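/- **Setting.** Let $n,k,\ell\ge 0$ be integers with $k\le \ell$. For a finite-dimensional real inner product space $V$ let $\mathrm{Alt}^{k,\ell}(V)=\mathrm{Alt}^k(V)\otimes\mathrm{Alt}^\ell(V)$ be the space of $\ell$-form-valued alternating $k$-forms, with the Frobenius inner product. Define $$\mathcal S_\dagger^{k,\ell}:\mathrm{Alt}^{k,\ell}(V)\to\mathrm{Alt}^{k-1,\ell+1}(V),\qquad \mathcal S_\dagger\omega(v_1,\dots,v_{k-1})(u_1,\dots,u_{\ell+1})=\sum_{j=1}^{\ell+1}(-1)^{j+1}\omega(u_j,v_1,\dots,v_{k-1})(u_1,\dots,\widehat{u_j},\dots,u_{\ell+1}),$$ which is zero for $k=0$, and $\mathbb W^{k,\ell}=\ker\mathcal S_\dagger^{k,\ell}$. With the Koszul operator $(\kappa b)(x)=b(x,\cdot,\dots,\cdot)$ in the first index let $\mathcal P^-\mathrm{Alt}^{k,\ell}=\mathrm{Alt}^{k,\ell}+\kappa\,\mathrm{Alt}^{k+1,\ell}$ (a space of polynomial fields of degree $\le 1$), and let $\mathcal P^-\mathbb W^{k,\ell}$ be the fields in $\mathcal P^-\mathrm{Alt}^{k,\ell}$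 with $\mathcal S_\dagger\omega=0$ pointwise. These spaces are defined on $\mathbb R^n$ and likewise, intrinsically, on every simplex $\sigma\subset\mathbb R^n$ (with $V$ the tangent space of $\sigma$). For a simplex $\sigma$, identified with its tangent space when convenient, $\iota_\sigma^*$ denotes pullback of forms to $\sigma$. For $m=\dim\sigma\le\ell$ the generalized trace $\jmath_\sigma^*:\mathrm{Alt}^\ell(\mathbb R^n)\to\mathrm{Alt}^{\ell-m}(\sigma^\perp)$ is $\jmath_\sigma^*\alpha(\nu_1,\dots,\nu_{\ell-m})=\alpha(e_1,\dots,e_m,\nu_1,\dots,\nu_{\ell-m})$, where $e_1,\dots,e_m$ is a fixed orthonormal frame of $\sigma$; for $m>\ell$ it is zero. $\iota_\sigma^*\jmath_\sigma^*$ and $\iota_\sigma^*\iota_\sigma^*$ act on $(k,\ell)$-form fields by $\iota_\sigma^*$ on the first index, by $\jmath_\sigma^*$ or $\iota_\sigma^*$ on the second, and by restriction of the field to $\sigma$. The bubbles $\mathcal B^-\mathrm{Alt}^{k,\ell}(\sigma)$ are the fields in $\mathcal P^-\mathrm{Alt}^{k,\ell}(\sigma)$ whose traces $\iota_\tau^*\iota_\tau^*$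 vanish on all proper subsimplices $\tau$ of $\sigma$, and $\mathcal B^-\mathbb W^{k,\ell}(\sigma)=\mathcal B^-\mathrm{Alt}^{k,\ell}(\sigma)\cap\ker\mathcal S_\dagger$. Let $\langle\cdot,\cdot\rangle_\sigma$ be the pointwise inner product integrated over $\sigma$ with respect to $\dim\sigma$-dimensional Lebesgue measure. **Claims.** Let $(\mathcal P,\mathcal B)$ be either $(\mathcal P^-\mathrm{Alt}^{k,\ell},\mathcal B^-\mathrm{Alt}^{k,\ell})$ or $(\mathcal P^-\mathbb W^{k,\ell},\mathcal B^-\mathbb W^{k,\ell})$. 1. (Unisolvence.) Let $K\subset\mathbb R^n$ be a nondegenerate $n$-simplex. The degrees of freedom $$\begin{cases}\langle\iota_\sigma^*\jmath_\sigma^*\omega,b\rangle_\sigma,\quad b\in\mathrm{Alt}^k(\sigma)\otimes\mathrm{Alt}^{\ell-k}(\sigma^\perp), & \sigma \text{ a subsimplex of } K,\ \dim\sigma=k,\\ \langle\iota_\sigma^*\iota_\sigma^*\omega,b\rangle_\sigma,\quad b\in\mathcal B(\sigma), & \sigma \text{ a subsimplex of } K,\ \dim\sigma>\ell,\end{cases}$$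 are unisolvent for $\mathcal P$: for every prescription of values depending linearly on $b$ on each $\sigma$ there is exactly one $\omega\in\mathcal P$ with these degrees of freedom. 2. (Conformity.) Let $\mathcal T$ be a simplicial complex in $\mathbb R^n$. The resulting finite element space consists of the families $(\omega_K)$, with $\omega_K\in\mathcal P$ for each $n$-simplex $K$ of $\mathcal T$, whose degrees of freedom are single-valued, i.e. agree for $\omega_K$ and $\omega_{K'}$ on every simplex shared by $K$ and $K'$. Every member is $\iota^*\jmath^*$-conforming: for every simplex $\sigma$ shared by $n$-simplices $K,K'$, $\iota_\sigma^*\jmath_\sigma^*\omega_K=\iota_\sigma^*\jmath_\sigma^*\omega_{K'}$ if $\dim\sigma\le\ell$, and $\iota_\sigma^*\iota_\sigma^*\omega_K=\iota_\sigma^*\iota_\sigma^*\omega_{K'}$ if $\dim\sigma\ge\ell$. 3. (Vector Lagrange element.) For $k=0$ the finite element space with shape functions $\mathcal P^-\mathrm{Alt}^{0,\ell}$ is the $\mathrm{Alt}^\ell$-valued Lagrange space: the families of affine $\mathrm{Alt}^\ell(\mathbb R^n)$-valued functions $(\omega_K)$ with $\omega_K=\omega_{K'}$ on $K\cap K'$.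 4. (Hu--Lin--Zhang element.) Let $n=3$, $(k,\ell)=(1,2)$, and identify a $(1,2)$-form $\omega$ with the matrix $U$ such that $\omega(v)(u_1,u_2)=v\cdot U(u_1\times u_2)$. Then $\mathcal P^-\mathbb W^{1,2}$ is the space $\mathbb T+x\times\mathbb S$ of fields $x\mapsto A+x\times S$ with $A$ traceless and $S$ symmetric ($x\times S$ is formed columnwise); on a tetrahedron there are two degrees of freedom on each edge and two in the interior, i.e. $\mathrm{Alt}^1(e)\otimes\mathrm{Alt}^1(e^\perp)$ and $\mathcal B^-\mathbb W^{1,2}(K)$ both have dimension $2$; and the finite element space with shape functions $\mathcal P^-\mathbb W^{1,2}$ consists of the families $(U_K)$ of such fields whose tangential--normal components $t\cdot U_K\nu$ ($t$ tangent to the edge, $\nu\perp t$) are single-valued on the edges. -/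

import Mathlib

open scoped MeasureTheory

noncomputable section

namespace TensorialWhitney

/-! ### Algebraic form-valued forms -/

section Algebra

variable {V V' M : Type*} [AddCommGroup V] [Module ℝ V] [AddCommGroup V'] [Module ℝ V']
  [AddCommGroup M] [Module ℝ M]

/-- `Alt^ℓ(V)`: alternating `ℓ`-forms on `V`. -/
abbrev Alt (V : Type*) [AddCommGroup V] [Module ℝ V] (ℓ : ℕ) : Type _ := V [⋀^Fin ℓ]→ₗ[ℝ] ℝ

/-- `Alt^k(V) ⊗ Alt^p(V')`, realised as alternating `k`-forms on `V` with values in the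
alternating `p`-forms on `V'`. -/
abbrev MixedAlt (V V' : Type*) [AddCommGroup V] [Module ℝ V] [AddCommGroup V'] [Module ℝ V']
    (k p : ℕ) : Type _ := V [⋀^Fin k]→ₗ[ℝ] Alt V' p

/-- `Alt^{k,ℓ}(V) = Alt^k(V) ⊗ Alt^ℓ(V)`: `ℓ`-form-valued `k`-forms on `V`. -/
abbrev AltAlt (V : Type*) [AddCommGroup V] [Module ℝ V] (k ℓ : ℕ) : Type _ := MixedAlt V V k ℓ

/-- Pullback of an `ℓ`-form along a linear map. -/
def pullAlt (f : V' →ₗ[ℝ] V) (ℓ : ℕ) : Alt V ℓ →ₗ[ℝ] Alt V' ℓ where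
  toFun α := α.compLinearMap f
  map_add' _ _ := rfl
  map_smul' _ _ := rfl

/-- Pull back the first (form) index along `f` and apply the linear map `g` to the second
(value) index. -/
def pairTrace (f : V' →ₗ[ℝ] V) {k ℓ : ℕ} (g : Alt V ℓ →ₗ[ℝ] M) :
    AltAlt V k ℓ →ₗ[ℝ] (V' [⋀^Fin k]→ₗ[ℝ] M) where
  toFun α := g.compAlternatingMap (α.compLinearMap f)
  map_add' α β := by ext; simp
  map_smul' c α := by ext; simp

/-- Contraction `u ↦ α(u, v₁, …, v_k)`, as an alternating function of `(v₁, …, v_k)`. -/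
def firstSlot {k : ℕ} (α : V [⋀^Fin (k + 1)]→ₗ[ℝ] M) : V [⋀^Fin k]→ₗ[ℝ] (V →ₗ[ℝ] M) where
  toFun v :=
    { toFun := fun u => α.curryLeft u v
      map_add' := fun _ _ => by simp
      map_smul' := fun _ _ => by simp }
  map_update_add' v i x y := by
    ext u
    exact (α.curryLeft u).map_update_add v i x y
  map_update_smul' v i c x := by
    ext u
    exact (α.curryLeft u).map_update_smul v i c x
  map_eq_zero_of_eq' v i j hv hij := by
    ext u
    exact (α.curryLeft u).map_eq_zero_of_eq v hv hij

/-- The operator `S_† : Alt^{k+1,ℓ} → Alt^{k,ℓ+1}`. -/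
def sDagger (k ℓ : ℕ) : AltAlt V (k + 1) ℓ →ₗ[ℝ] AltAlt V k (ℓ + 1) where
  toFun α := AlternatingMap.alternatizeUncurryFinLM.compAlternatingMap (firstSlot α)
  map_add' α β := by
    ext v u
    simp [firstSlot, AlternatingMap.alternatizeUncurryFin_apply, Finset.sum_add_distrib]
  map_smul' c α := by
    ext v u
    simp [firstSlot, AlternatingMap.alternatizeUncurryFin_apply, Finset.mul_sum, mul_left_comm]

/-- `S_† α (v₁,…,v_k)(u₁,…,u_{ℓ+1}) = ∑ⱼ (-1)^{j+1} α(uⱼ,v₁,…,v_k)(u₁,…,ûⱼ,…,u_{ℓ+1})`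
(the index `j` starts at `0` below). -/
theorem sDagger_apply {k ℓ : ℕ} (α : AltAlt V (k + 1) ℓ) (v : Fin k → V) (u : Fin (ℓ + 1) → V) :
    sDagger k ℓ α v u =
      ∑ j : Fin (ℓ + 1), (-1 : ℝ) ^ (j : ℕ) * α (Matrix.vecCons (u j) v) (j.removeNth u) := by
  simp [sDagger, firstSlot, AlternatingMap.alternatizeUncurryFin_apply]

/-- `𝕎^{k,ℓ} = ker S_†^{k,ℓ}`; since `Alt^{-1,ℓ+1} = 0`, it is everything for `k = 0`. -/
def symW (V : Type*) [AddCommGroup V] [Module ℝ V] :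
    (k ℓ : ℕ) → Submodule ℝ (AltAlt V k ℓ)
  | 0, _ => ⊤
  | k + 1, ℓ => LinearMap.ker (sDagger k ℓ)

/-- Fix the arguments of an alternating map in the left summand of its index type. -/
def fixLeft {ι ι' : Type*} (e : ι → V) : (V [⋀^ι ⊕ ι']→ₗ[ℝ] ℝ) →ₗ[ℝ] (V [⋀^ι']→ₗ[ℝ] ℝ) where
  toFun α :=
    { toFun := fun v => α (Sum.elim e v)
      map_update_add' := fun v i x y => by
        classical
        have h : ∀ z, Sum.elim e (Function.update v i z)
            = Function.update (Sum.elim e v) (Sum.inr i) z := fun z => by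
          funext t
          rcases t with t | t
          · simp [Function.update]
          · by_cases ht : t = i
            · subst ht; simp
            · simp [Function.update_of_ne, ht]
        rw [h, h, h]
        exact α.map_update_add _ _ _ _
      map_update_smul' := fun v i c x => by
        classical
        have h : ∀ z, Sum.elim e (Function.update v i z)
            = Function.update (Sum.elim e v) (Sum.inr i) z := fun z => by
          funext t
          rcases t with t | t
          · simp [Function.update]
          · by_cases ht : t = i
            · subst ht; simp
            · simp [Function.update_of_ne, ht]
        rw [h, h]
        exact α.map_update_smul _ _ _ _
      map_eq_zero_of_eq' := fun v i j hv hij =>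
        α.map_eq_zero_of_eq (Sum.elim e v) (i := Sum.inr i) (j := Sum.inr j) hv
          (fun h => hij (Sum.inr_injective h)) }
  map_add' _ _ := rfl
  map_smul' _ _ := rfl

end Algebra

/-! ### Generalized trace and inner product -/

section Metric

variable {E : Type*} [NormedAddCommGroup E] [InnerProductSpace ℝ E] [FiniteDimensional ℝ E]

/-- Reindexing of `m` tangential slots followed by `ℓ - m` normal slots. -/
def slotEquiv {m ℓ : ℕ} (h : m ≤ ℓ) : Fin ℓ ≃ Fin m ⊕ Fin (ℓ - m) :=
  (finSumFinEquiv.trans (finCongr (Nat.add_sub_cancel' h))).symm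

/-- The generalized trace `j_F^* : Alt^ℓ(E) → Alt^{ℓ - m}(F^⊥)`, `m = dim F`: the component with
all `m` tangential directions of `F` and `ℓ - m` normal ones, where `Alt^m(F)` is identified with
`ℝ` by evaluation on an orthonormal frame of `F` (the volume form is `1`). It is the zero map
if `m > ℓ`. -/
def jStar (F : Submodule ℝ E) (ℓ : ℕ) :
    Alt E ℓ →ₗ[ℝ] Alt (Fᗮ : Submodule ℝ E) (ℓ - Module.finrank ℝ F) :=
  if h : Module.finrank ℝ F ≤ ℓ then
    pullAlt (Fᗮ).subtype _ ∘ₗ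
      fixLeft (fun i => ((stdOrthonormalBasis ℝ F i : F) : E)) ∘ₗ
      (AlternatingMap.domDomCongrₗ ℝ (slotEquiv h)).toLinearMap
  else 0

/-- `j_F^* α (ν₁,…,ν_{ℓ-m}) = α(e₁,…,e_m,ν₁,…,ν_{ℓ-m})`. -/
theorem jStar_apply (F : Submodule ℝ E) {ℓ : ℕ} (h : Module.finrank ℝ F ≤ ℓ) (α : Alt E ℓ)
    (ν : Fin (ℓ - Module.finrank ℝ F) → (Fᗮ : Submodule ℝ E)) :
    jStar F ℓ α ν = α (fun i => Sum.elim
      (fun a => ((stdOrthonormalBasis ℝ F a : F) : E)) (fun b => (ν b : E)) (slotEquiv h i)) := by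
  simp only [jStar, h, dite_true]
  rfl

/-- The Frobenius inner product on `Alt^k(V) ⊗ Alt^p(V')`: the sum of the products of all
components with respect to orthonormal bases. -/
def frob {V V' : Type*} [NormedAddCommGroup V] [InnerProductSpace ℝ V] [FiniteDimensional ℝ V]
    [NormedAddCommGroup V'] [InnerProductSpace ℝ V'] [FiniteDimensional ℝ V'] {k p : ℕ}
    (α β : MixedAlt V V' k p) : ℝ :=
  ∑ I : Fin k → Fin (Module.finrank ℝ V), ∑ J : Fin p → Fin (Module.finrank ℝ V'),
    α (fun i => stdOrthonormalBasis ℝ V (I i)) (fun j => stdOrthonormalBasis ℝ V' (J j)) *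
    β (fun i => stdOrthonormalBasis ℝ V (I i)) (fun j => stdOrthonormalBasis ℝ V' (J j))

end Metric

/-! ### Fields on simplices

A simplex is given by its finite vertex set `σ`; the closed simplex is `convexHull ℝ σ`, its
tangent space is `vectorSpan ℝ σ`, and its subsimplices are the nonempty subsets of `σ`. -/

section Simplex

variable {E : Type*} [NormedAddCommGroup E] [InnerProductSpace ℝ E]

/-- The tangent space of a simplex. -/
abbrev tangent (σ : Finset E) : Submodule ℝ E := vectorSpan ℝ (σ : Set E)

/-- The dimension of a simplex. -/
abbrev simplexDim (σ : Finset E) : ℕ := Module.finrank ℝ (tangent σ)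

/-- The points of the closed simplex. -/
abbrev simplexPts (σ : Finset E) : Type _ := ↥(convexHull ℝ (σ : Set E))

/-- Fields of (intrinsic) `(k,ℓ)`-forms on the simplex `σ`. -/
abbrev SimplexField (σ : Finset E) (k ℓ : ℕ) : Type _ :=
  simplexPts σ → AltAlt (tangent σ) k ℓ

theorem sub_mem_tangent {σ : Finset E} (x y : simplexPts σ) : (x : E) - y ∈ tangent σ := by
  have h := convexHull_subset_affineSpan (𝕜 := ℝ) (σ : Set E)
  have := AffineSubspace.vsub_mem_direction (h x.2) (h y.2)
  rwa [direction_affineSpan] at this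

/-- The tangent vector from `y` to `x`. -/
def disp {σ : Finset E} (x y : simplexPts σ) : tangent σ := ⟨(x : E) - y, sub_mem_tangent x y⟩

/-- `P^- Alt^{k,ℓ} = Alt^{k,ℓ} + κ Alt^{k+1,ℓ}` on the whole space, with the Koszul operator
`(κ b)(x) = b(x, ·)`. -/
def PAlt (E : Type*) [NormedAddCommGroup E] [InnerProductSpace ℝ E] (k ℓ : ℕ) :
    Submodule ℝ (E → AltAlt E k ℓ) where
  carrier := {ω | ∃ (a : AltAlt E k ℓ) (b : AltAlt E (k + 1) ℓ), ∀ x, ω x = a + b.curryLeft x}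
  zero_mem' := ⟨0, 0, fun x => by simp⟩
  add_mem' := by
    rintro ω ω' ⟨a, b, h⟩ ⟨a', b', h'⟩
    exact ⟨a + a', b + b', fun x => by simp [h, h']; abel⟩
  smul_mem' := by
    rintro c ω ⟨a, b, h⟩
    exact ⟨c • a, c • b, fun x => by simp [h]⟩

/-- `P^- 𝕎^{k,ℓ} = ker (S_† on P^- Alt^{k,ℓ})`. -/
def PW (E : Type*) [NormedAddCommGroup E] [InnerProductSpace ℝ E] (k ℓ : ℕ) :
    Submodule ℝ (E → AltAlt E k ℓ) :=
  PAlt E k ℓ ⊓ Submodule.pi Set.univ (fun _ => symW E k ℓ)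

/-- `P^- Alt^{k,ℓ}(σ) = Alt^{k,ℓ} + κ Alt^{k+1,ℓ}` on a simplex. The space does not depend on the
origin `o ∈ σ` of the Koszul operator `(κ b)(x) = b(x - o, ·)`. -/
def simplexPAlt (σ : Finset E) (k ℓ : ℕ) : Submodule ℝ (SimplexField σ k ℓ) where
  carrier := {w | ∀ o : simplexPts σ, ∃ (a : AltAlt (tangent σ) k ℓ)
    (b : AltAlt (tangent σ) (k + 1) ℓ), ∀ x, w x = a + b.curryLeft (disp x o)}
  zero_mem' := fun o => ⟨0, 0, fun x => by simp⟩
  add_mem' := by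
    intro w w' h h' o
    obtain ⟨a, b, h⟩ := h o
    obtain ⟨a', b', h'⟩ := h' o
    exact ⟨a + a', b + b', fun x => by simp [h, h']; abel⟩
  smul_mem' := by
    intro c w h o
    obtain ⟨a, b, h⟩ := h o
    exact ⟨c • a, c • b, fun x => by simp [h]⟩

/-- The double trace `ι_τ^* ι_τ^*` of a field on `σ` to a subsimplex `τ ⊆ σ`. -/
def simplexTrace {τ σ : Finset E} (h : τ ⊆ σ) {k ℓ : ℕ} (w : SimplexField σ k ℓ) :
    SimplexField τ k ℓ :=
  fun x =>
    let f := Submodule.inclusion (vectorSpan_mono ℝ (Finset.coe_subset.2 h))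
    pairTrace f (pullAlt f ℓ) (w ⟨x, convexHull_mono (Finset.coe_subset.2 h) x.2⟩)

/-- The double trace `ι_σ^* ι_σ^*` of a field on the whole space to a simplex. -/
def traceII (σ : Finset E) {k ℓ : ℕ} (ω : E → AltAlt E k ℓ) : SimplexField σ k ℓ :=
  fun x => pairTrace (tangent σ).subtype (pullAlt (tangent σ).subtype ℓ) (ω x)

/-- The bubbles `B^- Alt^{k,ℓ}(σ)`: fields in `P^- Alt^{k,ℓ}(σ)` with vanishing double traces on
all proper subsimplices. -/
def BAlt (k ℓ : ℕ) (σ : Finset E) : Submodule ℝ (SimplexField σ k ℓ) where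
  carrier := {w | w ∈ simplexPAlt σ k ℓ ∧
    ∀ (τ : Finset E) (h : τ ⊆ σ), τ.Nonempty → τ ≠ σ → simplexTrace h w = 0}
  zero_mem' := ⟨zero_mem _, fun τ h _ _ => by ext; simp [simplexTrace]⟩
  add_mem' := by
    rintro w w' ⟨h, h0⟩ ⟨h', h0'⟩
    refine ⟨add_mem h h', fun τ hτ hn hne => ?_⟩
    have e : simplexTrace hτ (w + w') = simplexTrace hτ w + simplexTrace hτ w' := by
      funext x
      exact (pairTrace _ (pullAlt _ ℓ)).map_add _ _
    rw [e, h0 τ hτ hn hne, h0' τ hτ hn hne, add_zero]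
  smul_mem' := by
    rintro c w ⟨h, h0⟩
    refine ⟨Submodule.smul_mem _ c h, fun τ hτ hn hne => ?_⟩
    have e : simplexTrace hτ (c • w) = c • simplexTrace hτ w := by
      funext x
      exact (pairTrace _ (pullAlt _ ℓ)).map_smul c _
    rw [e, h0 τ hτ hn hne, smul_zero]

/-- The bubbles `B^- 𝕎^{k,ℓ}(σ) = ker (S_† on B^- Alt^{k,ℓ}(σ))`. -/
def BW (k ℓ : ℕ) (σ : Finset E) : Submodule ℝ (SimplexField σ k ℓ) :=
  BAlt k ℓ σ ⊓ Submodule.pi Set.univ (fun _ => symW (tangent σ) k ℓ)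

/-- The top-dimensional simplices of a triangulation. -/
abbrev Cell (T : Geometry.SimplicialComplex ℝ E) : Type _ :=
  {K : Finset E // K ∈ T.faces ∧ K.card = Module.finrank ℝ E + 1}

variable [FiniteDimensional ℝ E]

/-- The generalized trace `ι_σ^* j_σ^*`, with values in `Alt^k(σ) ⊗ Alt^{ℓ - dim σ}(σ^⊥)`. -/
def traceIJ (σ : Finset E) {k ℓ : ℕ} (ω : E → AltAlt E k ℓ) :
    simplexPts σ → MixedAlt (tangent σ) ((tangent σ)ᗮ : Submodule ℝ E) k (ℓ - simplexDim σ) :=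
  fun x => pairTrace (tangent σ).subtype (jStar (tangent σ) ℓ) (ω x)

/-- `ι^* j^*`-conformity: `ι^* j^*` is single-valued on the simplices of dimension `≤ ℓ`, and
`ι^* ι^*` on those of dimension `≥ ℓ`. -/
def IsIotaJConforming (T : Geometry.SimplicialComplex ℝ E) {k ℓ : ℕ}
    (ω : Cell T → E → AltAlt E k ℓ) : Prop :=
  ∀ (K K' : Cell T) (σ : Finset E), σ ⊆ K.1 → σ ⊆ K'.1 → σ.Nonempty →
    (simplexDim σ ≤ ℓ → traceIJ σ (ω K) = traceIJ σ (ω K')) ∧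
    (ℓ ≤ simplexDim σ → traceII σ (ω K) = traceII σ (ω K'))

/-- The constant test tensors `Alt^k(σ) ⊗ Alt^{ℓ - k}(σ^⊥)` of a simplex of dimension `k`. -/
abbrev SkeletalTest (σ : Finset E) (k ℓ : ℕ) : Type _ :=
  MixedAlt (tangent σ) ((tangent σ)ᗮ : Submodule ℝ E) k (ℓ - simplexDim σ)

variable [MeasurableSpace E] [BorelSpace E]

/-- The `dim σ`-dimensional Lebesgue measure of the simplex `σ` (point mass in dimension `0`). -/
def simplexMeasure (σ : Finset E) : MeasureTheory.Measure (simplexPts σ) :=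
  MeasureTheory.Measure.euclideanHausdorffMeasure (simplexDim σ)

/-- The moment `⟨ι_σ^* j_σ^* ω, b⟩_σ`. -/
def skeletalMoment (σ : Finset E) {k ℓ : ℕ} (ω : E → AltAlt E k ℓ) (b : SkeletalTest σ k ℓ) : ℝ :=
  ∫ x, frob (traceIJ σ ω x) b ∂(simplexMeasure σ)

/-- The moment `⟨ι_σ^* ι_σ^* ω, b⟩_σ`. -/
def bubbleMoment (σ : Finset E) {k ℓ : ℕ} (ω : E → AltAlt E k ℓ) (b : SimplexField σ k ℓ) : ℝ :=
  ∫ x, frob (traceII σ ω x) (b x) ∂(simplexMeasure σ)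

/-! ### Unisolvence, finite element spaces, conformity -/

/-- Unisolvence on the cell `K`, for the shape functions `P`, of the degrees of freedom
* `⟨ι_σ^* j_σ^* ω, b⟩_σ`, `b ∈ Alt^k(σ) ⊗ Alt^{ℓ-k}(σ^⊥)`, for the subsimplices with `dim σ = k`,
* `⟨ι_σ^* ι_σ^* ω, b⟩_σ`, `b ∈ B σ`, for the subsimplices with `dim σ > ℓ`:

any values of the moments, linear in the test tensor on each subsimplex, are attained by exactly
one shape function. -/
def IsUnisolvent (K : Finset E) {k ℓ : ℕ} (P : Submodule ℝ (E → AltAlt E k ℓ))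
    (B : (σ : Finset E) → Submodule ℝ (SimplexField σ k ℓ)) : Prop :=
  ∀ (f : (σ : Finset E) → Module.Dual ℝ (SkeletalTest σ k ℓ))
    (g : (σ : Finset E) → Module.Dual ℝ (B σ)),
    ∃! ω : E → AltAlt E k ℓ, ω ∈ P ∧
      (∀ σ ⊆ K, σ.Nonempty → simplexDim σ = k → ∀ b, skeletalMoment σ ω b = f σ b) ∧
      (∀ σ ⊆ K, σ.Nonempty → ℓ < simplexDim σ → ∀ b : B σ, bubbleMoment σ ω b = g σ b)

/-- The finite element space: piecewise shape functions whose degrees of freedom on every simplex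
are single-valued. -/
def feSpace (T : Geometry.SimplicialComplex ℝ E) {k ℓ : ℕ} (P : Submodule ℝ (E → AltAlt E k ℓ))
    (B : (σ : Finset E) → Submodule ℝ (SimplexField σ k ℓ)) :
    Set (Cell T → E → AltAlt E k ℓ) :=
  {ω | (∀ K, ω K ∈ P) ∧
    ∀ (K K' : Cell T) (σ : Finset E), σ ⊆ K.1 → σ ⊆ K'.1 → σ.Nonempty →
      (simplexDim σ = k → ∀ b, skeletalMoment σ (ω K) b = skeletalMoment σ (ω K') b) ∧
      (ℓ < simplexDim σ → ∀ b ∈ B σ, bubbleMoment σ (ω K) b = bubbleMoment σ (ω K') b)}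

end Simplex

/-! ### Matrix proxies of `(1,2)`-forms in three dimensions -/

/-- The matrix field `U` is the proxy of the field `ω` of `(1,2)`-forms:
`ω(v)(u₁,u₂) = v · U (u₁ × u₂)`. -/
def IsProxy (ω : EuclideanSpace ℝ (Fin 3) → AltAlt (EuclideanSpace ℝ (Fin 3)) 1 2)
    (U : EuclideanSpace ℝ (Fin 3) → Matrix (Fin 3) (Fin 3) ℝ) : Prop :=
  ∀ x v u, ω x v u =
    (v 0).ofLp ⬝ᵥ ((U x).mulVec (crossProduct (u 0).ofLp (u 1).ofLp))

/-- The matrix `x × S`, whose columns are the cross products of `x` with the columns of `S`. -/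
def crossMatrix (x : EuclideanSpace ℝ (Fin 3)) (S : Matrix (Fin 3) (Fin 3) ℝ) :
    Matrix (Fin 3) (Fin 3) ℝ :=
  Matrix.of fun i j => crossProduct x.ofLp (fun r => S r j) i

/-- The shape functions `𝕋 + x × 𝕊` of the Hu--Lin--Zhang element: `A + x × S` with `A` traceless
and `S` symmetric. -/
def IsHLZShape (U : EuclideanSpace ℝ (Fin 3) → Matrix (Fin 3) (Fin 3) ℝ) : Prop :=
  ∃ A S : Matrix (Fin 3) (Fin 3) ℝ, A.trace = 0 ∧ S.IsSymm ∧ ∀ x, U x = A + crossMatrix x S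

end TensorialWhitney

end

open TensorialWhitney

open scoped MeasureTheory
open TensorialWhitney
noncomputable section
namespace TensorialWhitney
set_option maxSynthPendingDepth 3

/-! ### The measure of a simplex -/

section Measure

variable {E : Type*} [NormedAddCommGroup E] [InnerProductSpace ℝ E] {σ : Finset E}

/-! In barycentric coordinates λ of a cell, every ω in `PAlt` has the form ω(x)(v) = B(λ(x), dλ v)
for an alternating (k+1)-form B on homogeneous coordinates with values in Alt^ℓ (`exists_eq_homog`).
The component of B at vertices f₀,…,f_k is the value of ω at f₀ on the edges leaving f₀
(`homog_vertex`). So the restriction of the form index to a face sees only the components indexed by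
its vertices, and everything reduces to finite algebra.

Vanishing. On a k-face the trace ι^*j^* is constant, so its moments determine it. A form whose
generalized trace on F is zero vanishes on every family of vectors whose span contains F
(`map_eq_zero_of_jStar`). Applied to the components of B, this carries vanishing from the k-faces to
ι^*j^* on faces of dimension ≤ ℓ and to ι^*ι^* in dimension ℓ. Below ℓ there are no nonzero ℓ-forms.
Above ℓ the double trace is, by induction, a bubble orthogonal to all bubbles, hence zero
(`traceII_eq_zero_of_moments`). On a whole cell this is uniqueness; for the difference of two
neighbouring fields on a shared simplex it is conformity.

Existence. Each degree of freedom is realised by a field that does not disturb the skeletal ones or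
the bubble ones on other faces of at most the same dimension, so the system is triangular in the
dimension. A skeletal value on F extends as a constant field, of which only the components with
index set F are kept. A bubble on σ is represented by terms e^f ⊗ e^g whose indices together exhaust
the vertices of σ (`exists_exactSupport`); such terms have no double trace on faces not containing
σ, and a count of vertices shows that the k-faces do not see them either.

For the kernel of S_†, such an extension ω is corrected by a field with the same image under S_† and
no relevant degrees of freedom. On homogeneous tensors S_† preserves the exact support, and the sl₂
relation `sDagger_sUp` together with the adjointness of S and S_† makes S_†S positive definite in
the degrees that occur when k ≤ ℓ. Hence tensors lift through S_† with unchanged support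
(`exists_sDagger_eq`), and the correction is assembled over faces of increasing dimension
(`exists_sDagger_eq_of_traceII`).

The Lagrange case is evaluation at vertices. The Hu–Lin–Zhang case is a translation to matrices plus
the count 14 = 6·2 + 2. -/

theorem isometry_disp (o : simplexPts σ) : Isometry (fun x : simplexPts σ => disp x o) := by
  refine Isometry.of_dist_eq fun x y => ?_
  rw [Subtype.dist_eq, Subtype.dist_eq]
  simp [disp]

theorem range_disp (o : simplexPts σ) : Set.range (fun x : simplexPts σ => disp x o) =
    {y : tangent σ | (y : E) + o ∈ convexHull ℝ (σ : Set E)} := by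
  ext y
  constructor
  · rintro ⟨x, rfl⟩
    simp [disp]
  · intro hy
    refine ⟨⟨_, hy⟩, ?_⟩
    ext
    simp [disp]

theorem convex_range_disp (o : simplexPts σ) :
    Convex ℝ (Set.range (fun x : simplexPts σ => disp x o)) := by
  rw [range_disp]
  intro y hy z hz a b ha hb hab
  have := convex_convexHull ℝ (σ : Set E) hy hz ha hb hab
  simp only [Set.mem_ofPred_eq]
  convert this using 1
  simp only [Submodule.coe_add, Submodule.coe_smul, smul_add]
  nth_rewrite 1 [← one_smul ℝ (o : E)]
  rw [← hab, add_smul]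
  abel

variable [FiniteDimensional ℝ E]

theorem interior_range_disp_nonempty (o : simplexPts σ) :
    (interior (Set.range (fun x : simplexPts σ => disp x o))).Nonempty := by
  rw [(convex_range_disp o).interior_nonempty_iff_affineSpan_eq_top]
  have hne : (Set.range (fun x : simplexPts σ => disp x o)).Nonempty := ⟨_, o, rfl⟩
  rw [AffineSubspace.affineSpan_eq_top_iff_vectorSpan_eq_top_of_nonempty _ _ _ hne]
  have key : tangent σ ≤ (vectorSpan ℝ (Set.range (fun x : simplexPts σ => disp x o))).map
      (tangent σ).subtype := by
    refine Submodule.span_le.2 ?_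
    rintro _ ⟨p, hp, q, hq, rfl⟩
    refine ⟨disp ⟨p, subset_convexHull ℝ _ hp⟩ o -ᵥ disp ⟨q, subset_convexHull ℝ _ hq⟩ o,
      vsub_mem_vectorSpan ℝ ⟨_, rfl⟩ ⟨_, rfl⟩, ?_⟩
    simp [disp]
  rw [eq_top_iff]
  intro y _
  obtain ⟨z, hz, hzy⟩ := key y.2
  have : z = y := Subtype.ext hzy
  rwa [← this]

instance compactSpace_simplexPts : CompactSpace (simplexPts σ) :=
  isCompact_iff_compactSpace.1 (σ.finite_toSet.isCompact_convexHull (𝕜 := ℝ))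

variable [MeasurableSpace E] [BorelSpace E]

instance isFiniteMeasure_simplexMeasure : MeasureTheory.IsFiniteMeasure (simplexMeasure σ) := by
  constructor
  rcases isEmpty_or_nonempty (simplexPts σ) with h | ⟨⟨o⟩⟩
  · simp [Set.univ_eq_empty_iff.2 h]
  · rw [simplexMeasure, ← (isometry_disp o).euclideanHausdorffMeasure_image, Set.image_univ]
    exact (isCompact_range (isometry_disp o).continuous).measure_lt_top

/-- Displacement from a base point maps the simplex isometrically onto a convex body with nonempty
interior in its tangent space, where the measure charges open sets. This is what makes the L²
pairing of continuous fields definite. -/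
instance isOpenPosMeasure_simplexMeasure : (simplexMeasure σ).IsOpenPosMeasure := by
  constructor
  rintro U hU ⟨o, ho⟩
  rw [simplexMeasure, ← (isometry_disp o).euclideanHausdorffMeasure_image]
  obtain ⟨V, hV, rfl⟩ := (isometry_disp o).isEmbedding.isOpen_iff.1 hU
  rw [Set.image_preimage_eq_inter_range]
  -- The image is not open, but a convex set with interior points lies in the closure of its
  -- interior, so a neighbourhood of a boundary point still meets the interior.
  have hcl := (convex_range_disp o).closure_interior_eq_closure_of_nonempty_interior
    (interior_range_disp_nonempty o)
  have hmem : disp o o ∈ closure (interior (Set.range (fun x : simplexPts σ => disp x o))) := by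
    rw [hcl]; exact subset_closure ⟨o, rfl⟩
  obtain ⟨z, hzV, hzI⟩ := mem_closure_iff.1 hmem V hV ho
  have hpos := (hV.inter isOpen_interior).measure_pos
    (MeasureTheory.Measure.euclideanHausdorffMeasure (simplexDim σ) :
      MeasureTheory.Measure (tangent σ)) ⟨z, hzV, hzI⟩
  exact (hpos.trans_le (MeasureTheory.measure_mono
    (Set.inter_subset_inter_right _ interior_subset))).ne'

end Measure


/-! ### Alternating maps in coordinates -/

instance finite_alternatingMap {V M : Type*} [AddCommGroup V] [Module ℝ V] [Module.Finite ℝ V]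
    [AddCommGroup M] [Module ℝ M] [Module.Finite ℝ M] (k : ℕ) :
    Module.Finite ℝ (V [⋀^Fin k]→ₗ[ℝ] M) :=
  Module.Finite.of_injective
    ({ toFun := fun f => f.toMultilinearMap
       map_add' := fun _ _ => rfl
       map_smul' := fun _ _ => rfl } :
      (V [⋀^Fin k]→ₗ[ℝ] M) →ₗ[ℝ] MultilinearMap ℝ (fun _ : Fin k => V) M)
    AlternatingMap.coe_multilinearMap_injective

theorem alternatingMap_sum_apply {V M κ : Type*} [AddCommGroup V] [Module ℝ V] [AddCommGroup M]
    [Module ℝ M] {k : ℕ} (s : Finset κ) (f : κ → V [⋀^Fin k]→ₗ[ℝ] M) (v : Fin k → V) :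
    (∑ a ∈ s, f a) v = ∑ a ∈ s, f a v := by
  classical
  induction s using Finset.induction_on with
  | empty => simp
  | insert a s ha ih =>
    rw [Finset.sum_insert ha, Finset.sum_insert ha, AlternatingMap.add_apply, ih]

section Coordinates

variable {ι : Type*} [Fintype ι] [DecidableEq ι] {M : Type*} [AddCommGroup M] [Module ℝ M]

/-- The family of coordinate vectors with indices `f`. -/
abbrev coordVec {p : ℕ} (f : Fin p → ι) : Fin p → ι → ℝ := fun s => Pi.single (f s) 1

theorem map_eq_sum_coordVec {p : ℕ} (α : (ι → ℝ) [⋀^Fin p]→ₗ[ℝ] M) (x : Fin p → ι → ℝ) :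
    α x = ∑ f : Fin p → ι, (∏ s, x s (f s)) • α (coordVec f) := by
  have h : x = fun s => ∑ i, x s i • (Pi.single i (1 : ℝ) : ι → ℝ) := by
    funext s
    conv_lhs => rw [pi_eq_sum_univ' (x s)]
  conv_lhs => rw [h]
  rw [← AlternatingMap.coe_multilinearMap, MultilinearMap.map_sum]
  refine Finset.sum_congr rfl fun f _ => ?_
  rw [MultilinearMap.map_smul_univ]

theorem ext_coordVec {p : ℕ} {α β : (ι → ℝ) [⋀^Fin p]→ₗ[ℝ] M}
    (h : ∀ f : Fin p → ι, α (coordVec f) = β (coordVec f)) : α = β := by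
  ext x
  rw [map_eq_sum_coordVec α, map_eq_sum_coordVec β]
  exact Finset.sum_congr rfl fun f _ => by rw [h]

/-- The mechanism behind all vanishing traces: points and tangent vectors of a face have coordinates
supported on its vertices, so only the components indexed by those vertices matter. -/
theorem map_eq_zero_of_support {p : ℕ} (α : (ι → ℝ) [⋀^Fin p]→ₗ[ℝ] M) {τ : Set ι}
    (h : ∀ f : Fin p → ι, (∀ s, f s ∈ τ) → α (coordVec f) = 0) {x : Fin p → ι → ℝ}
    (hx : ∀ s, ∀ i ∉ τ, x s i = 0) : α x = 0 := by
  rw [map_eq_sum_coordVec]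
  refine Finset.sum_eq_zero fun f _ => ?_
  by_cases hf : ∀ s, f s ∈ τ
  · rw [h f hf, smul_zero]
  · push Not at hf
    obtain ⟨s, hs⟩ := hf
    rw [Finset.prod_eq_zero (Finset.mem_univ s) (hx s _ hs), zero_smul]

/-- The alternating map `∑_f e^{f_1} ∧ ⋯ ∧ e^{f_p} ⊗ β_f`. -/
def altOfCoeff {p : ℕ} (β : (Fin p → ι) → M) : (ι → ℝ) [⋀^Fin p]→ₗ[ℝ] M :=
  ∑ f : Fin p → ι, (LinearMap.toSpanSingleton ℝ M (β f)).compAlternatingMap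
    (Matrix.detRowAlternating.compLinearMap (LinearMap.funLeft ℝ ℝ f))

omit [DecidableEq ι] in
theorem altOfCoeff_apply {p : ℕ} (β : (Fin p → ι) → M) (x : Fin p → ι → ℝ) :
    altOfCoeff β x = ∑ f : Fin p → ι, (Matrix.of fun s t => x s (f t)).det • β f := by
  rw [altOfCoeff, alternatingMap_sum_apply]
  rfl

/-- In the Leibniz expansion of the determinant the term of π survives only for f = h ∘ π. So
`altOfCoeff` antisymmetrizes arbitrary coefficients. -/
theorem altOfCoeff_coordVec {p : ℕ} (β : (Fin p → ι) → M) (h : Fin p → ι) :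
    altOfCoeff β (coordVec h) =
      ∑ π : Equiv.Perm (Fin p), ((Equiv.Perm.sign π : ℤ) : ℝ) • β (h ∘ π) := by
  rw [altOfCoeff_apply]
  have key : ∀ f : Fin p → ι, (Matrix.of fun s t => coordVec h s (f t)).det • β f =
      ∑ π : Equiv.Perm (Fin p), if f = h ∘ π then ((Equiv.Perm.sign π : ℤ) : ℝ) • β f else 0 := by
    intro f
    rw [Matrix.det_apply, Finset.sum_smul]
    refine Finset.sum_congr rfl fun π _ => ?_
    split_ifs with hf
    · subst hf
      simp [Units.smul_def]
    · have : ∃ t, f t ≠ h (π t) := by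
        by_contra! hc
        exact hf (funext hc)
      obtain ⟨t, ht⟩ := this
      rw [Finset.prod_eq_zero (Finset.mem_univ t) (by simp [coordVec, Pi.single_apply, ht])]
      simp
  rw [Finset.sum_congr rfl fun f _ => key f, Finset.sum_comm]
  simp

/-- Coefficients which are already alternating are recovered up to the factor `p!`. -/
theorem altOfCoeff_coordVec_of_alternating {p : ℕ} (β : (Fin p → ι) → M)
    (hβ : ∀ (f : Fin p → ι) (π : Equiv.Perm (Fin p)),
      β (f ∘ π) = ((Equiv.Perm.sign π : ℤ) : ℝ) • β f) (h : Fin p → ι) :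
    altOfCoeff β (coordVec h) = (p.factorial : ℝ) • β h := by
  rw [altOfCoeff_coordVec]
  have : ∀ π : Equiv.Perm (Fin p), ((Equiv.Perm.sign π : ℤ) : ℝ) • β (h ∘ π) = β h := by
    intro π
    rw [hβ, smul_smul, ← Int.cast_mul, Int.units_coe_mul_self, Int.cast_one, one_smul]
  simp [this, Fintype.card_perm, Nat.cast_smul_eq_nsmul]

omit [Fintype ι] in
theorem map_coordVec_comp_perm {p : ℕ} (α : (ι → ℝ) [⋀^Fin p]→ₗ[ℝ] M) (f : Fin p → ι)
    (π : Equiv.Perm (Fin p)) :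
    α (coordVec (f ∘ π)) = ((Equiv.Perm.sign π : ℤ) : ℝ) • α (coordVec f) := by
  have := α.map_perm (coordVec f) π
  rw [Units.smul_def, ← Int.cast_smul_eq_zsmul ℝ] at this
  exact this

end Coordinates

/-! ### The adjoint of `S_†` and surjectivity -/

section Adjoint

variable {V : Type*} [AddCommGroup V] [Module ℝ V]

/-- Contraction of the value index with a vector. -/
def contractValue (ℓ : ℕ) : V →ₗ[ℝ] Alt V (ℓ + 1) →ₗ[ℝ] Alt V ℓ where
  toFun y :=
    { toFun := fun α => α.curryLeft y
      map_add' := fun _ _ => by simp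
      map_smul' := fun _ _ => by simp }
  map_add' _ _ := by
    ext α v
    exact congrArg (fun β : Alt V ℓ => β v) (α.curryLeft.map_add _ _)
  map_smul' _ _ := by
    ext α v
    exact congrArg (fun β : Alt V ℓ => β v) (α.curryLeft.map_smul _ _)

@[simp]
theorem contractValue_apply {ℓ : ℕ} (y : V) (α : Alt V (ℓ + 1)) (v : Fin ℓ → V) :
    contractValue ℓ y α v = α (Matrix.vecCons y v) := rfl

/-- The operator `S : Alt^{k,ℓ+1} → Alt^{k+1,ℓ}`, adjoint to `S_†` up to a constant. -/
def sUp (k ℓ : ℕ) : AltAlt V k (ℓ + 1) →ₗ[ℝ] AltAlt V (k + 1) ℓ where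
  toFun α := AlternatingMap.alternatizeUncurryFin
    { toFun := fun y => (contractValue ℓ y).compAlternatingMap α
      map_add' := fun _ _ => by ext; simp
      map_smul' := fun _ _ => by ext; simp }
  map_add' α β := by
    ext v u
    simp [AlternatingMap.alternatizeUncurryFin_apply, Finset.sum_add_distrib,
      alternatingMap_sum_apply]
  map_smul' c α := by
    ext v u
    simp [AlternatingMap.alternatizeUncurryFin_apply, alternatingMap_sum_apply,
      Finset.mul_sum, mul_left_comm]

theorem sUp_apply {k ℓ : ℕ} (α : AltAlt V k (ℓ + 1)) (v : Fin (k + 1) → V) (u : Fin ℓ → V) :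
    sUp k ℓ α v u = ∑ j : Fin (k + 1), (-1 : ℝ) ^ (j : ℕ) *
      α (j.removeNth v) (Matrix.vecCons (v j) u) := by
  simp [sUp, AlternatingMap.alternatizeUncurryFin_apply, alternatingMap_sum_apply]

theorem neg_one_pow_mul_map_vecCons_removeNth {ℓ : ℕ} (α : Alt V (ℓ + 1)) (u : Fin (ℓ + 1) → V)
    (j : Fin (ℓ + 1)) :
    (-1 : ℝ) ^ (j : ℕ) * α (Matrix.vecCons (u j) (j.removeNth u)) = α u := by
  have h := α.neg_one_pow_smul_map_insertNth j (u j) (j.removeNth u)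
  rw [Fin.insertNth_self_removeNth] at h
  rw [← h]
  rw [zsmul_eq_mul]
  push_cast
  rw [← mul_assoc, ← mul_pow]
  simp

theorem removeNth_succ_vecCons {α : Type*} {n : ℕ} (a : α) (f : Fin (n + 1) → α)
    (i : Fin (n + 1)) :
    i.succ.removeNth (Matrix.vecCons a f) = Matrix.vecCons a (i.removeNth f) := by
  funext t
  refine Fin.cases ?_ (fun s => ?_) t <;> simp [Fin.removeNth, Matrix.vecCons]

theorem removeNth_zero_vecCons {α : Type*} {n : ℕ} (a : α) (f : Fin n → α) :
    (0 : Fin (n + 1)).removeNth (Matrix.vecCons a f) = f := by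
  funext t
  simp [Fin.removeNth, Matrix.vecCons]

/-- The `sl₂` relation between `S` and `S_†`. -/
theorem sDagger_sUp (k ℓ : ℕ) (B : AltAlt V (k + 1) (ℓ + 1)) :
    sDagger (k + 1) ℓ (sUp (k + 1) ℓ B) =
      sUp k (ℓ + 1) (sDagger k (ℓ + 1) B) + ((ℓ : ℝ) - k) • B := by
  ext v u
  -- Expanding S after inserting u_j, the term that takes u_j out again restores B v u; the others
  -- form a double sum over exchanged pairs. The same double sum appears in h2, so it cancels, and
  -- the multiplicities ℓ + 1 and k + 1 of B leave ℓ - k.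
  have h1 : ∀ (j : Fin (ℓ + 1)), (-1 : ℝ) ^ (j : ℕ) *
      sUp (k + 1) ℓ B (Matrix.vecCons (u j) v) (j.removeNth u) =
      B v u - ∑ i : Fin (k + 1), (-1 : ℝ) ^ (j : ℕ) * ((-1 : ℝ) ^ (i : ℕ) *
        B (Matrix.vecCons (u j) (i.removeNth v)) (Matrix.vecCons (v i) (j.removeNth u))) := by
    intro j
    rw [sUp_apply, Fin.sum_univ_succ, mul_add]
    simp only [removeNth_zero_vecCons, removeNth_succ_vecCons, Matrix.cons_val_zero,
      Matrix.cons_val_succ, Fin.val_zero, pow_zero, one_mul, Fin.val_succ]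
    rw [neg_one_pow_mul_map_vecCons_removeNth, sub_eq_add_neg, Finset.mul_sum,
      ← Finset.sum_neg_distrib]
    congr 1
    refine Finset.sum_congr rfl fun i _ => ?_
    ring
  have h2 : ∀ (i : Fin (k + 1)), (-1 : ℝ) ^ (i : ℕ) *
      sDagger k (ℓ + 1) B (i.removeNth v) (Matrix.vecCons (v i) u) =
      B v u - ∑ j : Fin (ℓ + 1), (-1 : ℝ) ^ (j : ℕ) * ((-1 : ℝ) ^ (i : ℕ) *
        B (Matrix.vecCons (u j) (i.removeNth v)) (Matrix.vecCons (v i) (j.removeNth u))) := by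
    intro i
    rw [sDagger_apply, Fin.sum_univ_succ, mul_add]
    simp only [removeNth_zero_vecCons, removeNth_succ_vecCons, Matrix.cons_val_zero,
      Matrix.cons_val_succ, Fin.val_zero, pow_zero, one_mul, Fin.val_succ]
    have h := B.neg_one_pow_smul_map_insertNth i (v i) (i.removeNth v)
    rw [Fin.insertNth_self_removeNth] at h
    have h' : (-1 : ℝ) ^ (i : ℕ) * B (Matrix.vecCons (v i) (i.removeNth v)) u = B v u := by
      rw [← h, ← Int.cast_smul_eq_zsmul ℝ, AlternatingMap.smul_apply, smul_eq_mul]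
      push_cast
      rw [← mul_assoc, ← mul_pow]
      simp
    rw [h', sub_eq_add_neg, Finset.mul_sum, ← Finset.sum_neg_distrib]
    congr 1
    refine Finset.sum_congr rfl fun i _ => ?_
    ring
  rw [sDagger_apply, Finset.sum_congr rfl fun j _ => h1 j]
  simp only [AlternatingMap.add_apply, AlternatingMap.smul_apply, smul_eq_mul]
  rw [sUp_apply, Finset.sum_congr rfl fun j _ => h2 j, Finset.sum_sub_distrib,
    Finset.sum_sub_distrib, Finset.sum_comm]
  simp
  ring

end Adjoint


/-! ### Lifting through `S_†` with prescribed support -/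

section Surjectivity

variable {ι : Type*} [Fintype ι] [DecidableEq ι]

/-- The tensors in `Alt^{p,q}(ℝ^ι)` spanned by `e^f ⊗ e^g` with `range f ∪ range g = σ`. -/
def exactSupport (σ : Set ι) (p q : ℕ) : Submodule ℝ (AltAlt (ι → ℝ) p q) where
  carrier := {B | ∀ (f : Fin p → ι) (g : Fin q → ι), Set.range f ∪ Set.range g ≠ σ →
    B (coordVec f) (coordVec g) = 0}
  zero_mem' := fun _ _ _ => rfl
  add_mem' := fun hB hC f g h => by simp [hB f g h, hC f g h]
  smul_mem' := fun c B hB f g h => by simp [hB f g h]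

omit [Fintype ι] in
theorem coordVec_vecCons {p : ℕ} (a : ι) (f : Fin p → ι) :
    Matrix.vecCons (coordVec (fun _ : Fin 1 => a) 0) (coordVec f) =
      coordVec (Matrix.vecCons a f) := by
  funext t
  refine Fin.cases rfl (fun s => rfl) t

omit [Fintype ι] in
theorem sDagger_coordVec {p q : ℕ} (B : AltAlt (ι → ℝ) (p + 1) q) (f : Fin p → ι)
    (g : Fin (q + 1) → ι) : sDagger p q B (coordVec f) (coordVec g) =
      ∑ j : Fin (q + 1), (-1 : ℝ) ^ (j : ℕ) *
        B (coordVec (Matrix.vecCons (g j) f)) (coordVec (j.removeNth g)) := by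
  rw [sDagger_apply]
  refine Finset.sum_congr rfl fun j _ => ?_
  rw [← coordVec_vecCons]
  rfl

omit [Fintype ι] in
theorem sUp_coordVec {p q : ℕ} (B : AltAlt (ι → ℝ) p (q + 1)) (f : Fin (p + 1) → ι)
    (g : Fin q → ι) : sUp p q B (coordVec f) (coordVec g) =
      ∑ j : Fin (p + 1), (-1 : ℝ) ^ (j : ℕ) *
        B (coordVec (j.removeNth f)) (coordVec (Matrix.vecCons (f j) g)) := by
  rw [sUp_apply]
  refine Finset.sum_congr rfl fun j _ => ?_
  rw [← coordVec_vecCons]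
  rfl

/-- S and S_† only move an index from one tensor factor to the other, which does not change the
union of the index sets. Hence both preserve `exactSupport`. -/
theorem range_union_vecCons_removeNth {α : Type*} {p q : ℕ} (f : Fin p → α)
    (g : Fin (q + 1) → α) (j : Fin (q + 1)) :
    Set.range (Matrix.vecCons (g j) f) ∪ Set.range (j.removeNth g) =
      Set.range f ∪ Set.range g := by
  have h : Set.range g = insert (g j) (Set.range (j.removeNth g)) := by
    conv_lhs => rw [← Fin.insertNth_self_removeNth j g]
    exact Fin.range_insertNth (α := α) _ _ _
  rw [h, Matrix.range_cons]
  ext x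
  simp only [Set.mem_union, Set.mem_insert_iff]
  tauto

omit [Fintype ι] in
theorem sDagger_mem_exactSupport {σ : Set ι} {p q : ℕ} {B : AltAlt (ι → ℝ) (p + 1) q}
    (hB : B ∈ exactSupport σ (p + 1) q) : sDagger p q B ∈ exactSupport σ p (q + 1) := by
  intro f g h
  rw [sDagger_coordVec]
  refine Finset.sum_eq_zero fun j _ => ?_
  rw [hB _ _ (by rwa [range_union_vecCons_removeNth]), mul_zero]

omit [Fintype ι] in
theorem sUp_mem_exactSupport {σ : Set ι} {p q : ℕ} {B : AltAlt (ι → ℝ) p (q + 1)}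
    (hB : B ∈ exactSupport σ p (q + 1)) : sUp p q B ∈ exactSupport σ (p + 1) q := by
  intro f g h
  rw [sUp_coordVec]
  refine Finset.sum_eq_zero fun j _ => ?_
  rw [hB _ _ (by rwa [Set.union_comm, range_union_vecCons_removeNth, Set.union_comm]), mul_zero]

/-- The sum of the products of all components. -/
def coordInner {p q : ℕ} (B C : AltAlt (ι → ℝ) p q) : ℝ :=
  ∑ f : Fin p → ι, ∑ g : Fin q → ι,
    B (coordVec f) (coordVec g) * C (coordVec f) (coordVec g)

theorem coordInner_self_nonneg {p q : ℕ} (B : AltAlt (ι → ℝ) p q) : 0 ≤ coordInner B B :=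
  Finset.sum_nonneg fun _ _ => Finset.sum_nonneg fun _ _ => mul_self_nonneg _

theorem eq_zero_of_coordInner_self {p q : ℕ} {B : AltAlt (ι → ℝ) p q}
    (h : coordInner B B = 0) : B = 0 := by
  refine ext_coordVec fun f => ext_coordVec fun g => ?_
  have h1 := (Finset.sum_eq_zero_iff_of_nonneg fun f _ =>
    Finset.sum_nonneg fun g _ => mul_self_nonneg _).1 h f (Finset.mem_univ _)
  have h2 := (Finset.sum_eq_zero_iff_of_nonneg fun g _ => mul_self_nonneg _).1 h1 g
    (Finset.mem_univ _)
  exact mul_self_eq_zero.1 h2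

omit [DecidableEq ι] in
theorem sum_eq_sum_removeNth {N : Type*} [AddCommMonoid N] {p : ℕ} (j : Fin (p + 1))
    (F : (Fin (p + 1) → ι) → N) :
    ∑ f, F f = ∑ a : ι, ∑ f : Fin p → ι, F (j.insertNth a f) := by
  rw [← Finset.sum_product', Finset.univ_product_univ,
    ← (Fin.insertNthEquiv (fun _ : Fin (p + 1) => ι) j).sum_comp]
  rfl

/-- Each of the p + 1 slots contributes equally: the sign of the slot cancels against the sign of
moving its argument to the front of Z. The same sum occurs in `coordInner_sDagger` with factor q +
1, so S and S_† are adjoint up to a positive constant. -/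
theorem coordInner_sUp {p q : ℕ} (X : AltAlt (ι → ℝ) p (q + 1)) (Z : AltAlt (ι → ℝ) (p + 1) q) :
    coordInner (sUp p q X) Z = (p + 1) * ∑ a : ι, ∑ f : Fin p → ι, ∑ g : Fin q → ι,
      X (coordVec f) (coordVec (Matrix.vecCons a g)) *
      Z (coordVec (Matrix.vecCons a f)) (coordVec g) := by
  have h : ∀ j : Fin (p + 1), (∑ f : Fin (p + 1) → ι, ∑ g : Fin q → ι, (-1 : ℝ) ^ (j : ℕ) *
      X (coordVec (j.removeNth f)) (coordVec (Matrix.vecCons (f j) g)) *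
      Z (coordVec f) (coordVec g)) = ∑ a : ι, ∑ f : Fin p → ι, ∑ g : Fin q → ι,
      X (coordVec f) (coordVec (Matrix.vecCons a g)) *
      Z (coordVec (Matrix.vecCons a f)) (coordVec g) := by
    intro j
    rw [sum_eq_sum_removeNth j]
    refine Finset.sum_congr rfl fun a _ => Finset.sum_congr rfl fun f _ =>
      Finset.sum_congr rfl fun g _ => ?_
    have hz := Z.map_insertNth j (coordVec (fun _ : Fin 1 => a) 0) (coordVec f)
    have hc : j.insertNth (coordVec (fun _ : Fin 1 => a) 0) (coordVec f) =
        coordVec (j.insertNth (α := fun _ => ι) a f) := by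
      funext t
      refine Fin.succAboveCases j ?_ (fun s => ?_) t <;> simp [coordVec]
    rw [hc, coordVec_vecCons] at hz
    rw [hz, ← Int.cast_smul_eq_zsmul ℝ]
    simp only [Fin.removeNth_insertNth, Fin.insertNth_apply_same, AlternatingMap.smul_apply,
      smul_eq_mul]
    push_cast
    have : ((-1 : ℝ) ^ (j : ℕ)) * (-1 : ℝ) ^ (j : ℕ) = 1 := by rw [← mul_pow]; simp
    linear_combination (X (coordVec f) (coordVec (Matrix.vecCons a g)) *
      Z (coordVec (Matrix.vecCons a f)) (coordVec g)) * this
  have h2 : coordInner (sUp p q X) Z = ∑ j : Fin (p + 1), (∑ f : Fin (p + 1) → ι,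
      ∑ g : Fin q → ι, (-1 : ℝ) ^ (j : ℕ) *
      X (coordVec (j.removeNth f)) (coordVec (Matrix.vecCons (f j) g)) *
      Z (coordVec f) (coordVec g)) := by
    rw [Finset.sum_comm]
    refine Finset.sum_congr rfl fun f _ => ?_
    rw [Finset.sum_comm]
    refine Finset.sum_congr rfl fun g _ => ?_
    rw [sUp_coordVec, Finset.sum_mul]
  rw [h2, Finset.sum_congr rfl fun j _ => h j]
  simp

theorem coordInner_sDagger {p q : ℕ} (X : AltAlt (ι → ℝ) p (q + 1))
    (Z : AltAlt (ι → ℝ) (p + 1) q) :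
    coordInner X (sDagger p q Z) = (q + 1) * ∑ a : ι, ∑ f : Fin p → ι, ∑ g : Fin q → ι,
      X (coordVec f) (coordVec (Matrix.vecCons a g)) *
      Z (coordVec (Matrix.vecCons a f)) (coordVec g) := by
  have h : ∀ j : Fin (q + 1), (∑ f : Fin p → ι, ∑ g : Fin (q + 1) → ι,
      X (coordVec f) (coordVec g) * ((-1 : ℝ) ^ (j : ℕ) *
      Z (coordVec (Matrix.vecCons (g j) f)) (coordVec (j.removeNth g)))) =
      ∑ a : ι, ∑ f : Fin p → ι, ∑ g : Fin q → ι,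
      X (coordVec f) (coordVec (Matrix.vecCons a g)) *
      Z (coordVec (Matrix.vecCons a f)) (coordVec g) := by
    intro j
    rw [Finset.sum_comm (γ := ι)]
    refine Finset.sum_congr rfl fun f _ => ?_
    rw [sum_eq_sum_removeNth j]
    refine Finset.sum_congr rfl fun a _ => Finset.sum_congr rfl fun g _ => ?_
    have hx := (X (coordVec f)).map_insertNth j (coordVec (fun _ : Fin 1 => a) 0) (coordVec g)
    have hc : j.insertNth (coordVec (fun _ : Fin 1 => a) 0) (coordVec g) =
        coordVec (j.insertNth (α := fun _ => ι) a g) := by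
      funext t
      refine Fin.succAboveCases j ?_ (fun s => ?_) t <;> simp [coordVec]
    rw [hc, coordVec_vecCons] at hx
    rw [hx, ← Int.cast_smul_eq_zsmul ℝ]
    simp only [Fin.removeNth_insertNth, Fin.insertNth_apply_same, smul_eq_mul]
    push_cast
    have : ((-1 : ℝ) ^ (j : ℕ)) * (-1 : ℝ) ^ (j : ℕ) = 1 := by rw [← mul_pow]; simp
    linear_combination (X (coordVec f) (coordVec (Matrix.vecCons a g)) *
      Z (coordVec (Matrix.vecCons a f)) (coordVec g)) * this
  have h2 : coordInner X (sDagger p q Z) = ∑ j : Fin (q + 1), (∑ f : Fin p → ι,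
      ∑ g : Fin (q + 1) → ι, X (coordVec f) (coordVec g) * ((-1 : ℝ) ^ (j : ℕ) *
      Z (coordVec (Matrix.vecCons (g j) f)) (coordVec (j.removeNth g)))) := by
    rw [Finset.sum_comm]
    refine Finset.sum_congr rfl fun f _ => ?_
    rw [Finset.sum_comm]
    refine Finset.sum_congr rfl fun g _ => ?_
    rw [sDagger_coordVec, Finset.mul_sum]
  rw [h2, Finset.sum_congr rfl fun j _ => h j]
  simp

/-- `S_† : Alt^{p+2,q} → Alt^{p+1,q+1}` is onto for `p < q`, already on the tensors with a
prescribed support. -/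
theorem exists_sDagger_eq {σ : Set ι} {p q : ℕ} (hpq : p < q) {B : AltAlt (ι → ℝ) (p + 1) (q + 1)}
    (hB : B ∈ exactSupport σ (p + 1) (q + 1)) :
    ∃ C ∈ exactSupport σ (p + 2) q, sDagger (p + 1) q C = B := by
  -- S_†S is injective: if S_†SC = 0, pairing the sl₂ relation with C writes 0 as a positive
  -- multiple of |S_†C|² plus (q - p)|C|². In finite dimension it is then onto, and SC' is a
  -- preimage under S_† with the same support.
  let Φ : exactSupport σ (p + 1) (q + 1) →ₗ[ℝ] exactSupport σ (p + 1) (q + 1) :=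
    (sDagger (p + 1) q ∘ₗ sUp (p + 1) q).restrict
      fun C hC => sDagger_mem_exactSupport (sUp_mem_exactSupport hC)
  have hinj : Function.Injective Φ := by
    rw [injective_iff_map_eq_zero]
    rintro ⟨C, hC⟩ h
    have h0 : sDagger (p + 1) q (sUp (p + 1) q C) = 0 := congrArg Subtype.val h
    rw [sDagger_sUp] at h0
    have h1 : coordInner (sUp p (q + 1) (sDagger p (q + 1) C)) C +
        ((q : ℝ) - p) * coordInner C C = 0 := by
      have : coordInner (sUp p (q + 1) (sDagger p (q + 1) C) + ((q : ℝ) - p) • C) C = 0 := by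
        rw [h0]; simp [coordInner]
      rw [← this]
      simp only [coordInner, Finset.mul_sum, ← Finset.sum_add_distrib]
      refine Finset.sum_congr rfl fun f _ => Finset.sum_congr rfl fun g _ => ?_
      simp
      ring
    rw [coordInner_sUp] at h1
    have h2 := coordInner_sDagger (sDagger p (q + 1) C) C
    have h3 := coordInner_self_nonneg (sDagger p (q + 1) C)
    have h4 := coordInner_self_nonneg C
    rw [h2] at h3
    have h5 := nonneg_of_mul_nonneg_right h3 (by positivity)
    have h6 : (0 : ℝ) < (q : ℝ) - p := sub_pos.2 (Nat.cast_lt.2 hpq)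
    have h7 : (0 : ℝ) ≤ (p : ℝ) + 1 := by positivity
    have h8 := mul_nonneg h7 h5
    have h9 := mul_nonneg h6.le h4
    have h10 : ((q : ℝ) - p) * coordInner C C = 0 := by linarith
    have h11 := (mul_eq_zero.1 h10).resolve_left h6.ne'
    exact Subtype.ext (eq_zero_of_coordInner_self h11)
  obtain ⟨C, hC⟩ := (LinearMap.injective_iff_surjective.1 hinj) ⟨B, hB⟩
  exact ⟨sUp (p + 1) q C, sUp_mem_exactSupport C.2, congrArg Subtype.val hC⟩

end Surjectivity


/-! ### Homogeneous coordinates -/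

/-- Multilinear expansion: every term containing some c s • y repeats the first argument y. With y
the coordinates of a vertex, this turns edge vectors into vertices of the coordinate space. -/
theorem map_vecCons_add_smul {V M : Type*} [AddCommGroup V] [Module ℝ V] [AddCommGroup M]
    [Module ℝ M] {k : ℕ} (α : V [⋀^Fin (k + 1)]→ₗ[ℝ] M) (y : V) (w : Fin k → V) (c : Fin k → ℝ) :
    α (Matrix.vecCons y fun s => w s + c s • y) = α (Matrix.vecCons y w) := by
  classical
  have h := (α.curryLeft y).toMultilinearMap.map_add_univ w (fun s => c s • y)
  have h0 : ∀ s ∈ (Finset.univ : Finset (Finset (Fin k))), s ≠ Finset.univ →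
      (α.curryLeft y).toMultilinearMap (s.piecewise w fun s => c s • y) = 0 := by
    intro s _ hs
    obtain ⟨i, hi⟩ : ∃ i, i ∉ s := by
      by_contra! hc
      exact hs (Finset.eq_univ_iff_forall.2 hc)
    have h1 : (s.piecewise w fun s => c s • y) =
        Function.update (s.piecewise w fun s => c s • y) i (c i • y) := by
      rw [eq_comm, Function.update_eq_self_iff, Finset.piecewise_eq_of_notMem _ _ _ hi]
    rw [h1, MultilinearMap.map_update_smul]
    have h2 : α (Matrix.vecCons y (Function.update (s.piecewise w fun s => c s • y) i y)) = 0 :=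
      α.map_eq_zero_of_eq _ (i := 0) (j := i.succ) (by simp) (Fin.succ_ne_zero i).symm
    have h3 : (α.curryLeft y).toMultilinearMap
        (Function.update (s.piecewise w fun s => c s • y) i y) = 0 := h2
    rw [h3, smul_zero]
  rw [Finset.sum_eq_single Finset.univ h0 (by simp), Finset.piecewise_univ] at h
  exact h

section Homogeneous

variable {E : Type*} [NormedAddCommGroup E] [InnerProductSpace ℝ E] {ι : Type*} [Fintype ι]
  [DecidableEq ι] {M : Type*} [AddCommGroup M] [Module ℝ M] (b : AffineBasis ι ℝ E)

/-- The linear part of the barycentric coordinates. -/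
abbrev coordsLin : E →ₗ[ℝ] (ι → ℝ) := b.coords.linear

/-- The field `x ↦ B(λ(x), dλ ·, …, dλ ·)` associated with an alternating `(k+1)`-form on the
space of homogeneous coordinates. -/
def homog {k : ℕ} (B : (ι → ℝ) [⋀^Fin (k + 1)]→ₗ[ℝ] M) (x : E) : E [⋀^Fin k]→ₗ[ℝ] M :=
  (B.curryLeft (b.coords x)).compLinearMap (coordsLin b)

omit [Fintype ι] [DecidableEq ι] in
theorem homog_apply {k : ℕ} (B : (ι → ℝ) [⋀^Fin (k + 1)]→ₗ[ℝ] M) (x : E) (v : Fin k → E) :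
    homog b B x v = B (Matrix.vecCons (b.coords x) fun s => coordsLin b (v s)) := rfl

/-- The linear combination of the vertices. -/
def vertexComb : (ι → ℝ) →ₗ[ℝ] E := Fintype.linearCombination ℝ b

omit [DecidableEq ι] in
theorem vertexComb_coords (x : E) : vertexComb b (b.coords x) = x := by
  simp [vertexComb, Fintype.linearCombination_apply]

omit [Fintype ι] [DecidableEq ι] in
theorem coordsLin_eq (v : E) : coordsLin b v = b.coords v - b.coords 0 := by
  have := b.coords.linearMap_vsub v 0
  simpa using this

omit [Fintype ι] [DecidableEq ι] in
theorem coordsLin_sub (v w : E) : coordsLin b (v - w) = b.coords v - b.coords w := by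
  have := b.coords.linearMap_vsub v w
  simpa using this

omit [DecidableEq ι] in
theorem vertexComb_coordsLin (v : E) : vertexComb b (coordsLin b v) = v := by
  rw [coordsLin_eq, map_sub, vertexComb_coords, vertexComb_coords, sub_zero]

omit [DecidableEq ι] in
theorem sum_coordsLin (v : E) : ∑ i, coordsLin b v i = 0 := by
  simp [coordsLin_eq, b.sum_coord_apply_eq_one]

omit [Fintype ι] in
theorem coords_vertex (i : ι) : b.coords (b i) = Pi.single i 1 := by
  ext j
  simp [AffineBasis.coord_apply, Pi.single_apply]

omit [Fintype ι] in
/-- The components of `B` are the values of its field at the vertices on the edge vectors. -/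
theorem homog_vertex {k : ℕ} (B : (ι → ℝ) [⋀^Fin (k + 1)]→ₗ[ℝ] M) (f : Fin (k + 1) → ι) :
    homog b B (b (f 0)) (fun s => b (f s.succ) - b (f 0)) = B (coordVec f) := by
  have h := map_vecCons_add_smul B (Pi.single (f 0) 1) (fun s : Fin k => Pi.single (f s.succ) 1)
    (fun _ => -1)
  rw [homog_apply]
  simp only [coordsLin_sub, coords_vertex]
  simp only [neg_one_smul, ← sub_eq_add_neg] at h
  rw [h]
  congr 1
  funext t
  refine Fin.cases rfl (fun s => rfl) t

omit [DecidableEq ι] in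
/-- Every field in `P^- Alt^{k,ℓ}` comes from an alternating form in homogeneous coordinates. -/
theorem exists_eq_homog {k ℓ : ℕ} {ω : E → AltAlt E k ℓ} (hω : ω ∈ PAlt E k ℓ) :
    ∃ B : (ι → ℝ) [⋀^Fin (k + 1)]→ₗ[ℝ] Alt E ℓ, ω = homog b B := by
  obtain ⟨a, c, h⟩ := hω
  -- The constant part a is wedged with the sum-of-coordinates functional, which is 1 on λ(x) and 0
  -- on every dλ(v); the Koszul part is pulled back along the vertex combination, a left inverse of
  -- λ and of dλ.
  refine ⟨AlternatingMap.alternatizeUncurryFin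
    (LinearMap.toSpanSingleton ℝ _ (a.compLinearMap (vertexComb b)) ∘ₗ
      Fintype.linearCombination ℝ (fun _ : ι => (1 : ℝ))) + c.compLinearMap (vertexComb b), ?_⟩
  funext x
  ext v u
  rw [h, homog_apply]
  simp only [AlternatingMap.add_apply]
  rw [AlternatingMap.alternatizeUncurryFin_apply,
    Fin.sum_univ_succ, Finset.sum_eq_zero]
  · simp only [Fin.val_zero, pow_zero, one_smul, removeNth_zero_vecCons, add_zero]
    simp only [Matrix.cons_val_zero, LinearMap.comp_apply, Fintype.linearCombination_apply,
      LinearMap.toSpanSingleton_apply, AlternatingMap.smul_apply,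
      AlternatingMap.compLinearMap_apply,
      vertexComb_coordsLin, smul_eq_mul, mul_one]
    have h1 : ∑ i, b.coords x i = 1 := by simp [b.sum_coord_apply_eq_one]
    rw [h1, one_mul]
    congr 2
    rw [AlternatingMap.curryLeft_apply_apply]
    congr 1
    funext t
    refine Fin.cases ?_ (fun s => ?_) t
    · simp [vertexComb_coords]
    · simp [vertexComb_coordsLin]
  · intro i _
    simp [Fintype.linearCombination_apply, sum_coordsLin]

omit [Fintype ι] [DecidableEq ι] in
theorem homog_mem_PAlt {k ℓ : ℕ} (B : (ι → ℝ) [⋀^Fin (k + 1)]→ₗ[ℝ] Alt E ℓ) :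
    homog b B ∈ PAlt E k ℓ := by
  refine ⟨homog b B 0, B.compLinearMap (coordsLin b), fun x => ?_⟩
  have h : b.coords x = b.coords 0 + coordsLin b x := by rw [coordsLin_eq]; abel
  ext v u
  change B.curryLeft (b.coords x) (fun s => coordsLin b (v s)) u =
    B.curryLeft (b.coords 0) (fun s => coordsLin b (v s)) u + B _ u
  rw [h, map_add, AlternatingMap.add_apply, AlternatingMap.add_apply]
  congr 1
  rw [AlternatingMap.curryLeft_apply_apply]
  congr 2
  funext t
  refine Fin.cases rfl (fun s => rfl) t

/-- The field of a tensor in homogeneous coordinates. -/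
def realize {k ℓ : ℕ} (B : AltAlt (ι → ℝ) (k + 1) ℓ) : E → AltAlt E k ℓ :=
  homog b ((pullAlt (coordsLin b) ℓ).compAlternatingMap B)

omit [Fintype ι] [DecidableEq ι] in
theorem realize_apply {k ℓ : ℕ} (B : AltAlt (ι → ℝ) (k + 1) ℓ) (x : E) (v : Fin k → E)
    (u : Fin ℓ → E) : realize b B x v u =
      B (Matrix.vecCons (b.coords x) fun s => coordsLin b (v s)) (fun s => coordsLin b (u s)) := rfl

omit [Fintype ι] [DecidableEq ι] in
theorem realize_mem_PAlt {k ℓ : ℕ} (B : AltAlt (ι → ℝ) (k + 1) ℓ) : realize b B ∈ PAlt E k ℓ :=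
  homog_mem_PAlt b _

omit [Fintype ι] [DecidableEq ι] in
-- On the field, u_j is inserted behind λ(x); on the tensor, in front of it. The transposition is
-- the sign. Thus solving S_† for fields reduces to solving it for tensors.
theorem sDagger_realize {k ℓ : ℕ} (B : AltAlt (ι → ℝ) (k + 2) ℓ) (x : E) :
    sDagger k ℓ (realize b B x) = -realize b (sDagger (k + 1) ℓ B) x := by
  ext v u
  rw [AlternatingMap.neg_apply, AlternatingMap.neg_apply, realize_apply, sDagger_apply,
    sDagger_apply, ← Finset.sum_neg_distrib]
  refine Finset.sum_congr rfl fun j _ => ?_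
  rw [realize_apply, ← mul_neg]
  congr 1
  have h := B.map_swap (Matrix.vecCons (coordsLin b (u j)) (Matrix.vecCons (b.coords x)
    fun s => coordsLin b (v s))) (i := 0) (j := 1) (by simp)
  have h' : (Matrix.vecCons (coordsLin b (u j)) (Matrix.vecCons (b.coords x)
      fun s => coordsLin b (v s))) ∘ (Equiv.swap 0 1) = Matrix.vecCons (b.coords x)
      fun s => coordsLin b (Matrix.vecCons (u j) v s) := by
    funext t
    refine Fin.cases ?_ (fun s => Fin.cases ?_ (fun s => ?_) s) t
    · simp
    · simp [show (Fin.succ (0 : Fin (k + 1))) = 1 from rfl]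
    · rw [Function.comp_apply, Equiv.swap_apply_of_ne_of_ne (Fin.succ_ne_zero _)
        (by simp [Fin.ext_iff])]
      simp
  rw [h'] at h
  rw [h, AlternatingMap.neg_apply]
  rfl

end Homogeneous


/-! ### Double traces -/

section Trace

variable {E : Type*} [NormedAddCommGroup E] [InnerProductSpace ℝ E] {k ℓ : ℕ}

theorem traceII_apply (σ : Finset E) (ω : E → AltAlt E k ℓ) (x : simplexPts σ)
    (v : Fin k → tangent σ) (u : Fin ℓ → tangent σ) :
    traceII σ ω x v u = ω x (fun s => (v s : E)) (fun s => (u s : E)) := rfl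

theorem traceII_add (σ : Finset E) (ω ω' : E → AltAlt E k ℓ) :
    traceII σ (ω + ω') = traceII σ ω + traceII σ ω' := rfl

theorem traceII_smul (σ : Finset E) (c : ℝ) (ω : E → AltAlt E k ℓ) :
    traceII σ (c • ω) = c • traceII σ ω := rfl

/-- The double trace as a linear map. -/
def traceIILin (σ : Finset E) (k ℓ : ℕ) : (E → AltAlt E k ℓ) →ₗ[ℝ] SimplexField σ k ℓ where
  toFun := traceII σ
  map_add' := traceII_add σ
  map_smul' := traceII_smul σ

theorem traceII_sub (σ : Finset E) (ω ω' : E → AltAlt E k ℓ) :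
    traceII σ (ω - ω') = traceII σ ω - traceII σ ω' := (traceIILin σ k ℓ).map_sub ω ω'

theorem traceII_zero (σ : Finset E) : traceII σ (0 : E → AltAlt E k ℓ) = 0 :=
  (traceIILin σ k ℓ).map_zero

theorem traceII_sum {κ : Type*} (σ : Finset E) (s : Finset κ) (ω : κ → E → AltAlt E k ℓ) :
    traceII σ (∑ a ∈ s, ω a) = ∑ a ∈ s, traceII σ (ω a) := map_sum (traceIILin σ k ℓ) ω s

theorem traceII_eq_iff {σ : Finset E} {ω ω' : E → AltAlt E k ℓ} :
    traceII σ ω = traceII σ ω' ↔ ∀ x ∈ convexHull ℝ (σ : Set E), ∀ v : Fin k → E,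
      (∀ s, v s ∈ tangent σ) → ∀ u : Fin ℓ → E, (∀ s, u s ∈ tangent σ) →
        ω x v u = ω' x v u := by
  constructor
  · intro h x hx v hv u hu
    exact congrArg (fun w : SimplexField σ k ℓ =>
      w ⟨x, hx⟩ (fun s => ⟨v s, hv s⟩) (fun s => ⟨u s, hu s⟩)) h
  · intro h
    funext x
    ext v u
    exact h x x.2 _ (fun s => (v s).2) _ (fun s => (u s).2)

theorem traceII_eq_zero_iff {σ : Finset E} {ω : E → AltAlt E k ℓ} :
    traceII σ ω = 0 ↔ ∀ x ∈ convexHull ℝ (σ : Set E), ∀ v : Fin k → E,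
      (∀ s, v s ∈ tangent σ) → ∀ u : Fin ℓ → E, (∀ s, u s ∈ tangent σ) → ω x v u = 0 := by
  rw [← traceII_zero, traceII_eq_iff]
  rfl

theorem traceII_sDagger {σ : Finset E} (ω : E → AltAlt E (k + 1) ℓ) :
    traceII σ (fun x => sDagger k ℓ (ω x)) = fun x => sDagger k ℓ (traceII σ ω x) := by
  funext x
  ext v u
  rw [traceII_apply, sDagger_apply, sDagger_apply]
  refine Finset.sum_congr rfl fun j _ => ?_
  rw [traceII_apply]
  congr 3
  funext t
  refine Fin.cases rfl (fun s => rfl) t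

/-- S_† anticommutes with the Koszul contraction, again because x and u_j change places in the first
two slots. -/
theorem sDagger_mem_PAlt {ω : E → AltAlt E (k + 1) ℓ} (hω : ω ∈ PAlt E (k + 1) ℓ) :
    (fun x => sDagger k ℓ (ω x)) ∈ PAlt E k (ℓ + 1) := by
  obtain ⟨a, c, h⟩ := hω
  refine ⟨sDagger k ℓ a, -sDagger (k + 1) ℓ c, fun x => ?_⟩
  ext v u
  rw [AlternatingMap.add_apply, AlternatingMap.add_apply, AlternatingMap.curryLeft_apply_apply,
    AlternatingMap.neg_apply, AlternatingMap.neg_apply, sDagger_apply, sDagger_apply,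
    sDagger_apply, ← sub_eq_add_neg, ← Finset.sum_sub_distrib]
  refine Finset.sum_congr rfl fun j _ => ?_
  rw [h, ← mul_sub, AlternatingMap.add_apply, AlternatingMap.add_apply, sub_eq_add_neg]
  congr 2
  have hs := c.map_swap (Matrix.vecCons (u j) (Matrix.vecCons x v)) (i := 0) (j := 1) (by simp)
  have h' : (Matrix.vecCons (u j) (Matrix.vecCons x v)) ∘ (Equiv.swap 0 1) =
      Matrix.vecCons x (Matrix.vecCons (u j) v) := by
    funext t
    refine Fin.cases ?_ (fun s => Fin.cases ?_ (fun s => ?_) s) t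
    · simp
    · simp [show (Fin.succ (0 : Fin (k + 1))) = 1 from rfl]
    · rw [Function.comp_apply, Equiv.swap_apply_of_ne_of_ne (Fin.succ_ne_zero _)
        (by simp [Fin.ext_iff])]
      simp
  rw [h'] at hs
  rw [AlternatingMap.curryLeft_apply_apply, hs, AlternatingMap.neg_apply]

end Trace

/-- Evaluation of an alternating form at fixed vectors. -/
def evalAlt {V : Type*} [AddCommGroup V] [Module ℝ V] {ℓ : ℕ} (w : Fin ℓ → V) :
    Alt V ℓ →ₗ[ℝ] ℝ where
  toFun α := α w
  map_add' _ _ := rfl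
  map_smul' _ _ := rfl

/-! ### Supports in barycentric coordinates and vanishing traces -/

section Support

variable {E : Type*} [NormedAddCommGroup E] [InnerProductSpace ℝ E] {ι : Type*}
  (b : AffineBasis ι ℝ E) {σ : Finset E}

theorem coords_eq_zero (hσ : (σ : Set E) ⊆ Set.range b) {x : E}
    (hx : x ∈ convexHull ℝ (σ : Set E)) {i : ι} (hi : b i ∉ σ) : b.coords x i = 0 := by
  have hc : Convex ℝ (b.coord i ⁻¹' {0}) := (convex_singleton (0 : ℝ)).affine_preimage _
  refine convexHull_min (fun p hp => ?_) hc hx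
  obtain ⟨j, rfl⟩ := hσ hp
  refine b.coord_apply_ne ?_
  rintro rfl
  exact hi hp

theorem coordsLin_eq_zero (hσ : (σ : Set E) ⊆ Set.range b) {u : E} (hu : u ∈ tangent σ) {i : ι}
    (hi : b i ∉ σ) : coordsLin b u i = 0 := by
  have h : tangent σ ≤ LinearMap.ker (LinearMap.proj i ∘ₗ coordsLin b) := by
    refine Submodule.span_le.2 ?_
    rintro _ ⟨p, hp, q, hq, rfl⟩
    have hp' := coords_eq_zero b hσ (subset_convexHull ℝ _ hp) hi
    have hq' := coords_eq_zero b hσ (subset_convexHull ℝ _ hq) hi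
    have h' : coordsLin b (p - q) i = 0 := by
      rw [coordsLin_sub, Pi.sub_apply, hp', hq', sub_zero]
    exact h'
  exact h hu

variable [Fintype ι] [DecidableEq ι] {M : Type*} [AddCommGroup M] [Module ℝ M]

theorem homog_eq_zero (hσ : (σ : Set E) ⊆ Set.range b) {k : ℕ}
    {B : (ι → ℝ) [⋀^Fin (k + 1)]→ₗ[ℝ] M}
    (hB : ∀ f : Fin (k + 1) → ι, (∀ s, b (f s) ∈ σ) → B (coordVec f) = 0) {x : E}
    (hx : x ∈ convexHull ℝ (σ : Set E)) {v : Fin k → E} (hv : ∀ s, v s ∈ tangent σ) :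
    homog b B x v = 0 := by
  rw [homog_apply]
  refine map_eq_zero_of_support B (τ := {i | b i ∈ σ}) hB fun s => ?_
  refine Fin.cases (fun i hi => ?_) (fun t i hi => ?_) s
  · exact coords_eq_zero b hσ hx hi
  · exact coordsLin_eq_zero b hσ (hv t) hi

theorem traceII_realize_eq_zero (hσ : (σ : Set E) ⊆ Set.range b) {k ℓ : ℕ}
    {B : AltAlt (ι → ℝ) (k + 1) ℓ}
    (hB : ∀ (f : Fin (k + 1) → ι) (g : Fin ℓ → ι), (∀ s, b (f s) ∈ σ) → (∀ s, b (g s) ∈ σ) →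
      B (coordVec f) (coordVec g) = 0) : traceII σ (realize b B) = 0 := by
  rw [traceII_eq_zero_iff]
  intro x hx v hv u hu
  rw [realize_apply]
  have h : ∀ f : Fin (k + 1) → ι, (∀ s, f s ∈ {i | b i ∈ σ}) →
      ((evalAlt (fun s => coordsLin b (u s))).compAlternatingMap B) (coordVec f) = 0 :=
    fun f hf => map_eq_zero_of_support (B (coordVec f)) (τ := {i | b i ∈ σ})
      (fun g hg => hB f g hf hg) (fun s i hi => coordsLin_eq_zero b hσ (hu s) hi)
  refine map_eq_zero_of_support _ h fun s => ?_
  refine Fin.cases (fun i hi => ?_) (fun t i hi => ?_) s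
  · exact coords_eq_zero b hσ hx hi
  · exact coordsLin_eq_zero b hσ (hv t) hi

/-- If σ has a vertex outside τ, each term e^f ⊗ e^g contains the coordinate of that vertex in one
of its factors, and this coordinate vanishes on τ. -/
theorem traceII_realize_of_exactSupport {τ : Finset E} (hτ : (τ : Set E) ⊆ Set.range b)
    (hσ : (σ : Set E) ⊆ Set.range b) {k ℓ : ℕ} {B : AltAlt (ι → ℝ) (k + 1) ℓ}
    (hB : B ∈ exactSupport {i | b i ∈ σ} (k + 1) ℓ) (h : ¬ σ ⊆ τ) :
    traceII τ (realize b B) = 0 := by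
  refine traceII_realize_eq_zero b hτ fun f g hf hg => hB f g fun heq => h fun p hp => ?_
  obtain ⟨i, rfl⟩ := hσ hp
  have : i ∈ Set.range f ∪ Set.range g := by rw [heq]; exact hp
  rcases this with ⟨s, rfl⟩ | ⟨s, rfl⟩
  exacts [hf s, hg s]

/-- The projection of homogeneous coordinates to the tangent space of the face `σ` that sends
each vertex `b i` of `σ` to the edge vector from `b i₀`. -/
def faceProj (σ : Finset E) (i₀ : ι) : (ι → ℝ) →ₗ[ℝ] E := by
  classical
  exact Fintype.linearCombination ℝ (fun i => if b i ∈ σ then b i - b i₀ else 0)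

open Classical in
omit [DecidableEq ι] in
theorem faceProj_apply (i₀ : ι) (y : ι → ℝ) :
    faceProj b σ i₀ y = ∑ i, y i • (if b i ∈ σ then b i - b i₀ else 0) := by
  rw [faceProj, Fintype.linearCombination_apply]

theorem faceProj_single (i₀ : ι) {i : ι} (hi : b i ∈ σ) :
    faceProj b σ i₀ (Pi.single i 1) = b i - b i₀ := by
  classical
  rw [faceProj_apply, Finset.sum_eq_single i]
  · simp [hi]
  · intro j _ hj
    simp [hj]
  · simp

theorem faceProj_single_of_notMem (i₀ : ι) {i : ι} (hi : b i ∉ σ) :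
    faceProj b σ i₀ (Pi.single i 1) = 0 := by
  classical
  rw [faceProj_apply, Finset.sum_eq_zero]
  intro j _
  by_cases hj : j = i
  · subst hj; simp [hi]
  · simp [hj]

omit [DecidableEq ι] in
theorem faceProj_coordsLin (hσ : (σ : Set E) ⊆ Set.range b) (i₀ : ι) {u : E}
    (hu : u ∈ tangent σ) : faceProj b σ i₀ (coordsLin b u) = u := by
  classical
  have h : ∀ i, coordsLin b u i • (if b i ∈ σ then b i - b i₀ else 0) =
      coordsLin b u i • b i - coordsLin b u i • b i₀ := by
    intro i
    split_ifs with hi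
    · rw [smul_sub]
    · rw [coordsLin_eq_zero b hσ hu hi]; simp
  rw [faceProj_apply, Finset.sum_congr rfl fun i _ => h i, Finset.sum_sub_distrib,
    ← Finset.sum_smul, sum_coordsLin, zero_smul, sub_zero]
  have := vertexComb_coordsLin b u
  rwa [vertexComb, Fintype.linearCombination_apply] at this

/-- A field with vanishing double traces on the proper faces of `σ` agrees on `σ` with one whose
homogeneous tensor is spanned by `e^f ⊗ e^g` with `range f ∪ range g` the vertex set of `σ`. -/
theorem exists_exactSupport (hσ : (σ : Set E) ⊆ Set.range b) {k ℓ : ℕ} {ω : E → AltAlt E k ℓ}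
    (hω : ω ∈ PAlt E k ℓ)
    (h0 : ∀ τ ⊆ σ, τ.Nonempty → τ ≠ σ → traceII τ ω = 0) :
    ∃ B ∈ exactSupport {i | b i ∈ σ} (k + 1) ℓ, traceII σ (realize b B) = traceII σ ω := by
  classical
  obtain ⟨B₀, rfl⟩ := exists_eq_homog b hω
  -- The coefficient of e^f is the component of the field with its value form pulled back to
  -- coordinates by projecting to σ. The base vertex f 0 ensures that only edges among the vertices
  -- of f and g enter. The factor 1/(k+1)! offsets the antisymmetrization, since β itself is not
  -- alternating in f.
  let β : (Fin (k + 1) → ι) → Alt (ι → ℝ) ℓ := fun f => if ∀ s, b (f s) ∈ σ then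
    (((k + 1).factorial : ℝ)⁻¹) • pullAlt (faceProj b σ (f 0)) ℓ (B₀ (coordVec f)) else 0
  have hβ : ∀ f g, Set.range f ∪ Set.range g ≠ {i | b i ∈ σ} → β f (coordVec g) = 0 := by
    intro f g hfg
    by_cases hf : ∀ s, b (f s) ∈ σ
    · simp only [β, if_pos hf, AlternatingMap.smul_apply]
      change _ • B₀ (coordVec f) (fun s => faceProj b σ (f 0) (Pi.single (g s) 1)) = 0
      by_cases hg : ∀ s, b (g s) ∈ σ
      · simp only [faceProj_single b _ (hg _)]
        -- The coefficient at (f, g) is a value of the double trace on the face τ spanned by these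
        -- vertices, so it is zero whenever τ is a proper face.
        let τ : Finset E := Finset.univ.image (b ∘ f) ∪ Finset.univ.image (b ∘ g)
        have hfτ : ∀ s, b (f s) ∈ τ := fun s =>
          Finset.mem_union_left _ (Finset.mem_image_of_mem _ (Finset.mem_univ s))
        have hgτ : ∀ s, b (g s) ∈ τ := fun s =>
          Finset.mem_union_right _ (Finset.mem_image_of_mem _ (Finset.mem_univ s))
        have hτσ : τ ⊆ σ := by
          refine Finset.union_subset ?_ ?_ <;> intro p hp
          · obtain ⟨s, _, rfl⟩ := Finset.mem_image.1 hp
            exact hf s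
          · obtain ⟨s, _, rfl⟩ := Finset.mem_image.1 hp
            exact hg s
        have hne : τ ≠ σ := by
          intro heq
          apply hfg
          ext i
          simp only [Set.mem_union, Set.mem_range, Set.mem_ofPred_eq]
          rw [← heq]
          simp [τ, b.ind.injective.eq_iff]
        have h1 := traceII_eq_zero_iff.1 (h0 τ hτσ ⟨_, hfτ 0⟩ hne) (b (f 0))
          (subset_convexHull ℝ _ (hfτ 0)) (fun s => b (f s.succ) - b (f 0))
          (fun s => vsub_mem_vectorSpan ℝ (hfτ _) (hfτ _)) (fun s => b (g s) - b (f 0))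
          (fun s => vsub_mem_vectorSpan ℝ (hgτ _) (hfτ _))
        rw [homog_vertex] at h1
        rw [h1, smul_zero]
      · push Not at hg
        obtain ⟨s, hs⟩ := hg
        rw [AlternatingMap.map_coord_zero _ s (faceProj_single_of_notMem b _ hs), smul_zero]
    · simp only [β, if_neg hf]
      rfl
  refine ⟨altOfCoeff β, ?_, ?_⟩
  · intro f g hfg
    rw [altOfCoeff_coordVec, alternatingMap_sum_apply]
    refine Finset.sum_eq_zero fun π _ => ?_
    rw [AlternatingMap.smul_apply, hβ _ _ (by rwa [EquivLike.range_comp]), smul_zero]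
  · rw [traceII_eq_iff]
    intro x hx v hv u hu
    rw [realize_apply, homog_apply, ← sub_eq_zero]
    let C : (ι → ℝ) [⋀^Fin (k + 1)]→ₗ[ℝ] ℝ :=
      (evalAlt (fun s => coordsLin b (u s))).compAlternatingMap (altOfCoeff β) -
        (evalAlt u).compAlternatingMap B₀
    change C _ = 0
    refine map_eq_zero_of_support C (τ := {i | b i ∈ σ}) (fun f hf => ?_) fun s => ?_
    · change altOfCoeff β (coordVec f) (fun s => coordsLin b (u s)) - B₀ (coordVec f) u = 0
      rw [altOfCoeff_coordVec, alternatingMap_sum_apply]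
      -- On tangent vectors of σ the projection is the identity whatever its base vertex, so all
      -- permutations contribute equally.
      have hterm : ∀ π : Equiv.Perm (Fin (k + 1)),
          (((Equiv.Perm.sign π : ℤ) : ℝ) • β (f ∘ π)) (fun s => coordsLin b (u s)) =
          (((k + 1).factorial : ℝ)⁻¹) * B₀ (coordVec f) u := by
        intro π
        have hfπ : ∀ s, b ((f ∘ π) s) ∈ σ := fun s => hf (π s)
        simp only [β, if_pos hfπ, AlternatingMap.smul_apply]
        change _ • _ • B₀ (coordVec (f ∘ π))
          (fun s => faceProj b σ ((f ∘ π) 0) (coordsLin b (u s))) = _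
        simp only [faceProj_coordsLin b hσ _ (hu _)]
        rw [map_coordVec_comp_perm, AlternatingMap.smul_apply, smul_eq_mul, smul_eq_mul,
          smul_eq_mul]
        have hs : ((Equiv.Perm.sign π : ℤ) : ℝ) * ((Equiv.Perm.sign π : ℤ) : ℝ) = 1 := by
          rw [← Int.cast_mul, Int.units_coe_mul_self, Int.cast_one]
        linear_combination (((k + 1).factorial : ℝ)⁻¹) * B₀ (coordVec f) u * hs
      rw [Finset.sum_congr rfl fun π _ => hterm π]
      have : ((k + 1).factorial : ℝ) ≠ 0 := Nat.cast_ne_zero.2 (Nat.factorial_ne_zero _)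
      rw [Finset.sum_const, Finset.card_univ, Fintype.card_perm, Fintype.card_fin, nsmul_eq_mul,
        ← mul_assoc, mul_inv_cancel₀ this, one_mul, sub_self]
    · refine Fin.cases (fun i hi => ?_) (fun t i hi => ?_) s
      · exact coords_eq_zero b hσ hx hi
      · exact coordsLin_eq_zero b hσ (hv t) hi

end Support


/-! ### The Frobenius inner product and moments -/

section Frob

variable {V V' : Type*} [NormedAddCommGroup V] [InnerProductSpace ℝ V] [FiniteDimensional ℝ V]
  [NormedAddCommGroup V'] [InnerProductSpace ℝ V'] [FiniteDimensional ℝ V'] {k p : ℕ}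

/-- The Frobenius inner product as a bilinear map. -/
def frobBilin (V V' : Type*) [NormedAddCommGroup V] [InnerProductSpace ℝ V]
    [FiniteDimensional ℝ V] [NormedAddCommGroup V'] [InnerProductSpace ℝ V']
    [FiniteDimensional ℝ V'] (k p : ℕ) :
    MixedAlt V V' k p →ₗ[ℝ] MixedAlt V V' k p →ₗ[ℝ] ℝ :=
  LinearMap.mk₂ ℝ frob
    (fun α α' β => by simp [frob, add_mul, Finset.sum_add_distrib])
    (fun c α β => by simp [frob, Finset.mul_sum, mul_assoc])
    (fun α β β' => by simp [frob, mul_add, Finset.sum_add_distrib])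
    (fun c α β => by simp [frob, Finset.mul_sum, mul_left_comm])

theorem frobBilin_apply (α β : MixedAlt V V' k p) : frobBilin V V' k p α β = frob α β := rfl

theorem frob_self_nonneg (α : MixedAlt V V' k p) : 0 ≤ frob α α :=
  Finset.sum_nonneg fun _ _ => Finset.sum_nonneg fun _ _ => mul_self_nonneg _

theorem eq_zero_of_frob_self {α : MixedAlt V V' k p} (h : frob α α = 0) : α = 0 := by
  refine Module.Basis.ext_alternating (stdOrthonormalBasis ℝ V).toBasis fun f _ => ?_
  refine Module.Basis.ext_alternating (stdOrthonormalBasis ℝ V').toBasis fun g _ => ?_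
  have h1 := (Finset.sum_eq_zero_iff_of_nonneg fun f _ =>
    Finset.sum_nonneg fun g _ => mul_self_nonneg _).1 h f (Finset.mem_univ _)
  have h2 := (Finset.sum_eq_zero_iff_of_nonneg fun g _ => mul_self_nonneg _).1 h1 g
    (Finset.mem_univ _)
  simpa using mul_self_eq_zero.1 h2

end Frob

theorem surjective_of_injective_dual {V : Type*} [AddCommGroup V] [Module ℝ V] [Module.Finite ℝ V]
    (Φ : V →ₗ[ℝ] Module.Dual ℝ V) (h : Function.Injective Φ) : Function.Surjective Φ :=
  (LinearMap.injective_iff_surjective_of_finrank_eq_finrank Subspace.dual_finrank_eq.symm).1 h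

section Moments

variable {E : Type*} [NormedAddCommGroup E] [InnerProductSpace ℝ E] {σ : Finset E} {k ℓ : ℕ}

/-- The bubbles are contained in the finite-dimensional space `P^- Alt^{k,ℓ}(σ)`. -/
theorem BAlt_le : BAlt k ℓ σ ≤ simplexPAlt σ k ℓ := fun _ h => h.1

theorem BW_le : BW k ℓ σ ≤ simplexPAlt σ k ℓ := fun _ h => h.1.1

variable [FiniteDimensional ℝ E]

instance finite_simplexPAlt : Module.Finite ℝ (simplexPAlt σ k ℓ) := by
  rcases isEmpty_or_nonempty (simplexPts σ) with h | ⟨⟨o⟩⟩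
  · infer_instance
  · let L : AltAlt (tangent σ) k ℓ × AltAlt (tangent σ) (k + 1) ℓ →ₗ[ℝ] SimplexField σ k ℓ :=
      { toFun := fun a x => a.1 + a.2.curryLeft (disp x o)
        map_add' := fun a a' => by funext x; simp; abel
        map_smul' := fun c a => by funext x; simp }
    have hle : simplexPAlt σ k ℓ ≤ LinearMap.range L := by
      intro w hw
      obtain ⟨a, c, h⟩ := hw o
      exact ⟨(a, c), funext fun x => (h x).symm⟩
    exact Submodule.finiteDimensional_of_le hle

/-- All components of the field are continuous. -/
def IsContinuousField {X V V' : Type*} [TopologicalSpace X] [AddCommGroup V] [Module ℝ V]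
    [AddCommGroup V'] [Module ℝ V'] {k p : ℕ} (w : X → MixedAlt V V' k p) : Prop :=
  ∀ v u, Continuous fun x => w x v u

theorem isContinuousField_of_mem_simplexPAlt {w : SimplexField σ k ℓ}
    (hw : w ∈ simplexPAlt σ k ℓ) : IsContinuousField w := by
  intro v u
  rcases isEmpty_or_nonempty (simplexPts σ) with h | ⟨⟨o⟩⟩
  · exact continuous_of_discreteTopology
  · obtain ⟨a, c, h⟩ := hw o
    have hc : Continuous fun x : simplexPts σ => (evalAlt u ∘ₗ firstSlot c v) (disp x o) :=
      (LinearMap.continuous_of_finiteDimensional _).comp (isometry_disp o).continuous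
    refine (continuous_const (y := a v u)).add hc |>.congr fun x => ?_
    rw [h]
    rfl

theorem continuous_apply_of_mem_PAlt {ω : E → AltAlt E k ℓ} (hω : ω ∈ PAlt E k ℓ)
    (v : Fin k → E) (u : Fin ℓ → E) : Continuous fun x => ω x v u := by
  obtain ⟨a, c, h⟩ := hω
  have hc : Continuous fun x : E => (evalAlt u ∘ₗ firstSlot c v) x :=
    LinearMap.continuous_of_finiteDimensional _
  refine (continuous_const (y := a v u)).add hc |>.congr fun x => ?_
  rw [h]
  rfl

theorem isContinuousField_traceII {ω : E → AltAlt E k ℓ} (hω : ω ∈ PAlt E k ℓ) :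
    IsContinuousField (traceII σ ω) := fun v u =>
  (continuous_apply_of_mem_PAlt hω (fun s => (v s : E)) (fun s => (u s : E))).comp
    continuous_subtype_val

theorem IsContinuousField.frob {X V V' : Type*} [TopologicalSpace X] [NormedAddCommGroup V]
    [InnerProductSpace ℝ V] [FiniteDimensional ℝ V] [NormedAddCommGroup V']
    [InnerProductSpace ℝ V'] [FiniteDimensional ℝ V'] {k p : ℕ} {w w' : X → MixedAlt V V' k p}
    (hw : IsContinuousField w) (hw' : IsContinuousField w') :
    Continuous fun x => frob (w x) (w' x) :=
  continuous_finsetSum _ fun _ _ => continuous_finsetSum _ fun _ _ => (hw _ _).mul (hw' _ _)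

variable [MeasurableSpace E] [BorelSpace E]

theorem integrable_simplexMeasure {g : simplexPts σ → ℝ} (hg : Continuous g) :
    MeasureTheory.Integrable g (simplexMeasure σ) :=
  hg.integrable_of_hasCompactSupport (HasCompactSupport.of_compactSpace g)

/-- The `L²` inner product of fields on a simplex. -/
def fieldInner (w b : SimplexField σ k ℓ) : ℝ := ∫ x, frob (w x) (b x) ∂(simplexMeasure σ)

theorem bubbleMoment_eq (ω : E → AltAlt E k ℓ) (b : SimplexField σ k ℓ) :
    bubbleMoment σ ω b = fieldInner (traceII σ ω) b := rfl

theorem fieldInner_add_left {w w' b : SimplexField σ k ℓ} (hw : IsContinuousField w)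
    (hw' : IsContinuousField w') (hb : IsContinuousField b) :
    fieldInner (w + w') b = fieldInner w b + fieldInner w' b := by
  unfold fieldInner
  rw [← MeasureTheory.integral_add (integrable_simplexMeasure (hw.frob hb))
    (integrable_simplexMeasure (hw'.frob hb))]
  congr 1
  funext x
  exact LinearMap.map_add₂ (frobBilin _ _ k ℓ) _ _ _

theorem fieldInner_add_right {w b b' : SimplexField σ k ℓ} (hw : IsContinuousField w)
    (hb : IsContinuousField b) (hb' : IsContinuousField b') :
    fieldInner w (b + b') = fieldInner w b + fieldInner w b' := by
  unfold fieldInner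
  rw [← MeasureTheory.integral_add (integrable_simplexMeasure (hw.frob hb))
    (integrable_simplexMeasure (hw.frob hb'))]
  congr 1
  funext x
  exact map_add (frobBilin _ _ k ℓ (w x)) _ _

theorem fieldInner_smul_left (c : ℝ) (w b : SimplexField σ k ℓ) :
    fieldInner (c • w) b = c * fieldInner w b := by
  unfold fieldInner
  rw [← MeasureTheory.integral_const_mul]
  congr 1
  funext x
  exact LinearMap.map_smul₂ (frobBilin _ _ k ℓ) _ _ _

theorem fieldInner_smul_right (c : ℝ) (w b : SimplexField σ k ℓ) :
    fieldInner w (c • b) = c * fieldInner w b := by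
  unfold fieldInner
  rw [← MeasureTheory.integral_const_mul]
  congr 1
  funext x
  exact map_smul (frobBilin _ _ k ℓ (w x)) _ _

theorem fieldInner_sub_left {w w' b : SimplexField σ k ℓ} (hw : IsContinuousField w)
    (hw' : IsContinuousField w') (hb : IsContinuousField b) :
    fieldInner (w - w') b = fieldInner w b - fieldInner w' b := by
  unfold fieldInner
  rw [← MeasureTheory.integral_sub (integrable_simplexMeasure (hw.frob hb))
    (integrable_simplexMeasure (hw'.frob hb))]
  congr 1
  funext x
  exact LinearMap.map_sub₂ (frobBilin _ _ k ℓ) _ _ _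

/-- A nonnegative continuous integrand with zero integral vanishes almost everywhere, hence
everywhere because the measure charges open sets. -/
theorem eq_zero_of_fieldInner_self {w : SimplexField σ k ℓ} (hw : IsContinuousField w)
    (h : fieldInner w w = 0) : w = 0 := by
  have h1 := (MeasureTheory.integral_eq_zero_iff_of_nonneg (fun x => frob_self_nonneg (w x))
    (integrable_simplexMeasure (hw.frob hw))).1 h
  have h2 := (Continuous.ae_eq_iff_eq (simplexMeasure σ) (hw.frob hw) continuous_zero).1 h1
  funext x
  exact eq_zero_of_frob_self (congrFun h2 x)

/-- Every functional on a space of polynomial fields on a simplex is represented by an element. -/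
theorem exists_fieldInner_eq {B : Submodule ℝ (SimplexField σ k ℓ)} (hB : B ≤ simplexPAlt σ k ℓ)
    (g : Module.Dual ℝ B) : ∃ w ∈ B, ∀ b : B, fieldInner w b = g b := by
  have hcont : ∀ w ∈ B, IsContinuousField w := fun w hw =>
    isContinuousField_of_mem_simplexPAlt (hB hw)
  have : Module.Finite ℝ B := Submodule.finiteDimensional_of_le hB
  let Φ : B →ₗ[ℝ] Module.Dual ℝ B := LinearMap.mk₂ ℝ
    (fun w b : B => fieldInner (w : SimplexField σ k ℓ) b)
    (fun w w' b => fieldInner_add_left (hcont _ w.2) (hcont _ w'.2) (hcont _ b.2))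
    (fun c w b => fieldInner_smul_left c _ _)
    (fun w b b' => fieldInner_add_right (hcont _ w.2) (hcont _ b.2) (hcont _ b'.2))
    (fun c w b => fieldInner_smul_right c _ _)
  have hinj : Function.Injective Φ := by
    rw [injective_iff_map_eq_zero]
    intro w hw
    have : fieldInner (w : SimplexField σ k ℓ) w = 0 :=
      congrArg (fun φ : Module.Dual ℝ B => φ w) hw
    exact Subtype.ext (eq_zero_of_fieldInner_self (hcont _ w.2) this)
  obtain ⟨w, hw⟩ := surjective_of_injective_dual Φ hinj g
  exact ⟨w, w.2, fun b => congrArg (fun φ : Module.Dual ℝ B => φ b) hw⟩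

end Moments


/-! ### The generalized trace -/

section GeneralizedTrace

variable {E : Type*} [NormedAddCommGroup E] [InnerProductSpace ℝ E]

theorem span_range_coe_basis {κ : Type*} {F : Submodule ℝ E} (e : Module.Basis κ ℝ F) :
    Submodule.span ℝ (Set.range fun a => (e a : E)) = F := by
  have : (Set.range fun a => (e a : E)) = F.subtype '' Set.range e := by
    rw [← Set.range_comp]; rfl
  rw [this, Submodule.span_image, e.span_eq, Submodule.map_top, Submodule.range_subtype]

variable [FiniteDimensional ℝ E]

/-- The orthonormal frame of `F` followed by the vectors `ν`. -/
def frameVec {F : Submodule ℝ E} {ℓ : ℕ} (h : Module.finrank ℝ F ≤ ℓ)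
    (ν : Fin (ℓ - Module.finrank ℝ F) → E) (i : Fin ℓ) : E :=
  Sum.elim (fun a => ((stdOrthonormalBasis ℝ F a : F) : E)) ν (slotEquiv h i)

theorem jStar_eq_frameVec {F : Submodule ℝ E} {ℓ : ℕ} (h : Module.finrank ℝ F ≤ ℓ) (α : Alt E ℓ)
    (ν : Fin (ℓ - Module.finrank ℝ F) → (Fᗮ : Submodule ℝ E)) :
    jStar F ℓ α ν = α (frameVec h fun j => (ν j : E)) := jStar_apply F h α ν

theorem le_span_frameVec {F : Submodule ℝ E} {ℓ : ℕ} (h : Module.finrank ℝ F ≤ ℓ)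
    (ν : Fin (ℓ - Module.finrank ℝ F) → E) :
    F ≤ Submodule.span ℝ (Set.range (frameVec h ν)) := by
  have h1 := span_range_coe_basis (stdOrthonormalBasis ℝ F).toBasis
  conv_lhs => rw [← h1]
  refine Submodule.span_mono ?_
  rintro _ ⟨a, rfl⟩
  exact ⟨(slotEquiv h).symm (Sum.inl a), by simp [frameVec]⟩

/-- If the generalized trace of `α` on `F` vanishes, so does `α` on all families of vectors whose
span contains `F`. -/
theorem map_eq_zero_of_jStar {F : Submodule ℝ E} {ℓ : ℕ} (h : Module.finrank ℝ F ≤ ℓ)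
    {α : Alt E ℓ} (hα : jStar F ℓ α = 0) {u : Fin ℓ → E}
    (hu : F ≤ Submodule.span ℝ (Set.range u)) : α u = 0 := by
  by_cases hli : LinearIndependent ℝ u
  swap
  · exact α.map_linearDependent u hli
  set W := Submodule.span ℝ (Set.range u) with hW
  have hWdim : Module.finrank ℝ W = ℓ := by
    rw [hW, finrank_span_eq_card hli, Fintype.card_fin]
  -- The frame of F completed by a basis of the complement of F inside W is a basis of W. Restricted
  -- to W, α has top degree, so its vanishing on this single basis suffices.
  have hN : Module.finrank ℝ (Fᗮ ⊓ W : Submodule ℝ E) = ℓ - Module.finrank ℝ F := by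
    have := Submodule.finrank_add_inf_finrank_orthogonal hu
    omega
  let bN := Module.finBasisOfFinrankEq ℝ (Fᗮ ⊓ W : Submodule ℝ E) hN
  let w : Fin ℓ → E := frameVec h fun j => (bN j : E)
  have hw0 : α w = 0 := by
    have h1 := jStar_eq_frameVec h α (fun j => ⟨bN j, (bN j).2.1⟩)
    rw [hα] at h1
    exact h1.symm
  have hwW : ∀ i, w i ∈ W := by
    intro i
    simp only [w, frameVec]
    rcases slotEquiv h i with a | j
    · exact hu (stdOrthonormalBasis ℝ F a).2
    · exact (bN j).2.2
  let w' : Fin ℓ → W := fun i => ⟨w i, hwW i⟩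
  have hNw : Fᗮ ⊓ W ≤ Submodule.span ℝ (Set.range w) := by
    conv_lhs => rw [← span_range_coe_basis bN]
    refine Submodule.span_mono ?_
    rintro _ ⟨j, rfl⟩
    exact ⟨(slotEquiv h).symm (Sum.inr j), by simp [w, frameVec]⟩
  have hspan : ⊤ ≤ Submodule.span ℝ (Set.range w') := by
    rw [← Submodule.map_le_map_iff_of_injective W.subtype_injective, Submodule.map_top,
      Submodule.range_subtype, Submodule.map_span, ← Set.range_comp]
    exact (Submodule.sup_orthogonal_inf_of_hasOrthogonalProjection hu).symm.le.trans
      (sup_le (le_span_frameVec h _) hNw)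
  let e := basisOfTopLeSpanOfCardEqFinrank w' hspan (by rw [Fintype.card_fin, hWdim])
  have h2 : α.compLinearMap W.subtype = 0 := by
    rw [← AlternatingMap.map_basis_eq_zero_iff e, coe_basisOfTopLeSpanOfCardEqFinrank]
    exact hw0
  exact congrArg (fun β : Alt W ℓ => β fun i => ⟨u i, Submodule.subset_span ⟨i, rfl⟩⟩) h2

theorem inner_frame_eq {F : Submodule ℝ E} (a c : Fin (Module.finrank ℝ F)) :
    inner ℝ ((stdOrthonormalBasis ℝ F a : F) : E) ((stdOrthonormalBasis ℝ F c : F) : E) =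
      if a = c then 1 else 0 :=
  orthonormal_iff_ite.1 (stdOrthonormalBasis ℝ F).orthonormal a c

/-- The generalized trace is onto. -/
theorem jStar_surjective {F : Submodule ℝ E} {ℓ : ℕ} (h : Module.finrank ℝ F ≤ ℓ) :
    Function.Surjective (jStar F ℓ) := by
  intro c
  let bN := Module.finBasis ℝ (Fᗮ : Submodule ℝ E)
  let c' : Alt (Fin (Module.finrank ℝ (Fᗮ : Submodule ℝ E)) → ℝ) (ℓ - Module.finrank ℝ F) :=
    c.compLinearMap bN.equivFun.symm.toLinearMap
  have hc : altOfCoeff (fun f => c' (coordVec f)) =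
      ((ℓ - Module.finrank ℝ F).factorial : ℝ) • c' :=
    ext_coordVec fun f => altOfCoeff_coordVec_of_alternating _
      (fun f π => map_coordVec_comp_perm c' f π) f
  let P : E →ₗ[ℝ] (Fᗮ : Submodule ℝ E) := (Fᗮ.orthogonalProjectionOnto : E →L[ℝ] Fᗮ)
  let ξ (f : Fin (ℓ - Module.finrank ℝ F) → Fin (Module.finrank ℝ (Fᗮ : Submodule ℝ E))) :
      Fin (Module.finrank ℝ F) ⊕ Fin (ℓ - Module.finrank ℝ F) → E →ₗ[ℝ] ℝ :=
    Sum.elim (fun a => (innerSL ℝ ((stdOrthonormalBasis ℝ F a : F) : E)).toLinearMap)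
      (fun j => bN.coord (f j) ∘ₗ P)
  -- D f is the wedge of the covectors dual to the frame of F with normal coordinate covectors. On a
  -- tangential-normal family its matrix is block diagonal with an identity block. The sum over all
  -- tuples f counts each normal form (ℓ - dim F)! times, whence the inverse factorial in the
  -- witness.
  let D (f : Fin (ℓ - Module.finrank ℝ F) → Fin (Module.finrank ℝ (Fᗮ : Submodule ℝ E))) :
      Alt E ℓ := Matrix.detRowAlternating.compLinearMap
        (LinearMap.pi fun i : Fin ℓ => ξ f (slotEquiv h i))
  refine ⟨((ℓ - Module.finrank ℝ F).factorial : ℝ)⁻¹ • ∑ f, c' (coordVec f) • D f, ?_⟩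
  ext ν
  have hD : ∀ f, D f (frameVec h fun j => (ν j : E)) =
      (Matrix.of fun s t => bN.equivFun (ν s) (f t)).det := by
    intro f
    have h1 : D f (frameVec h fun j => (ν j : E)) = Matrix.det ((Matrix.of fun x y =>
        ξ f y (Sum.elim (fun a => ((stdOrthonormalBasis ℝ F a : F) : E))
          (fun j => (ν j : E)) x)).submatrix (slotEquiv h) (slotEquiv h)) := rfl
    rw [h1, Matrix.det_submatrix_equiv_self]
    have h2 : (Matrix.of fun x y => ξ f y (Sum.elim
        (fun a => ((stdOrthonormalBasis ℝ F a : F) : E)) (fun j => (ν j : E)) x)) =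
        Matrix.fromBlocks 1 0 0 (Matrix.of fun s t => bN.equivFun (ν s) (f t)) := by
      ext x y
      rcases x with a | i <;> rcases y with a' | j
      · simp only [Matrix.of_apply, ξ, Sum.elim_inl, Matrix.fromBlocks_apply₁₁, Matrix.one_apply]
        exact (inner_frame_eq a' a).trans (by simp [eq_comm])
      · have hP : P ((stdOrthonormalBasis ℝ F a : F) : E) = 0 :=
          Submodule.orthogonalProjectionOnto_orthogonal_apply_eq_zero
            (stdOrthonormalBasis ℝ F a).2
        simp [ξ, hP]
      · simp only [Matrix.of_apply, ξ, Sum.elim_inl, Sum.elim_inr, Matrix.fromBlocks_apply₂₁]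
        exact (ν i).2 _ (stdOrthonormalBasis ℝ F a').2
      · have hP : P (ν i : E) = ν i :=
          Submodule.orthogonalProjectionOnto_mem_subspace_eq_self (ν i)
        simp [ξ, hP]
    rw [h2, Matrix.det_fromBlocks_zero₁₂, Matrix.det_one, one_mul]
  have hfac : ((ℓ - Module.finrank ℝ F).factorial : ℝ) ≠ 0 :=
    Nat.cast_ne_zero.2 (Nat.factorial_ne_zero _)
  have h3 : altOfCoeff (fun f => c' (coordVec f)) (fun s => bN.equivFun (ν s)) =
      ((ℓ - Module.finrank ℝ F).factorial : ℝ) * c ν := by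
    rw [hc]
    simp [c']
  rw [altOfCoeff_apply] at h3
  rw [jStar_eq_frameVec h, AlternatingMap.smul_apply, alternatingMap_sum_apply, smul_eq_mul,
    inv_mul_eq_iff_eq_mul₀ hfac, ← h3]
  refine Finset.sum_congr rfl fun f _ => ?_
  rw [AlternatingMap.smul_apply, hD, smul_eq_mul, smul_eq_mul, mul_comm]

end GeneralizedTrace


/-! ### Propagation from the `k`-dimensional faces and skeletal moments -/

section Skeletal

variable {E : Type*} [NormedAddCommGroup E] [InnerProductSpace ℝ E]

section Vertices

variable {ι : Type*} (b : AffineBasis ι ℝ E) {σ : Finset E}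

theorem affineIndependent_of_subset_range (hσ : (σ : Set E) ⊆ Set.range b) :
    AffineIndependent ℝ ((↑) : σ → E) := b.ind.range.mono hσ

theorem simplexDim_add_one (hσ : (σ : Set E) ⊆ Set.range b) (hne : σ.Nonempty) :
    simplexDim σ + 1 = σ.card := by
  have : Nonempty σ := hne.to_subtype
  have h := (affineIndependent_of_subset_range b hσ).finrank_vectorSpan_add_one
  have hr : Set.range ((↑) : σ → E) = (σ : Set E) := Subtype.range_coe
  rw [hr, Fintype.card_coe] at h
  exact h

end Vertices

variable [FiniteDimensional ℝ E] {k ℓ : ℕ}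

theorem traceIJ_apply (σ : Finset E) (ω : E → AltAlt E k ℓ) (x : simplexPts σ)
    (v : Fin k → tangent σ) :
    traceIJ σ ω x v = jStar (tangent σ) ℓ (ω x fun s => (v s : E)) := rfl

/-- The generalized trace as a linear map. -/
def traceIJLin (σ : Finset E) (k ℓ : ℕ) : (E → AltAlt E k ℓ) →ₗ[ℝ]
    (simplexPts σ → MixedAlt (tangent σ) ((tangent σ)ᗮ : Submodule ℝ E) k (ℓ - simplexDim σ)) where
  toFun := traceIJ σ
  map_add' ω ω' := by
    funext x
    exact map_add (pairTrace (tangent σ).subtype (jStar (tangent σ) ℓ)) (ω x) (ω' x)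
  map_smul' c ω := by
    funext x
    exact map_smul (pairTrace (tangent σ).subtype (jStar (tangent σ) ℓ)) c (ω x)

theorem traceIJ_add (σ : Finset E) (ω ω' : E → AltAlt E k ℓ) :
    traceIJ σ (ω + ω') = traceIJ σ ω + traceIJ σ ω' := (traceIJLin σ k ℓ).map_add ω ω'

theorem traceIJ_sub (σ : Finset E) (ω ω' : E → AltAlt E k ℓ) :
    traceIJ σ (ω - ω') = traceIJ σ ω - traceIJ σ ω' := (traceIJLin σ k ℓ).map_sub ω ω'

theorem traceIJ_sum {κ : Type*} (σ : Finset E) (s : Finset κ) (ω : κ → E → AltAlt E k ℓ) :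
    traceIJ σ (∑ a ∈ s, ω a) = ∑ a ∈ s, traceIJ σ (ω a) := map_sum (traceIJLin σ k ℓ) ω s

theorem traceII_eq_zero_of_dim_lt {σ : Finset E} (h : simplexDim σ < ℓ) (ω : E → AltAlt E k ℓ) :
    traceII σ ω = 0 := by
  funext x
  ext v u
  refine AlternatingMap.map_linearDependent _ _ fun hli => ?_
  have := hli.fintype_card_le_finrank
  rw [Fintype.card_fin] at this
  exact absurd h this.not_gt

section Propagation

variable {ι : Type*} [Fintype ι] [DecidableEq ι] (b : AffineBasis ι ℝ E) {σ : Finset E}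

theorem coordVec_not_injective {ι : Type*} [DecidableEq ι] {k : ℕ} {M : Type*} [AddCommGroup M]
    [Module ℝ M] (B : (ι → ℝ) [⋀^Fin k]→ₗ[ℝ] M) {f : Fin k → ι} (hf : ¬ Function.Injective f) :
    B (coordVec f) = 0 := by
  refine B.map_eq_zero_of_not_injective _ fun h => hf fun s t hst => h ?_
  simp only [coordVec, hst]

omit [Fintype ι] in
-- The component at f is the value of the field at a vertex of the k-face F spanned by f, on the
-- edges of F. Its generalized trace on F is zero, and the span of u contains the tangent space of
-- σ, a fortiori that of F, so `map_eq_zero_of_jStar` applies.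
theorem coordVec_apply_eq_zero_of_traceIJ
    {B : (ι → ℝ) [⋀^Fin (k + 1)]→ₗ[ℝ] Alt E ℓ} (hd : simplexDim σ ≤ ℓ)
    (h0 : ∀ F ⊆ σ, F.card = k + 1 → traceIJ F (homog b B) = 0) {f : Fin (k + 1) → ι}
    (hf : ∀ s, b (f s) ∈ σ) {u : Fin ℓ → E}
    (hu : tangent σ ≤ Submodule.span ℝ (Set.range u)) : B (coordVec f) u = 0 := by
  classical
  by_cases hinj : Function.Injective f
  swap
  · rw [coordVec_not_injective B hinj]; rfl
  let F : Finset E := Finset.univ.image (b ∘ f)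
  have hfF : ∀ s, b (f s) ∈ F := fun s => Finset.mem_image_of_mem _ (Finset.mem_univ s)
  have hFσ : F ⊆ σ := by
    intro p hp
    obtain ⟨s, _, rfl⟩ := Finset.mem_image.1 hp
    exact hf s
  have hcard : F.card = k + 1 := by
    rw [Finset.card_image_of_injective _ (b.ind.injective.comp hinj), Finset.card_fin]
  have hle : tangent F ≤ tangent σ := vectorSpan_mono ℝ (Finset.coe_subset.2 hFσ)
  have h1 : jStar (tangent F) ℓ (B (coordVec f)) = 0 := by
    have h2 := congrFun (h0 F hFσ hcard) ⟨b (f 0), subset_convexHull ℝ _ (hfF 0)⟩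
    have h3 := congrArg (fun α : MixedAlt (tangent F) ((tangent F)ᗮ : Submodule ℝ E) k
      (ℓ - simplexDim F) => α fun s =>
        ⟨b (f s.succ) - b (f 0), vsub_mem_vectorSpan ℝ (hfF _) (hfF _)⟩) h2
    rw [← homog_vertex b B f]
    exact h3
  exact map_eq_zero_of_jStar ((Submodule.finrank_mono hle).trans hd) h1 (hle.trans hu)

variable (hσ : (σ : Set E) ⊆ Set.range b)
include hσ

/-- The components with vertices in σ are killed by the previous lemma, because the arguments of the
generalized trace include a full frame of σ. This gives conformity in dimension ≤ ℓ. -/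
theorem traceIJ_eq_zero (hd : simplexDim σ ≤ ℓ) {ω : E → AltAlt E k ℓ} (hω : ω ∈ PAlt E k ℓ)
    (h0 : ∀ F ⊆ σ, F.card = k + 1 → traceIJ F ω = 0) : traceIJ σ ω = 0 := by
  obtain ⟨B, rfl⟩ := exists_eq_homog b hω
  funext x
  ext v : 1
  rw [traceIJ_apply]
  have h := homog_eq_zero b hσ (B := (jStar (tangent σ) ℓ).compAlternatingMap B) (fun f hf => ?_)
    x.2 (fun s => (v s).2)
  · exact h
  · ext ν
    change jStar (tangent σ) ℓ (B (coordVec f)) ν = 0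
    rw [jStar_eq_frameVec hd]
    exact coordVec_apply_eq_zero_of_traceIJ b hd h0 hf (le_span_frameVec _ _)

/-- In dimension exactly ℓ, any ℓ independent tangent vectors span the tangent space, so the double
trace is governed by the skeletal data too. This is the start of the induction over bubbles. -/
theorem traceII_eq_zero_of_traceIJ (hd : simplexDim σ = ℓ) {ω : E → AltAlt E k ℓ}
    (hω : ω ∈ PAlt E k ℓ) (h0 : ∀ F ⊆ σ, F.card = k + 1 → traceIJ F ω = 0) :
    traceII σ ω = 0 := by
  obtain ⟨B, rfl⟩ := exists_eq_homog b hω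
  rw [traceII_eq_zero_iff]
  intro x hx v hv u hu
  by_cases hli : LinearIndependent ℝ u
  swap
  · exact AlternatingMap.map_linearDependent _ _ hli
  have hspan : tangent σ ≤ Submodule.span ℝ (Set.range u) := by
    refine (Submodule.eq_of_le_of_finrank_eq
      (Submodule.span_le.2 (Set.range_subset_iff.2 hu)) ?_).ge
    rw [finrank_span_eq_card hli, Fintype.card_fin]
    exact hd.symm
  exact homog_eq_zero b hσ (B := (evalAlt u).compAlternatingMap B)
    (fun f hf => coordVec_apply_eq_zero_of_traceIJ b hd.le h0 hf hspan) hx hv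

end Propagation

/-- A field in `P^- Alt^{k,ℓ}` has constant `k`-form part on a `k`-dimensional simplex. -/
theorem traceIJ_const {σ : Finset E} (hd : simplexDim σ = k) {ω : E → AltAlt E k ℓ}
    (hω : ω ∈ PAlt E k ℓ) (x y : simplexPts σ) : traceIJ σ ω x = traceIJ σ ω y := by
  obtain ⟨a, c, h⟩ := hω
  ext v : 1
  rw [traceIJ_apply, traceIJ_apply]
  congr 1
  rw [h, h, AlternatingMap.add_apply, AlternatingMap.add_apply, add_right_inj, ← sub_eq_zero]
  -- The k + 1 vectors x - y, v₁, …, v_k lie in a k-dimensional space.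
  have h1 : c.curryLeft ((x : E) - y) (fun s => (v s : E)) = 0 := by
    have h2 := (c.compLinearMap (tangent σ).subtype).map_linearDependent
      (Matrix.vecCons (disp x y) v) (fun hli => by
        have := hli.fintype_card_le_finrank
        rw [Fintype.card_fin] at this
        exact absurd (this.trans hd.le) (Nat.not_succ_le_self k))
    rw [← h2, AlternatingMap.curryLeft_apply_apply, AlternatingMap.compLinearMap_apply]
    congr 1
    funext t
    refine Fin.cases rfl (fun s => rfl) t
  rw [← h1, map_sub, AlternatingMap.sub_apply]

section Moment

variable [MeasurableSpace E] [BorelSpace E] {σ : Finset E}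

theorem skeletalMoment_eq (hd : simplexDim σ = k) {ω : E → AltAlt E k ℓ} (hω : ω ∈ PAlt E k ℓ)
    (o : simplexPts σ) (c : SkeletalTest σ k ℓ) :
    skeletalMoment σ ω c = (simplexMeasure σ).real Set.univ * frob (traceIJ σ ω o) c := by
  unfold skeletalMoment
  have h : ∀ x, frob (traceIJ σ ω x) c = frob (traceIJ σ ω o) c := fun x => by
    rw [traceIJ_const hd hω x o]
  simp only [h, MeasureTheory.integral_const, smul_eq_mul]

theorem simplexMeasure_real_pos (o : simplexPts σ) : 0 < (simplexMeasure σ).real Set.univ :=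
  ENNReal.toReal_pos (isOpen_univ.measure_pos _ ⟨o, trivial⟩).ne'
    (MeasureTheory.measure_ne_top _ _)

/-- The traces are constant on σ, so the difference of their values is itself an admissible test
tensor, and σ has positive measure. -/
theorem traceIJ_eq_of_skeletalMoment (hd : simplexDim σ = k) {ω ω' : E → AltAlt E k ℓ}
    (hω : ω ∈ PAlt E k ℓ) (hω' : ω' ∈ PAlt E k ℓ)
    (h : ∀ c, skeletalMoment σ ω c = skeletalMoment σ ω' c) : traceIJ σ ω = traceIJ σ ω' := by
  funext o
  rw [← sub_eq_zero]
  refine eq_zero_of_frob_self ?_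
  have h1 := h (traceIJ σ ω o - traceIJ σ ω' o)
  rw [skeletalMoment_eq hd hω o, skeletalMoment_eq hd hω' o] at h1
  have h2 := mul_left_cancel₀ (simplexMeasure_real_pos o).ne' h1
  rw [← frobBilin_apply] at h2 ⊢
  rw [LinearMap.map_sub₂, h2, frobBilin_apply, sub_self]

theorem exists_skeletalMoment_eq (o : simplexPts σ) (f : Module.Dual ℝ (SkeletalTest σ k ℓ)) :
    ∃ c : SkeletalTest σ k ℓ, ∀ c',
      (simplexMeasure σ).real Set.univ * frob c c' = f c' := by
  have hpos := simplexMeasure_real_pos o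
  let Φ : SkeletalTest σ k ℓ →ₗ[ℝ] Module.Dual ℝ (SkeletalTest σ k ℓ) :=
    (simplexMeasure σ).real Set.univ • frobBilin _ _ _ _
  have hinj : Function.Injective Φ := by
    rw [injective_iff_map_eq_zero]
    intro c hc
    have h1 : (simplexMeasure σ).real Set.univ * frob c c = 0 :=
      congrArg (fun φ : Module.Dual ℝ (SkeletalTest σ k ℓ) => φ c) hc
    exact eq_zero_of_frob_self ((mul_eq_zero.1 h1).resolve_left hpos.ne')
  obtain ⟨c, hc⟩ := surjective_of_injective_dual Φ hinj f
  exact ⟨c, fun c' => congrArg (fun φ : Module.Dual ℝ (SkeletalTest σ k ℓ) => φ c') hc⟩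

end Moment

end Skeletal


/-! ### Extension from faces -/

section Extension

variable {E : Type*} [NormedAddCommGroup E] [InnerProductSpace ℝ E]
  {ι : Type*} [Fintype ι] [DecidableEq ι] (b : AffineBasis ι ℝ E) {k ℓ : ℕ}

/-- On a full-dimensional cell nothing is lost in the trace, and the values at the vertices on edges
are all the components of the homogeneous form. -/
theorem eq_zero_of_traceII_top {ω : E → AltAlt E k ℓ} (hω : ω ∈ PAlt E k ℓ) {K : Finset E}
    (hK : (K : Set E) = Set.range b) (h : traceII K ω = 0) : ω = 0 := by
  obtain ⟨B, rfl⟩ := exists_eq_homog b hω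
  have htop : tangent K = ⊤ := by
    change vectorSpan ℝ (K : Set E) = ⊤
    rw [hK, ← AffineSubspace.affineSpan_eq_top_iff_vectorSpan_eq_top_of_nonempty]
    · exact b.tot
    · exact ⟨b b.nonempty.some, Set.mem_range_self _⟩
  have hmem : ∀ v : E, v ∈ tangent K := fun v => by rw [htop]; trivial
  have hB : B = 0 := by
    refine ext_coordVec fun f => ?_
    ext u
    have := traceII_eq_zero_iff.1 h (b (f 0))
      (subset_convexHull ℝ _ (by rw [hK]; exact ⟨_, rfl⟩)) (fun s => b (f s.succ) - b (f 0))
      (fun s => hmem _) u (fun s => hmem _)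
    rwa [homog_vertex] at this
  rw [hB]
  rfl

variable [FiniteDimensional ℝ E] {σ : Finset E}

/-- A count of vertices. For a term to survive on F, the form indices and the k tangential value
slots must use vertices of F, so only the ℓ - k normal slots may leave F. At most (k + 1) + (ℓ - k)
= ℓ + 1 vertices are reached, fewer than σ has. -/
theorem traceIJ_realize_of_exactSupport (hσ : (σ : Set E) ⊆ Set.range b) (hk : k ≤ ℓ)
    (hcard : ℓ + 2 ≤ σ.card) {F : Finset E} (hF : (F : Set E) ⊆ Set.range b)
    (hFc : F.card = k + 1) {B : AltAlt (ι → ℝ) (k + 1) ℓ}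
    (hB : B ∈ exactSupport {i | b i ∈ σ} (k + 1) ℓ) : traceIJ F (realize b B) = 0 := by
  classical
  have hdim : simplexDim F = k := by
    have := simplexDim_add_one b hF (Finset.card_pos.1 (by omega))
    omega
  have hd : Module.finrank ℝ (tangent F) ≤ ℓ := hdim.le.trans hk
  funext x
  ext v ν
  rw [traceIJ_apply, jStar_eq_frameVec hd]
  set w := frameVec hd fun j => (ν j : E) with hw
  refine homog_eq_zero b hF
    (B := (evalAlt fun s => coordsLin b (w s)).compAlternatingMap B) (fun f hf => ?_) x.2
    (fun s => (v s).2)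
  change B (coordVec f) (fun s => coordsLin b (w s)) = 0
  rw [map_eq_sum_coordVec]
  refine Finset.sum_eq_zero fun g _ => ?_
  by_cases hg : ∀ a, b (g ((slotEquiv hd).symm (Sum.inl a))) ∈ F
  · rw [hB f g, smul_zero]
    intro heq
    let N : Finset E := Finset.univ.image fun j => b (g ((slotEquiv hd).symm (Sum.inr j)))
    have hsub : σ ⊆ F ∪ N := by
      intro p hp
      obtain ⟨i, rfl⟩ := hσ hp
      have hi : i ∈ Set.range f ∪ Set.range g := by rw [heq]; exact hp
      rcases hi with ⟨s, rfl⟩ | ⟨s, rfl⟩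
      · exact Finset.mem_union_left _ (hf s)
      · obtain ⟨y, rfl⟩ := (slotEquiv hd).symm.surjective s
        rcases y with a | j
        · exact Finset.mem_union_left _ (hg a)
        · exact Finset.mem_union_right _ (Finset.mem_image_of_mem _ (Finset.mem_univ j))
    have h1 := (Finset.card_le_card hsub).trans (Finset.card_union_le _ _)
    have h2 : N.card ≤ ℓ - simplexDim F := Finset.card_image_le.trans (by simp)
    omega
  · push Not at hg
    obtain ⟨a, ha⟩ := hg
    rw [Finset.prod_eq_zero (Finset.mem_univ ((slotEquiv hd).symm (Sum.inl a))), zero_smul]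
    refine coordsLin_eq_zero b hF ?_ ha
    rw [hw, frameVec, Equiv.apply_symm_apply]
    exact (stdOrthonormalBasis ℝ (tangent F) a).2

/-- Extension of a skeletal degree of freedom in `P^- Alt^{k,ℓ}`. -/
theorem exists_traceIJ_eq (hk : k ≤ ℓ) {F : Finset E} (hF : (F : Set E) ⊆ Set.range b)
    (hFc : F.card = k + 1) (c : SkeletalTest F k ℓ) :
    ∃ ω ∈ PAlt E k ℓ, (∀ x, traceIJ F ω x = c) ∧ ∀ F' : Finset E, (F' : Set E) ⊆ Set.range b →
      F'.card = k + 1 → F' ≠ F → traceIJ F' ω = 0 := by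
  classical
  have hdim : simplexDim F = k := by
    have := simplexDim_add_one b hF (Finset.card_pos.1 (by omega))
    omega
  have hd : Module.finrank ℝ (tangent F) ≤ ℓ := hdim.le.trans hk
  obtain ⟨s, hs⟩ := (jStar (tangent F) ℓ).exists_rightInverse_of_surjective
    (LinearMap.range_eq_top.2 (jStar_surjective hd))
  let P : E →ₗ[ℝ] tangent F := ((tangent F).orthogonalProjectionOnto : E →L[ℝ] tangent F)
  -- A constant field with the prescribed trace: c is extended by orthogonal projection in the form
  -- index and by a right inverse of the generalized trace in the value index.
  let C : AltAlt E k ℓ := s.compAlternatingMap (c.compLinearMap P)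
  have hC : (fun _ => C) ∈ PAlt E k ℓ := ⟨C, 0, fun x => by simp⟩
  obtain ⟨B₀, hB₀⟩ := exists_eq_homog b hC
  -- Keeping only the components indexed by exactly the vertices of F leaves C unchanged on F in the
  -- form index and removes it from every other k-face, as for Whitney forms.
  let β : (Fin (k + 1) → ι) → Alt E ℓ := fun f =>
    if ∀ i, b i ∈ F ↔ i ∈ Set.range f then (((k + 1).factorial : ℝ)⁻¹) • B₀ (coordVec f) else 0
  have hβ : ∀ (f : Fin (k + 1) → ι) (π : Equiv.Perm (Fin (k + 1))),
      β (f ∘ π) = ((Equiv.Perm.sign π : ℤ) : ℝ) • β f := by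
    intro f π
    simp only [β, EquivLike.range_comp]
    split_ifs
    · rw [map_coordVec_comp_perm, smul_comm]
    · rw [smul_zero]
  have hB : ∀ f, altOfCoeff β (coordVec f) =
      if ∀ i, b i ∈ F ↔ i ∈ Set.range f then B₀ (coordVec f) else 0 := by
    intro f
    rw [altOfCoeff_coordVec_of_alternating β hβ]
    simp only [β]
    split_ifs
    · rw [smul_smul, mul_inv_cancel₀ (Nat.cast_ne_zero.2 (Nat.factorial_ne_zero _)), one_smul]
    · rw [smul_zero]
  refine ⟨homog b (altOfCoeff β), homog_mem_PAlt b _, fun x => ?_, fun F' hF' hF'c hne => ?_⟩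
  · ext v : 1
    rw [traceIJ_apply]
    have h1 : homog b (altOfCoeff β) x (fun s => (v s : E)) = C fun s => (v s : E) := by
      have h2 := homog_eq_zero b hF (B := altOfCoeff β - B₀) (fun f hf => ?_) x.2
        (fun s => (v s).2)
      · have h3 : C = homog b B₀ (x : E) := congrFun hB₀ x
        rw [h3]
        exact sub_eq_zero.1 h2
      · rw [AlternatingMap.sub_apply, hB]
        split_ifs with hc
        · rw [sub_self]
        -- An injective f into the k + 1 vertices of F would exhaust them, so the discarded
        -- components within F vanish already by alternation.
        · have hinj : ¬ Function.Injective f := by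
            intro hinj
            apply hc
            have himg : Finset.univ.image (b ∘ f) = F := by
              refine Finset.eq_of_subset_of_card_le ?_ ?_
              · intro p hp
                obtain ⟨s, _, rfl⟩ := Finset.mem_image.1 hp
                exact hf s
              · rw [Finset.card_image_of_injective _ (b.ind.injective.comp hinj),
                  Finset.card_fin, hFc]
            intro i
            rw [← himg]
            simp [b.ind.injective.eq_iff]
          rw [coordVec_not_injective B₀ hinj, sub_zero]
    rw [h1]
    have h3 : C (fun s => (v s : E)) = s (c v) := by
      change s (c fun i => P (v i)) = s (c v)
      congr 2
      funext i
      exact Submodule.orthogonalProjectionOnto_mem_subspace_eq_self (v i)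
    rw [h3]
    exact LinearMap.congr_fun hs (c v)
  · funext x
    ext v : 1
    rw [traceIJ_apply, homog_eq_zero b hF' (B := altOfCoeff β) (fun f hf => ?_) x.2
      (fun s => (v s).2), map_zero]
    · rfl
    · rw [hB, if_neg]
      intro hc
      apply hne
      refine (Finset.eq_of_subset_of_card_le (fun p hp => ?_) (by omega)).symm
      obtain ⟨i, rfl⟩ := hF hp
      obtain ⟨s, rfl⟩ := (hc i).1 hp
      exact hf s

theorem exists_traceII_eq_of_mem_simplexPAlt (o : simplexPts σ) {w : SimplexField σ k ℓ}
    (hw : w ∈ simplexPAlt σ k ℓ) : ∃ ω ∈ PAlt E k ℓ, traceII σ ω = w := by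
  obtain ⟨a, c, h⟩ := hw o
  let P : E →ₗ[ℝ] tangent σ := ((tangent σ).orthogonalProjectionOnto : E →L[ℝ] tangent σ)
  have hP : ∀ y : tangent σ, P y = y :=
    fun y => Submodule.orthogonalProjectionOnto_mem_subspace_eq_self y
  let C : AltAlt E (k + 1) ℓ := pairTrace P (pullAlt P ℓ) c
  -- Pullback along the orthogonal projection, the identity on tangent vectors; subtracting the
  -- contraction with o moves the Koszul origin from o to 0.
  refine ⟨fun x => (pairTrace P (pullAlt P ℓ) a - C.curryLeft (o : E)) + C.curryLeft x,
    ⟨_, _, fun x => rfl⟩, ?_⟩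
  funext x
  ext v u
  have h1 : ∀ y : E, C.curryLeft y (fun s => (v s : E)) (fun s => (u s : E)) =
      c (Matrix.vecCons (P y) v) u := by
    intro y
    change c (fun i => P (Matrix.vecCons y (fun s => (v s : E)) i)) (fun i => P (u i)) = _
    simp only [hP]
    congr 2
    funext t
    refine Fin.cases rfl (fun s => hP _) t
  have h2 : pairTrace P (pullAlt P ℓ) a (fun s => (v s : E)) (fun s => (u s : E)) = a v u := by
    change a (fun i => P (v i)) (fun i => P (u i)) = _
    simp only [hP]
  have h3 : c.curryLeft (disp x o) v u =
      c (Matrix.vecCons (P x) v) u - c (Matrix.vecCons (P o) v) u := by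
    have h4 : disp x o = P x - P o := by
      rw [← map_sub]
      exact (hP (disp x o)).symm
    rw [h4, map_sub]
    rfl
  rw [traceII_apply, h, AlternatingMap.add_apply, AlternatingMap.add_apply,
    AlternatingMap.add_apply, AlternatingMap.add_apply, AlternatingMap.sub_apply,
    AlternatingMap.sub_apply, h1, h1, h2, h3]
  ring

/-- Extension of a bubble in `P^- Alt^{k,ℓ}`. -/
theorem exists_traceII_eq (hσ : (σ : Set E) ⊆ Set.range b) (hk : k ≤ ℓ)
    (hcard : ℓ + 2 ≤ σ.card) {w : SimplexField σ k ℓ} (hw : w ∈ BAlt k ℓ σ) :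
    ∃ ω ∈ PAlt E k ℓ, traceII σ ω = w ∧
      (∀ τ : Finset E, (τ : Set E) ⊆ Set.range b → ¬ σ ⊆ τ → traceII τ ω = 0) ∧
      ∀ F : Finset E, (F : Set E) ⊆ Set.range b → F.card = k + 1 → traceIJ F ω = 0 := by
  obtain ⟨p, hp⟩ : σ.Nonempty := Finset.card_pos.1 (by omega)
  obtain ⟨ω₀, hω₀, hw₀⟩ :=
    exists_traceII_eq_of_mem_simplexPAlt ⟨p, subset_convexHull ℝ _ hp⟩ hw.1
  obtain ⟨B, hB, hBσ⟩ := exists_exactSupport b hσ hω₀ fun τ hτ hne hτσ => by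
    have := hw.2 τ hτ hne hτσ
    rw [← hw₀] at this
    exact this
  exact ⟨realize b B, realize_mem_PAlt b B, hBσ.trans hw₀,
    fun τ hτ h => traceII_realize_of_exactSupport b hτ hσ hB h,
    fun F hF hFc => traceIJ_realize_of_exactSupport b hσ hk hcard hF hFc hB⟩

/-- A field in `P^- Alt^{k,ℓ+1}` whose double traces vanish in dimensions up to `m ≥ ℓ` is the
image under `S_†` of a field with the same property and vanishing skeletal traces. -/
theorem exists_sDagger_eq_of_traceII (hk : k < ℓ) (d : ℕ) :
    ∀ m, ℓ ≤ m → Fintype.card ι ≤ m + 1 + d → ∀ η ∈ PAlt E k (ℓ + 1),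
    (∀ τ : Finset E, (τ : Set E) ⊆ Set.range b → τ.card ≤ m + 1 → traceII τ η = 0) →
    ∃ ω ∈ PAlt E (k + 1) ℓ, (∀ x, sDagger k ℓ (ω x) = η x) ∧
      (∀ τ : Finset E, (τ : Set E) ⊆ Set.range b → τ.card ≤ m + 1 → traceII τ ω = 0) ∧
      ∀ F : Finset E, (F : Set E) ⊆ Set.range b → F.card = k + 2 → traceIJ F ω = 0 := by
  classical
  have hK : ((Finset.univ.image b : Finset E) : Set E) = Set.range b := by simp
  have hKc : (Finset.univ.image b).card = Fintype.card ι :=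
    Finset.card_image_of_injective _ b.ind.injective
  -- d counts the levels of faces still to be treated above dimension m. At d = 0 the whole cell is
  -- covered, so η = 0 and the zero field solves the equation.
  induction d with
  | zero =>
    intro m _ hd η hη h0
    have h1 : η = 0 := eq_zero_of_traceII_top b hη hK (h0 _ hK.le (by omega))
    subst h1
    exact ⟨0, zero_mem _, fun x => map_zero _, fun τ _ _ => traceII_zero τ,
      fun F _ _ => (traceIJLin F (k + 1) ℓ).map_zero⟩
  | succ d ih =>
    intro m hm hd η hη h0
    -- On each (m+1)-face σ the trace of η is a bubble, represented by a tensor of exact support σ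
    -- and lifted through S_† with the same support. Faces of this dimension do not see one
    -- another's tensors, so the sum can be subtracted from η and the dimension raised.
    set S := (Finset.univ.image b).powersetCard (m + 2) with hS
    have hSr : ∀ σ ∈ S, (σ : Set E) ⊆ Set.range b := fun σ hσ => by
      rw [← hK]; exact Finset.coe_subset.2 (Finset.mem_powersetCard.1 hσ).1
    have hSc : ∀ σ ∈ S, σ.card = m + 2 := fun σ hσ => (Finset.mem_powersetCard.1 hσ).2
    have hex : ∀ σ ∈ S, ∃ B ∈ exactSupport {i | b i ∈ σ} (k + 1) (ℓ + 1),
        traceII σ (realize b B) = traceII σ η := fun σ hσ =>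
      exists_exactSupport b (hSr σ hσ) hη fun τ hτ _ hne =>
        h0 τ ((Finset.coe_subset.2 hτ).trans (hSr σ hσ)) (by
          have := Finset.card_lt_card (Finset.ssubset_iff_subset_ne.2 ⟨hτ, hne⟩)
          have := hSc σ hσ
          omega)
    choose! B hB hBσ using hex
    have hex' : ∀ σ ∈ S, ∃ C ∈ exactSupport {i | b i ∈ σ} (k + 2) ℓ,
        sDagger (k + 1) ℓ C = B σ := fun σ hσ => exists_sDagger_eq hk (hB σ hσ)
    choose! C hC hCB using hex'
    have hvan : ∀ σ ∈ S, ∀ τ : Finset E, τ.card ≤ m + 2 → τ ≠ σ → ¬ σ ⊆ τ := by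
      intro σ hσ τ hτ hne hsub
      exact hne (Finset.eq_of_subset_of_card_le hsub (by rw [hSc σ hσ]; exact hτ)).symm
    have hη' : η - ∑ σ ∈ S, realize b (B σ) ∈ PAlt E k (ℓ + 1) :=
      sub_mem hη (sum_mem fun σ _ => realize_mem_PAlt b _)
    obtain ⟨ω₂, hω₂, hS₂, ht₂, hs₂⟩ := ih (m + 1) (by omega) (by omega) _ hη' (by
      intro τ hτ hτc
      rw [traceII_sub, traceII_sum]
      by_cases hτS : τ ∈ S
      · rw [Finset.sum_eq_single τ, hBσ τ hτS, sub_self]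
        · intro σ hσ hne
          exact traceII_realize_of_exactSupport b hτ (hSr σ hσ) (hB σ hσ)
            (hvan σ hσ τ hτc hne.symm)
        · exact fun h => absurd hτS h
      · have hc : τ.card ≤ m + 1 := by
          by_contra hc
          apply hτS
          rw [hS, Finset.mem_powersetCard]
          refine ⟨?_, by omega⟩
          rw [← Finset.coe_subset, hK]
          exact hτ
        rw [h0 τ hτ hc, Finset.sum_eq_zero, sub_zero]
        intro σ hσ
        exact traceII_realize_of_exactSupport b hτ (hSr σ hσ) (hB σ hσ)
          (hvan σ hσ τ hτc fun h => hτS (h ▸ hσ)))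
    -- The minus sign compensates that of `sDagger_realize`.
    refine ⟨ω₂ - ∑ σ ∈ S, realize b (C σ), sub_mem hω₂ (sum_mem fun σ _ => realize_mem_PAlt b _),
      fun x => ?_, fun τ hτ hτc => ?_, fun F hF hFc => ?_⟩
    · rw [Pi.sub_apply, map_sub, hS₂, Finset.sum_apply, map_sum, Pi.sub_apply, Finset.sum_apply]
      have : ∀ σ ∈ S, sDagger k ℓ (realize b (C σ) x) = -realize b (B σ) x := fun σ hσ => by
        rw [sDagger_realize, hCB σ hσ]
      rw [Finset.sum_congr rfl this, Finset.sum_neg_distrib]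
      abel
    · rw [traceII_sub, ht₂ τ hτ (by omega), traceII_sum, Finset.sum_eq_zero, sub_zero]
      intro σ hσ
      refine traceII_realize_of_exactSupport b hτ (hSr σ hσ) (hC σ hσ)
        (hvan σ hσ τ (by omega) ?_)
      rintro rfl
      have := hSc τ hσ
      omega
    · rw [traceIJ_sub, hs₂ F hF hFc, traceIJ_sum, Finset.sum_eq_zero, sub_zero]
      intro σ hσ
      exact traceIJ_realize_of_exactSupport b (hSr σ hσ) hk (by rw [hSc σ hσ]; omega) hF hFc
        (hC σ hσ)

end Extension


/-! ### Unisolvence and conformity -/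

section Unisolvence

variable {E : Type*} [NormedAddCommGroup E] [InnerProductSpace ℝ E] {k ℓ : ℕ}

/-- The bubble spaces `B` contain the double traces of the fields in `P ⊆ P^- Alt^{k,ℓ}` that
vanish on all proper faces. -/
structure IsCompatible (P : Submodule ℝ (E → AltAlt E k ℓ))
    (B : (σ : Finset E) → Submodule ℝ (SimplexField σ k ℓ)) : Prop where
  le : P ≤ PAlt E k ℓ
  bubble_le : ∀ σ, B σ ≤ simplexPAlt σ k ℓ
  trace_mem : ∀ ω ∈ P, ∀ σ : Finset E,
    (∀ τ ⊆ σ, τ.Nonempty → τ ≠ σ → traceII τ ω = 0) → traceII σ ω ∈ B σ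

theorem traceII_mem_simplexPAlt (σ : Finset E) {ω : E → AltAlt E k ℓ} (hω : ω ∈ PAlt E k ℓ) :
    traceII σ ω ∈ simplexPAlt σ k ℓ := by
  obtain ⟨a, c, h⟩ := hω
  intro o
  refine ⟨pairTrace (tangent σ).subtype (pullAlt (tangent σ).subtype ℓ)
    (a + c.curryLeft (o : E)), pairTrace (tangent σ).subtype (pullAlt (tangent σ).subtype ℓ) c,
    fun x => ?_⟩
  ext v u
  have h1 : pairTrace (tangent σ).subtype (pullAlt (tangent σ).subtype ℓ) c
      (Matrix.vecCons (disp x o) v) u =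
      c.curryLeft ((x : E) - o) (fun s => (v s : E)) (fun s => (u s : E)) := by
    rw [AlternatingMap.curryLeft_apply_apply]
    change c (fun i => ((Matrix.vecCons (disp x o) v i : tangent σ) : E)) _ = _
    congr 2
    funext t
    refine Fin.cases rfl (fun s => rfl) t
  rw [traceII_apply, h]
  simp only [AlternatingMap.add_apply]
  rw [AlternatingMap.curryLeft_apply_apply (pairTrace _ _ c), h1, map_sub]
  change _ = (a + c.curryLeft (o : E)) (fun s => (v s : E)) (fun s => (u s : E)) + _
  simp only [AlternatingMap.add_apply, AlternatingMap.sub_apply]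
  ring

theorem isCompatible_Alt : IsCompatible (PAlt E k ℓ) (BAlt k ℓ) where
  le := le_rfl
  bubble_le _ := BAlt_le
  trace_mem _ hω σ h := ⟨traceII_mem_simplexPAlt σ hω, fun τ hτ hne hτσ => h τ hτ hne hτσ⟩

theorem PW_zero : PW E 0 ℓ = PAlt E 0 ℓ :=
  le_antisymm inf_le_left fun _ h => ⟨h, fun _ _ => trivial⟩

theorem BW_zero : (BW 0 ℓ : (σ : Finset E) → Submodule ℝ (SimplexField σ 0 ℓ)) = BAlt 0 ℓ :=
  funext fun _ => le_antisymm inf_le_left fun _ h => ⟨h, fun _ _ => trivial⟩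

theorem mem_PW_succ {ω : E → AltAlt E (k + 1) ℓ} :
    ω ∈ PW E (k + 1) ℓ ↔ ω ∈ PAlt E (k + 1) ℓ ∧ ∀ x, sDagger k ℓ (ω x) = 0 :=
  ⟨fun h => ⟨h.1, fun x => h.2 x trivial⟩, fun h => ⟨h.1, fun x _ => h.2 x⟩⟩

theorem mem_BW_succ {σ : Finset E} {w : SimplexField σ (k + 1) ℓ} :
    w ∈ BW (k + 1) ℓ σ ↔ w ∈ BAlt (k + 1) ℓ σ ∧ ∀ x, sDagger k ℓ (w x) = 0 :=
  ⟨fun h => ⟨h.1, fun x => h.2 x trivial⟩, fun h => ⟨h.1, fun x _ => h.2 x⟩⟩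

/-- S_† commutes with the double trace, so traces of fields in its kernel stay in the kernel. -/
theorem isCompatible_W : IsCompatible (PW E k ℓ) (BW k ℓ) := by
  cases k with
  | zero => rw [PW_zero, BW_zero]; exact isCompatible_Alt
  | succ k =>
    refine ⟨inf_le_left, fun _ => BW_le, fun ω hω σ h => ?_⟩
    rw [mem_PW_succ] at hω
    refine mem_BW_succ.2 ⟨isCompatible_Alt.trace_mem ω hω.1 σ h, fun x => ?_⟩
    have h1 := congrFun (traceII_sDagger (σ := σ) ω) x
    simp only [hω.2] at h1
    rw [← h1]
    exact congrFun (traceII_zero σ) x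

variable [FiniteDimensional ℝ E]

/-- Every degree of freedom is attained by a shape function with the other degrees of freedom on
simplices of at most the same dimension vanishing. -/
structure HasExtensions {ι : Type*} (b : AffineBasis ι ℝ E) (P : Submodule ℝ (E → AltAlt E k ℓ))
    (B : (σ : Finset E) → Submodule ℝ (SimplexField σ k ℓ)) : Prop where
  skeletal : ∀ F : Finset E, (F : Set E) ⊆ Set.range b → F.card = k + 1 →
    ∀ c : SkeletalTest F k ℓ, ∃ ω ∈ P, (∀ x, traceIJ F ω x = c) ∧
      ∀ F' : Finset E, (F' : Set E) ⊆ Set.range b → F'.card = k + 1 → F' ≠ F → traceIJ F' ω = 0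
  bubble : ∀ σ : Finset E, (σ : Set E) ⊆ Set.range b → ℓ + 2 ≤ σ.card → ∀ w ∈ B σ,
    ∃ ω ∈ P, traceII σ ω = w ∧
      (∀ τ : Finset E, (τ : Set E) ⊆ Set.range b → τ.card ≤ σ.card → τ ≠ σ → traceII τ ω = 0) ∧
      ∀ F : Finset E, (F : Set E) ⊆ Set.range b → F.card = k + 1 → traceIJ F ω = 0

section HasExtensions

variable {ι : Type*} [Fintype ι] [DecidableEq ι] (b : AffineBasis ι ℝ E)

theorem hasExtensions_Alt (hk : k ≤ ℓ) : HasExtensions b (PAlt E k ℓ) (BAlt k ℓ) where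
  skeletal _ hF hFc c := exists_traceIJ_eq b hk hF hFc c
  bubble σ hσ hσc w hw := by
    obtain ⟨ω, hω, h1, h2, h3⟩ := exists_traceII_eq b hσ hk hσc hw
    exact ⟨ω, hω, h1, fun τ hτ hc hne => h2 τ hτ fun h =>
      hne (Finset.eq_of_subset_of_card_le h hc).symm, h3⟩

/-- An extension ω without symmetry is corrected by ω' with S_†ω' = S_†ω and with vanishing traces
wherever values are prescribed. For k = 0 there is nothing to correct. -/
theorem hasExtensions_W (hk : k ≤ ℓ) : HasExtensions b (PW E k ℓ) (BW k ℓ) := by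
  cases k with
  | zero => rw [PW_zero, BW_zero]; exact hasExtensions_Alt b hk
  | succ k =>
    constructor
    · intro F hF hFc c
      obtain ⟨ω, hω, h1, h2⟩ := (hasExtensions_Alt b hk).skeletal F hF hFc c
      -- S_†ω takes values in (ℓ+1)-forms, whose double traces in dimension ≤ ℓ are automatically
      -- zero; the lifting therefore starts at m = ℓ.
      obtain ⟨ω', hω', hS, -, h3⟩ := exists_sDagger_eq_of_traceII b (Nat.lt_of_succ_le hk)
        (Fintype.card ι) ℓ le_rfl (by omega) _ (sDagger_mem_PAlt hω) (by
          intro τ hτ hτc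
          rcases τ.eq_empty_or_nonempty with rfl | hne
          · rw [traceII_eq_zero_iff]
            intro x hx
            simp at hx
          · have := simplexDim_add_one b hτ hne
            exact traceII_eq_zero_of_dim_lt (by omega) _)
      refine ⟨ω - ω', mem_PW_succ.2 ⟨sub_mem hω hω', fun x => ?_⟩, fun x => ?_,
        fun F' hF' hF'c hne => ?_⟩
      · rw [Pi.sub_apply, map_sub, hS, sub_self]
      · rw [traceIJ_sub, h3 F hF hFc, sub_zero, h1]
      · rw [traceIJ_sub, h3 F' hF' hF'c, sub_zero, h2 F' hF' hF'c hne]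
    · intro σ hσ hσc w hw
      rw [mem_BW_succ] at hw
      obtain ⟨ω, hω, h1, h2, h3⟩ := (hasExtensions_Alt b hk).bubble σ hσ hσc w hw.1
      -- Here the lifting starts at m = dim σ: S_†ω has no double trace on σ since the bubble w lies
      -- in the kernel, and none on other faces of at most this dimension since ω has none.
      obtain ⟨ω', hω', hS, h4, h5⟩ := exists_sDagger_eq_of_traceII b (Nat.lt_of_succ_le hk)
        (Fintype.card ι) (σ.card - 1) (by omega) (by omega) _ (sDagger_mem_PAlt hω) (by
          intro τ hτ hτc
          rw [traceII_sDagger]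
          by_cases hτσ : τ = σ
          · subst hτσ
            rw [h1]
            exact funext hw.2
          · rw [h2 τ hτ (by omega) hτσ]
            exact funext fun x => map_zero _)
      refine ⟨ω - ω', mem_PW_succ.2 ⟨sub_mem hω hω', fun x => ?_⟩, ?_, fun τ hτ hτc hne => ?_,
        fun F hF hFc => ?_⟩
      · rw [Pi.sub_apply, map_sub, hS, sub_self]
      · rw [traceII_sub, h1, h4 σ hσ (by omega), sub_zero]
      · rw [traceII_sub, h2 τ hτ hτc hne, h4 τ hτ (by omega), sub_zero]
      · rw [traceIJ_sub, h3 F hF hFc, h5 F hF hFc, sub_zero]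

end HasExtensions

variable [MeasurableSpace E] [BorelSpace E] {P : Submodule ℝ (E → AltAlt E k ℓ)}
  {B : (σ : Finset E) → Submodule ℝ (SimplexField σ k ℓ)}

/-- If the degrees of freedom on the faces of `σ` vanish, so does the double trace on `σ`. -/
theorem traceII_eq_zero_of_moments {ι : Type*} [Fintype ι] [DecidableEq ι]
    (b : AffineBasis ι ℝ E) (hPB : IsCompatible P B) {ω : E → AltAlt E k ℓ} (hω : ω ∈ P) :
    ∀ σ : Finset E, (σ : Set E) ⊆ Set.range b →
      (∀ F ⊆ σ, F.card = k + 1 → traceIJ F ω = 0) →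
      (∀ τ ⊆ σ, τ.Nonempty → ℓ < simplexDim τ → ∀ c ∈ B τ, bubbleMoment τ ω c = 0) →
      traceII σ ω = 0 := by
  intro σ
  induction σ using Finset.strongInduction with
  | H σ ih =>
    intro hσ h0 h1
    rcases lt_trichotomy (simplexDim σ) ℓ with hd | hd | hd
    · exact traceII_eq_zero_of_dim_lt hd ω
    · exact traceII_eq_zero_of_traceIJ b hσ hd (hPB.le hω) h0
    · have hne : σ.Nonempty := by
        by_contra hc
        rw [Finset.not_nonempty_iff_eq_empty] at hc
        subst hc
        rw [simplexDim, tangent, Finset.coe_empty, vectorSpan_empty, finrank_bot] at hd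
        omega
      -- By induction the traces on proper faces vanish, so the trace on σ is a bubble and may be
      -- tested against itself.
      have hmem := hPB.trace_mem ω hω σ fun τ hτ _ hτσ =>
        ih τ (Finset.ssubset_iff_subset_ne.2 ⟨hτ, hτσ⟩) ((Finset.coe_subset.2 hτ).trans hσ)
          (fun F hF => h0 F (hF.trans hτ)) (fun ρ hρ => h1 ρ (hρ.trans hτ))
      exact eq_zero_of_fieldInner_self (isContinuousField_traceII (hPB.le hω))
        (h1 σ subset_rfl hne hd _ hmem)

/-- The vertices of a nondegenerate simplex of full dimension as an affine basis. -/
def cellBasis {K : Finset E} (h : AffineIndependent ℝ ((↑) : K → E))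
    (hc : K.card = Module.finrank ℝ E + 1) : AffineBasis K ℝ E :=
  ⟨(↑), h, by
    rw [h.affineSpan_eq_top_iff_card_eq_finrank_add_one, Fintype.card_coe, hc]⟩

omit [MeasurableSpace E] [BorelSpace E] in
theorem range_cellBasis {K : Finset E} (h : AffineIndependent ℝ ((↑) : K → E))
    (hc : K.card = Module.finrank ℝ E + 1) : Set.range (cellBasis h hc) = (K : Set E) :=
  Subtype.range_coe

/-- The system is block triangular in the dimension of the faces, with diagonal blocks that are Gram
matrices of definite inner products. -/
theorem isUnisolvent_of_hasExtensions {K : Finset E} (hK : AffineIndependent ℝ ((↑) : K → E))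
    (hKc : K.card = Module.finrank ℝ E + 1) (hPB : IsCompatible P B)
    (hext : HasExtensions (cellBasis hK hKc) P B) : IsUnisolvent K P B := by
  classical
  intro f g
  have hr := range_cellBasis hK hKc
  have hsub : ∀ {σ : Finset E}, σ ⊆ K → (σ : Set E) ⊆ Set.range (cellBasis hK hKc) := fun h => by
    rw [hr]; exact Finset.coe_subset.2 h
  have hdim : ∀ {σ : Finset E}, σ ⊆ K → σ.Nonempty → simplexDim σ + 1 = σ.card := fun h hne =>
    simplexDim_add_one (cellBasis hK hKc) (hsub h) hne
  have hpt : ∀ {σ : Finset E}, σ.Nonempty → Nonempty (simplexPts σ) := fun ⟨p, hp⟩ =>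
    ⟨⟨p, subset_convexHull ℝ _ hp⟩⟩
  obtain ⟨ω, hω, hs, hb⟩ : ∃ ω ∈ P,
      (∀ σ ⊆ K, σ.Nonempty → simplexDim σ = k → ∀ c, skeletalMoment σ ω c = f σ c) ∧
      (∀ σ ⊆ K, σ.Nonempty → ℓ < simplexDim σ → ∀ c : B σ, bubbleMoment σ ω c = g σ c) := by
    -- N bounds the bubble faces treated so far: those with at most ℓ + 1 + N vertices. For N = 0
    -- there are none, since dimension > ℓ requires ℓ + 2 vertices.
    have hlev : ∀ N, ∃ ω ∈ P,
        (∀ σ ⊆ K, σ.Nonempty → simplexDim σ = k → ∀ c, skeletalMoment σ ω c = f σ c) ∧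
        (∀ σ ⊆ K, σ.Nonempty → ℓ < simplexDim σ → σ.card ≤ ℓ + 1 + N →
          ∀ c : B σ, bubbleMoment σ ω c = g σ c) := by
      intro N
      induction N with
      | zero =>
        have hex : ∀ F ∈ K.powersetCard (k + 1), ∃ ω ∈ P, (∀ c' (o : simplexPts F),
            (simplexMeasure F).real Set.univ * frob (traceIJ F ω o) c' = f F c') ∧
            ∀ F' ⊆ K, F'.card = k + 1 → F' ≠ F → traceIJ F' ω = 0 := by
          intro F hF
          obtain ⟨hFK, hFc⟩ := Finset.mem_powersetCard.1 hF
          obtain ⟨o⟩ := hpt (Finset.card_pos.1 (by omega : 0 < F.card))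
          obtain ⟨c, hc⟩ := exists_skeletalMoment_eq o (f F)
          obtain ⟨ω, hω, h1, h2⟩ := hext.skeletal F (hsub hFK) hFc c
          refine ⟨ω, hω, fun c' o' => ?_, fun F' hF' => h2 F' (hsub hF')⟩
          rw [h1, hc]
        choose! ω hω h1 h2 using hex
        refine ⟨∑ F ∈ K.powersetCard (k + 1), ω F, sum_mem hω, fun σ hσ hne hd c => ?_,
          fun σ hσ hne hd hc => ?_⟩
        · have hσS : σ ∈ K.powersetCard (k + 1) := by
            rw [Finset.mem_powersetCard]
            exact ⟨hσ, by rw [← hdim hσ hne, hd]⟩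
          obtain ⟨o⟩ := hpt hne
          rw [skeletalMoment_eq hd (hPB.le (sum_mem hω)) o, traceIJ_sum,
            Finset.sum_eq_single_of_mem σ hσS, h1 σ hσS]
          intro F hF hne'
          exact h2 F hF σ hσ (Finset.mem_powersetCard.1 hσS).2 hne'.symm
        · have := hdim hσ hne
          omega
      | succ N ih =>
        obtain ⟨ω, hω, hs, hb⟩ := ih
        have hcont := fun σ : Finset E => isContinuousField_traceII (σ := σ) (hPB.le hω)
        have hex : ∀ σ ∈ K.powersetCard (ℓ + 2 + N), ∃ ω' ∈ P,
            (∀ c : B σ, fieldInner (traceII σ ω') c = g σ c - fieldInner (traceII σ ω) c) ∧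
            (∀ τ ⊆ K, τ.card ≤ σ.card → τ ≠ σ → traceII τ ω' = 0) ∧
            ∀ F ⊆ K, F.card = k + 1 → traceIJ F ω' = 0 := by
          intro σ hσ
          obtain ⟨hσK, hσc⟩ := Finset.mem_powersetCard.1 hσ
          have hcB : ∀ c : B σ, IsContinuousField (c : SimplexField σ k ℓ) := fun c =>
            isContinuousField_of_mem_simplexPAlt (hPB.bubble_le σ c.2)
          -- The bubble represents the residual: the prescribed moment minus the one already
          -- produced by ω.
          obtain ⟨w, hw, hwg⟩ := exists_fieldInner_eq (hPB.bubble_le σ)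
            (g σ - { toFun := fun c : B σ => fieldInner (traceII σ ω) c
                     map_add' := fun c c' => fieldInner_add_right (hcont σ) (hcB c) (hcB c')
                     map_smul' := fun a c => fieldInner_smul_right a _ _ })
          obtain ⟨ω', hω', h1, h2, h3⟩ := hext.bubble σ (hsub hσK) (by omega) w hw
          exact ⟨ω', hω', fun c => by rw [h1, hwg]; rfl, fun τ hτ => h2 τ (hsub hτ),
            fun F hF => h3 F (hsub hF)⟩
        choose! ω' hω' h1 h2 h3 using hex
        refine ⟨ω + ∑ σ ∈ K.powersetCard (ℓ + 2 + N), ω' σ, add_mem hω (sum_mem hω'),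
          fun σ hσ hne hd c => ?_, fun σ hσ hne hd hc c => ?_⟩
        · rw [← hs σ hσ hne hd c]
          have : traceIJ σ (ω + ∑ σ ∈ K.powersetCard (ℓ + 2 + N), ω' σ) = traceIJ σ ω := by
            rw [traceIJ_add, traceIJ_sum, Finset.sum_eq_zero, add_zero]
            intro ρ hρ
            refine h3 ρ hρ σ hσ ?_
            rw [← hdim hσ hne, hd]
          unfold skeletalMoment
          rw [this]
        · rw [bubbleMoment_eq, traceII_add, traceII_sum]
          by_cases hσT : σ ∈ K.powersetCard (ℓ + 2 + N)
          · rw [Finset.sum_eq_single_of_mem σ hσT, fieldInner_add_left (hcont σ)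
              (isContinuousField_traceII (hPB.le (hω' σ hσT)))
              (isContinuousField_of_mem_simplexPAlt (hPB.bubble_le σ c.2)), h1 σ hσT]
            · ring
            · intro ρ hρ hne'
              refine h2 ρ hρ σ hσ ?_ hne'.symm
              rw [(Finset.mem_powersetCard.1 hρ).2]
              omega
          · rw [Finset.sum_eq_zero, add_zero]
            · refine hb σ hσ hne hd ?_ c
              by_contra hlt
              exact hσT (Finset.mem_powersetCard.2 ⟨hσ, by omega⟩)
            · intro ρ hρ
              refine h2 ρ hρ σ hσ ?_ fun h => hσT (h ▸ hρ)
              rw [(Finset.mem_powersetCard.1 hρ).2]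
              omega
    obtain ⟨ω, hω, hs, hb⟩ := hlev K.card
    exact ⟨ω, hω, hs, fun σ hσ hne hd => hb σ hσ hne hd (by
      have := Finset.card_le_card hσ
      omega)⟩
  refine ⟨ω, ⟨hω, hs, hb⟩, ?_⟩
  rintro ω' ⟨hω', hs', hb'⟩
  rw [← sub_eq_zero]
  refine eq_zero_of_traceII_top (cellBasis hK hKc) (sub_mem (hPB.le hω') (hPB.le hω)) hr.symm ?_
  refine traceII_eq_zero_of_moments (cellBasis hK hKc) hPB (sub_mem hω' hω) K hr.symm.le ?_ ?_
  · intro F hF hFc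
    have hne : F.Nonempty := Finset.card_pos.1 (by omega)
    have hd : simplexDim F = k := by
      have := hdim hF hne
      omega
    rw [traceIJ_sub, traceIJ_eq_of_skeletalMoment hd (hPB.le hω') (hPB.le hω) fun c => by
      rw [hs F hF hne hd, hs' F hF hne hd], sub_self]
  · intro τ hτ hne hd c hc
    rw [bubbleMoment_eq, traceII_sub, fieldInner_sub_left
      (isContinuousField_traceII (hPB.le hω')) (isContinuousField_traceII (hPB.le hω))
      (isContinuousField_of_mem_simplexPAlt (hPB.bubble_le τ hc)), sub_eq_zero]
    exact (hb' τ hτ hne hd ⟨c, hc⟩).trans (hb τ hτ hne hd ⟨c, hc⟩).symm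

/-- The two fields are polynomials on the whole space, so their difference is a shape function
without degrees of freedom on the faces of σ, and the vanishing results apply in the barycentric
coordinates of either cell. -/
theorem isIotaJConforming_of_mem_feSpace {T : Geometry.SimplicialComplex ℝ E}
    (hPB : IsCompatible P B) {ω : Cell T → E → AltAlt E k ℓ} (hω : ω ∈ feSpace T P B) :
    IsIotaJConforming T ω := by
  classical
  obtain ⟨hmem, hdof⟩ := hω
  intro K K' σ hσ hσ' hne
  let b := cellBasis (T.indep K.2.1) K.2.2
  have hr : Set.range b = (K.1 : Set E) := range_cellBasis _ _
  have hσb : (σ : Set E) ⊆ Set.range b := by rw [hr]; exact Finset.coe_subset.2 hσ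
  have h0 : ∀ F ⊆ σ, F.card = k + 1 → traceIJ F (ω K - ω K') = 0 := by
    intro F hF hFc
    have hFne : F.Nonempty := Finset.card_pos.1 (by omega)
    have hd : simplexDim F = k := by
      have := simplexDim_add_one b ((Finset.coe_subset.2 hF).trans hσb) hFne
      omega
    rw [traceIJ_sub, traceIJ_eq_of_skeletalMoment hd (hPB.le (hmem K)) (hPB.le (hmem K'))
      ((hdof K K' F (hF.trans hσ) (hF.trans hσ') hFne).1 hd), sub_self]
  have h1 : ∀ τ ⊆ σ, τ.Nonempty → ℓ < simplexDim τ → ∀ c ∈ B τ,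
      bubbleMoment τ (ω K - ω K') c = 0 := by
    intro τ hτ hτne hd c hc
    rw [bubbleMoment_eq, traceII_sub, fieldInner_sub_left
      (isContinuousField_traceII (hPB.le (hmem K))) (isContinuousField_traceII (hPB.le (hmem K')))
      (isContinuousField_of_mem_simplexPAlt (hPB.bubble_le τ hc)), sub_eq_zero]
    exact (hdof K K' τ (hτ.trans hσ) (hτ.trans hσ') hτne).2 hd c hc
  have hsub : ω K - ω K' ∈ P := sub_mem (hmem K) (hmem K')
  constructor
  · intro hd
    rw [← sub_eq_zero, ← traceIJ_sub]
    exact traceIJ_eq_zero b hσb hd (hPB.le hsub) h0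
  · intro _
    rw [← sub_eq_zero, ← traceII_sub]
    exact traceII_eq_zero_of_moments b hPB hsub σ hσb h0 h1

end Unisolvence


/-! ### The vector-valued Lagrange element -/

section Lagrange

variable {E : Type*} [NormedAddCommGroup E] [InnerProductSpace ℝ E] {k ℓ : ℕ}

theorem mem_PAlt_zero_iff {ω : E → AltAlt E 0 ℓ} :
    ω ∈ PAlt E 0 ℓ ↔ ∃ A : E →ᵃ[ℝ] AltAlt E 0 ℓ, ∀ x, ω x = A x := by
  constructor
  · rintro ⟨a, c, h⟩
    exact ⟨AffineMap.const ℝ E a + c.curryLeft.toAffineMap, fun x => h x⟩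
  · rintro ⟨A, h⟩
    refine ⟨A 0, AlternatingMap.alternatizeUncurryFin A.linear, fun x => ?_⟩
    refine (h x).trans (((congrFun A.decomp x).trans (add_comm _ _)).trans (congrArg (A 0 + ·) ?_))
    ext v : 1
    rw [AlternatingMap.curryLeft_apply_apply, AlternatingMap.alternatizeUncurryFin_apply]
    simp only [Nat.reduceAdd, Finset.univ_unique, Fin.default_eq_zero, Finset.sum_singleton,
      Fin.val_zero, pow_zero, one_smul, Matrix.cons_val_zero]
    rw [removeNth_zero_vecCons]

theorem tangent_singleton (p : E) : tangent ({p} : Finset E) = ⊥ := by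
  rw [tangent, Finset.coe_singleton, vectorSpan_singleton]

theorem simplexDim_singleton (p : E) : simplexDim ({p} : Finset E) = 0 := by
  rw [simplexDim, tangent_singleton, finrank_bot]

theorem traceII_congr {σ : Finset E} {ω ω' : E → AltAlt E k ℓ}
    (h : ∀ x ∈ convexHull ℝ (σ : Set E), ω x = ω' x) : traceII σ ω = traceII σ ω' := by
  funext x
  rw [traceII, traceII, h x x.2]

theorem eqOn_convexHull {F : Type*} [AddCommGroup F] [Module ℝ F] {s : Set E} {A A' : E →ᵃ[ℝ] F}
    (h : ∀ p ∈ s, A p = A' p) : ∀ x ∈ convexHull ℝ s, A x = A' x := by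
  have hc : Convex ℝ ((A - A') ⁻¹' {0}) := (convex_singleton (0 : F)).affine_preimage _
  intro x hx
  have := convexHull_min (fun p hp => by simp [h p hp]) hc hx
  exact sub_eq_zero.1 this

variable [FiniteDimensional ℝ E]

/-- A vertex has zero tangent space, so the generalized trace there retains the whole form. -/
theorem eq_of_traceIJ_singleton {p : E} {ω ω' : E → AltAlt E 0 ℓ}
    (h : traceIJ {p} ω = traceIJ {p} ω') : ω p = ω' p := by
  rw [← sub_eq_zero, ← traceIJ_sub] at h
  rw [← sub_eq_zero]
  ext v u
  have h1 := congrArg (fun w => w ⟨p, subset_convexHull ℝ _ (by simp)⟩ ![]) h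
  have h2 : jStar (tangent {p}) ℓ ((ω - ω') p v) = 0 := by
    rw [Subsingleton.elim v fun s => ((![] : Fin 0 → tangent ({p} : Finset E)) s : E)]
    exact h1
  exact map_eq_zero_of_jStar (by rw [tangent_singleton, finrank_bot]; exact ℓ.zero_le) h2
    (by rw [tangent_singleton]; exact bot_le)

theorem traceIJ_congr {σ : Finset E} {ω ω' : E → AltAlt E k ℓ}
    (h : ∀ x ∈ convexHull ℝ (σ : Set E), ω x = ω' x) : traceIJ σ ω = traceIJ σ ω' := by
  funext x
  rw [traceIJ, traceIJ, h x x.2]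

variable [MeasurableSpace E] [BorelSpace E]

theorem mem_feSpace_of_eqOn {T : Geometry.SimplicialComplex ℝ E}
    {P : Submodule ℝ (E → AltAlt E k ℓ)} {B : (σ : Finset E) → Submodule ℝ (SimplexField σ k ℓ)}
    {ω : Cell T → E → AltAlt E k ℓ} (hP : ∀ K, ω K ∈ P)
    (h : ∀ K K' : Cell T, ∀ x ∈ convexHull ℝ (K.1 : Set E), x ∈ convexHull ℝ (K'.1 : Set E) →
      ω K x = ω K' x) : ω ∈ feSpace T P B := by
  refine ⟨hP, fun K K' σ hσ hσ' _ => ?_⟩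
  have h' : ∀ x ∈ convexHull ℝ (σ : Set E), ω K x = ω K' x := fun x hx =>
    h K K' x (convexHull_mono (Finset.coe_subset.2 hσ) hx)
      (convexHull_mono (Finset.coe_subset.2 hσ') hx)
  constructor
  · intro _ c
    rw [skeletalMoment, skeletalMoment, traceIJ_congr h']
  · intro _ c _
    rw [bubbleMoment, bubbleMoment, traceII_congr h']

/-- Two cells meet inside the convex hull of their common vertices, and affine functions that agree
at these vertices agree on the hull. Conversely, fields agreeing on shared points have equal moments
against any tests, so the choice of bubbles is immaterial. -/
theorem feSpace_PAlt_zero (T : Geometry.SimplicialComplex ℝ E)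
    (B : (σ : Finset E) → Submodule ℝ (SimplexField σ 0 ℓ)) :
    feSpace T (PAlt E 0 ℓ) B =
      {ω | (∀ K, ∃ A : E →ᵃ[ℝ] AltAlt E 0 ℓ, ∀ x, ω K x = A x) ∧
        ∀ (K K' : Cell T) (x : E), x ∈ convexHull ℝ (K.1 : Set E) →
          x ∈ convexHull ℝ (K'.1 : Set E) → ω K x = ω K' x} := by
  ext ω
  constructor
  · rintro ⟨hP, hdof⟩
    refine ⟨fun K => mem_PAlt_zero_iff.1 (hP K), fun K K' x hx hx' => ?_⟩
    obtain ⟨A, hA⟩ := mem_PAlt_zero_iff.1 (hP K)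
    obtain ⟨A', hA'⟩ := mem_PAlt_zero_iff.1 (hP K')
    rw [hA, hA']
    refine eqOn_convexHull (s := (K.1 : Set E) ∩ K'.1) (fun p hp => ?_) x
      (T.inter_subset_convexHull K.2.1 K'.2.1 ⟨hx, hx'⟩)
    rw [← hA, ← hA']
    exact eq_of_traceIJ_singleton (traceIJ_eq_of_skeletalMoment (simplexDim_singleton p) (hP K)
      (hP K') ((hdof K K' {p} (Finset.singleton_subset_iff.2 hp.1)
        (Finset.singleton_subset_iff.2 hp.2) (Finset.singleton_nonempty p)).1
          (simplexDim_singleton p)))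
  · rintro ⟨hA, h⟩
    exact mem_feSpace_of_eqOn (fun K => mem_PAlt_zero_iff.2 (hA K))
      fun K K' x hx hx' => h K K' x hx hx'

end Lagrange


/-! ### Matrix proxies -/

section Proxy

variable {M : Type*} [AddCommGroup M] [Module ℝ M]

open scoped Matrix

/-- The cross product as an alternating map. -/
def crossAlt : EuclideanSpace ℝ (Fin 3) [⋀^Fin 2]→ₗ[ℝ] (Fin 3 → ℝ) where
  toFun u := crossProduct (u 0).ofLp (u 1).ofLp
  map_update_add' u i x y := by
    rcases Fin.exists_fin_two.1 ⟨i, rfl⟩ with h | h <;> subst h <;>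
      simp [Function.update_of_ne]
  map_update_smul' u i c x := by
    rcases Fin.exists_fin_two.1 ⟨i, rfl⟩ with h | h <;> subst h <;>
      simp [Function.update_of_ne]
  map_eq_zero_of_eq' u i j h hij := by
    rcases Fin.exists_fin_two.1 ⟨i, rfl⟩ with hi | hi <;>
      rcases Fin.exists_fin_two.1 ⟨j, rfl⟩ with hj | hj <;> subst hi <;> subst hj <;>
      simp_all

theorem crossAlt_apply (u : Fin 2 → EuclideanSpace ℝ (Fin 3)) :
    crossAlt u = crossProduct (u 0).ofLp (u 1).ofLp := rfl

/-- Every alternating bilinear map in three dimensions is a linear function of the cross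
product. -/
theorem exists_eq_comp_crossAlt (α : EuclideanSpace ℝ (Fin 3) [⋀^Fin 2]→ₗ[ℝ] M) :
    ∃ L : (Fin 3 → ℝ) →ₗ[ℝ] M, α = L.compAlternatingMap crossAlt := by
  let e : Fin 3 → EuclideanSpace ℝ (Fin 3) := fun i => EuclideanSpace.single i 1
  -- Since e₁ × e₂ = e₀ and cyclically, the values of α on these pairs prescribe L on the basis.
  let w : Fin 3 → M := ![α ![e 1, e 2], α ![e 2, e 0], α ![e 0, e 1]]
  refine ⟨(Pi.basisFun ℝ (Fin 3)).constr ℝ w, ?_⟩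
  have hsw : ∀ a b : EuclideanSpace ℝ (Fin 3), α ![a, b] = -α ![b, a] := fun a b => by
    have := α.map_swap ![b, a] (i := 0) (j := 1) (by simp)
    rw [← this]
    congr 1
    funext i
    fin_cases i <;> rfl
  have hL : ∀ y : Fin 3 → ℝ, (Pi.basisFun ℝ (Fin 3)).constr ℝ w y = ∑ i, y i • w i := fun y => by
    rw [Module.Basis.constr_apply_fintype]
    rfl
  refine Module.Basis.ext_alternating (EuclideanSpace.basisFun (Fin 3) ℝ).toBasis
    fun f hf => ?_
  rw [LinearMap.compAlternatingMap_apply, hL, crossAlt_apply]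
  have h1 : (fun i => (EuclideanSpace.basisFun (Fin 3) ℝ).toBasis (f i)) = ![e (f 0), e (f 1)] := by
    funext i
    fin_cases i <;> simp [e]
  rw [h1]
  have h01 : f 0 ≠ f 1 := fun h => absurd (hf h) (by simp)
  generalize f 0 = i at h01 ⊢
  generalize f 1 = j at h01 ⊢
  fin_cases i <;> fin_cases j <;>
    first
    | exact absurd rfl h01
    | (simp [Fin.sum_univ_three, cross_apply, w, e]; done)
    | (simp [Fin.sum_univ_three, cross_apply, w, e]; exact hsw _ _)

/-- The linear map `y ↦ y · A (u₁ × u₂)` into the 2-forms. -/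
def proxyLin : Matrix (Fin 3) (Fin 3) ℝ →ₗ[ℝ]
    (Fin 3 → ℝ) →ₗ[ℝ] Alt (EuclideanSpace ℝ (Fin 3)) 2 where
  toFun A :=
    { toFun := fun y => (Matrix.toLinearMap₂' ℝ A y).compAlternatingMap crossAlt
      map_add' := fun v v' => by ext; simp
      map_smul' := fun c v => by ext; simp }
  map_add' A A' := by ext; simp
  map_smul' c A := by ext; simp

theorem proxyLin_apply (A : Matrix (Fin 3) (Fin 3) ℝ) (y : Fin 3 → ℝ)
    (u : Fin 2 → EuclideanSpace ℝ (Fin 3)) :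
    proxyLin A y u = y ⬝ᵥ A *ᵥ (crossProduct (u 0).ofLp (u 1).ofLp) :=
  Matrix.toLinearMap₂'_apply' A y _

theorem proxyLin_injective : Function.Injective proxyLin := by
  refine (injective_iff_map_eq_zero proxyLin).2 fun A hA => ?_
  have h : ∀ (i : Fin 3) (a b : EuclideanSpace ℝ (Fin 3)),
      (Pi.single i 1 : Fin 3 → ℝ) ⬝ᵥ A *ᵥ (crossProduct a.ofLp b.ofLp) = 0 := fun i a b => by
    have := proxyLin_apply A (Pi.single i 1) ![a, b]
    rw [hA] at this
    exact this.symm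
  ext i j
  have h0 := h i (EuclideanSpace.single (j + 1) 1) (EuclideanSpace.single (j + 2) 1)
  rw [single_dotProduct, one_mul] at h0
  fin_cases j <;>
    simpa [cross_apply, Matrix.mulVec, dotProduct, Fin.sum_univ_three] using h0

theorem proxyLin_surjective : Function.Surjective proxyLin := by
  intro L
  choose l hl using fun i => exists_eq_comp_crossAlt (L (Pi.single i 1))
  refine ⟨Matrix.of fun i j => l i (Pi.single j 1), ?_⟩
  ext i u
  rw [LinearMap.comp_apply, LinearMap.comp_apply, proxyLin_apply, LinearMap.single_apply, hl,
    LinearMap.compAlternatingMap_apply, crossAlt_apply, single_dotProduct, one_mul]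
  generalize crossProduct (u 0).ofLp (u 1).ofLp = z
  conv_rhs => rw [pi_eq_sum_univ' z, map_sum]
  simp [Matrix.mulVec, dotProduct, mul_comm]

/-- The `(1,2)`-form with matrix proxy `A`. -/
def proxyForm : Matrix (Fin 3) (Fin 3) ℝ →ₗ[ℝ] AltAlt (EuclideanSpace ℝ (Fin 3)) 1 2 where
  toFun A := AlternatingMap.ofSubsingleton ℝ _ _ 0
    (proxyLin A ∘ₗ (WithLp.linearEquiv 2 ℝ (Fin 3 → ℝ)).toLinearMap)
  map_add' A A' := by ext; simp
  map_smul' c A := by ext; simp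

theorem proxyForm_apply (A : Matrix (Fin 3) (Fin 3) ℝ) (v : Fin 1 → EuclideanSpace ℝ (Fin 3))
    (u : Fin 2 → EuclideanSpace ℝ (Fin 3)) :
    proxyForm A v u = (v 0).ofLp ⬝ᵥ A *ᵥ (crossProduct (u 0).ofLp (u 1).ofLp) :=
  proxyLin_apply A _ u

theorem proxyForm_injective : Function.Injective proxyForm := by
  refine (injective_iff_map_eq_zero proxyForm).2 fun A hA => proxyLin_injective ?_
  rw [map_zero]
  refine LinearMap.ext fun y => ?_
  exact congrArg (fun α => α fun _ => WithLp.toLp 2 y) hA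

theorem proxyForm_surjective : Function.Surjective proxyForm := by
  intro α
  obtain ⟨A, hA⟩ := proxyLin_surjective
    (((AlternatingMap.ofSubsingleton ℝ (EuclideanSpace ℝ (Fin 3)) _ (0 : Fin 1)).symm α) ∘ₗ
      (WithLp.linearEquiv 2 ℝ (Fin 3 → ℝ)).symm.toLinearMap)
  refine ⟨A, ?_⟩
  ext v : 1
  change proxyLin A (v 0).ofLp = α v
  rw [hA]
  change α (fun _ => v 0) = α v
  congr 1
  funext i
  rw [Subsingleton.elim i 0]

theorem isProxy_iff {ω : EuclideanSpace ℝ (Fin 3) → AltAlt (EuclideanSpace ℝ (Fin 3)) 1 2}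
    {U : EuclideanSpace ℝ (Fin 3) → Matrix (Fin 3) (Fin 3) ℝ} :
    IsProxy ω U ↔ ∀ x, ω x = proxyForm (U x) := by
  constructor
  · intro h x
    ext v u
    rw [h x, proxyForm_apply]
  · intro h x v u
    rw [h, proxyForm_apply]

/-- The alternating sum is a 3-form in u, hence a multiple of the determinant, and the multiple is
the trace of A. So symmetry in the sense of S_† means tracelessness of the proxy. -/
theorem sDagger_proxyForm (A : Matrix (Fin 3) (Fin 3) ℝ) (v : Fin 0 → EuclideanSpace ℝ (Fin 3))
    (u : Fin 3 → EuclideanSpace ℝ (Fin 3)) :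
    sDagger 0 2 (proxyForm A) v u =
      A.trace * ((u 0).ofLp ⬝ᵥ crossProduct (u 1).ofLp (u 2).ofLp) := by
  have h : ∀ j : Fin 3, proxyForm A (Matrix.vecCons (u j) v) (j.removeNth u) =
      (u j).ofLp ⬝ᵥ A *ᵥ crossProduct (j.removeNth u 0).ofLp (j.removeNth u 1).ofLp :=
    fun j => proxyForm_apply A _ _
  rw [sDagger_apply]
  refine (Finset.sum_congr rfl fun j _ => congrArg _ (h j)).trans ?_
  rw [Fin.sum_univ_three]
  change (-1) ^ 0 * ((u 0).ofLp ⬝ᵥ A *ᵥ crossProduct (u 1).ofLp (u 2).ofLp) +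
    (-1) ^ 1 * ((u 1).ofLp ⬝ᵥ A *ᵥ crossProduct (u 0).ofLp (u 2).ofLp) +
    (-1) ^ 2 * ((u 2).ofLp ⬝ᵥ A *ᵥ crossProduct (u 0).ofLp (u 1).ofLp) = _
  simp [Matrix.mulVec, dotProduct, Fin.sum_univ_three, cross_apply, Matrix.trace]
  ring

theorem sDagger_proxyForm_eq_zero_iff (A : Matrix (Fin 3) (Fin 3) ℝ) :
    sDagger 0 2 (proxyForm A) = 0 ↔ A.trace = 0 := by
  constructor
  · intro h
    have h1 := sDagger_proxyForm A ![] fun i => EuclideanSpace.single i 1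
    rw [h] at h1
    simpa [cross_apply, dotProduct, Fin.sum_univ_three] using h1.symm
  · intro h
    ext v u
    rw [sDagger_proxyForm, h, zero_mul]
    rfl

theorem crossMatrix_mulVec (x : EuclideanSpace ℝ (Fin 3)) (S : Matrix (Fin 3) (Fin 3) ℝ)
    (y : Fin 3 → ℝ) : crossMatrix x S *ᵥ y = crossProduct x.ofLp (S *ᵥ y) := by
  ext i
  fin_cases i <;>
    simp [crossMatrix, cross_apply, Matrix.mulVec, dotProduct, Fin.sum_univ_three] <;> ring

theorem trace_crossMatrix (x : EuclideanSpace ℝ (Fin 3)) (S : Matrix (Fin 3) (Fin 3) ℝ) :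
    (crossMatrix x S).trace =
      x 0 * (S 1 2 - S 2 1) + x 1 * (S 2 0 - S 0 2) + x 2 * (S 0 1 - S 1 0) := by
  simp [crossMatrix, cross_apply, Matrix.trace, Fin.sum_univ_three]
  ring

/-- The triple product identity (x × v) · z = -v · (x × z): the Koszul operator becomes, up to sign,
the columnwise cross product with x. -/
theorem curryLeft_proxyLin (N : Matrix (Fin 3) (Fin 3) ℝ) (x : EuclideanSpace ℝ (Fin 3)) :
    ((proxyLin N).compAlternatingMap crossAlt).curryLeft x = proxyForm (-crossMatrix x N) := by
  ext v u
  rw [AlternatingMap.curryLeft_apply_apply, LinearMap.compAlternatingMap_apply, proxyLin_apply,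
    proxyForm_apply, crossAlt_apply, Matrix.neg_mulVec, crossMatrix_mulVec, dotProduct_neg]
  generalize N *ᵥ _ = z
  simp [cross_apply, dotProduct, Fin.sum_univ_three]
  ring

end Proxy

/-! ### The shape functions `𝕋 + x × 𝕊` and their dimension -/

section Shape

open scoped Matrix

/-- The field of `(1,2)`-forms with matrix proxy `A + x × S`. -/
def affineProxy : Matrix (Fin 3) (Fin 3) ℝ × Matrix (Fin 3) (Fin 3) ℝ →ₗ[ℝ]
    (EuclideanSpace ℝ (Fin 3) → AltAlt (EuclideanSpace ℝ (Fin 3)) 1 2) where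
  toFun M x := proxyForm (M.1 + crossMatrix x M.2)
  map_add' M M' := by
    funext x
    rw [Pi.add_apply, ← map_add]
    congr 1
    ext i j
    fin_cases i <;> simp [crossMatrix, cross_apply] <;> ring
  map_smul' c M := by
    funext x
    rw [Pi.smul_apply, ← map_smul]
    congr 1
    ext i j
    fin_cases i <;> simp [crossMatrix, cross_apply] <;> ring

theorem affineProxy_apply (M : Matrix (Fin 3) (Fin 3) ℝ × Matrix (Fin 3) (Fin 3) ℝ)
    (x : EuclideanSpace ℝ (Fin 3)) :
    affineProxy M x = proxyForm (M.1 + crossMatrix x M.2) := rfl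

theorem affineProxy_injective : Function.Injective affineProxy := by
  refine (injective_iff_map_eq_zero affineProxy).2 fun M hM => ?_
  have h : ∀ x, M.1 + crossMatrix x M.2 = 0 := fun x => proxyForm_injective
    ((affineProxy_apply M x).symm.trans ((congrFun hM x).trans (map_zero _).symm))
  have h0 : M.1 = 0 := by
    have := h 0
    rwa [show crossMatrix 0 M.2 = 0 by ext i j; simp [crossMatrix], add_zero] at this
  refine Prod.ext h0 ?_
  ext i j
  have h1 : ∀ a b, crossMatrix (EuclideanSpace.single a 1) M.2 b j = 0 := fun a b => by
    have := h (EuclideanSpace.single a 1)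
    rw [h0, zero_add] at this
    rw [this]
    rfl
  have h2 := h1 (i + 1) (i + 2)
  fin_cases i <;> simpa [crossMatrix, cross_apply] using h2

theorem mem_PAlt_one_two_iff
    {ω : EuclideanSpace ℝ (Fin 3) → AltAlt (EuclideanSpace ℝ (Fin 3)) 1 2} :
    ω ∈ PAlt (EuclideanSpace ℝ (Fin 3)) 1 2 ↔ ω ∈ LinearMap.range affineProxy := by
  constructor
  · rintro ⟨a, c, h⟩
    obtain ⟨A, rfl⟩ := proxyForm_surjective a
    obtain ⟨L, rfl⟩ := exists_eq_comp_crossAlt c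
    obtain ⟨N, rfl⟩ := proxyLin_surjective L
    refine ⟨(A, -N), funext fun x => ?_⟩
    rw [h, curryLeft_proxyLin, affineProxy_apply, ← map_add]
    congr 2
    ext i j
    fin_cases i <;> simp [crossMatrix, cross_apply] <;> ring
  · rintro ⟨M, rfl⟩
    refine ⟨proxyForm M.1, (proxyLin (-M.2)).compAlternatingMap crossAlt, fun x => ?_⟩
    rw [curryLeft_proxyLin, affineProxy_apply, ← map_add]
    congr 2
    ext i j
    fin_cases i <;> simp [crossMatrix, cross_apply] <;> ring

/-- The trace of `A` and the axial vector of `S`. -/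
def traceAxial : Matrix (Fin 3) (Fin 3) ℝ × Matrix (Fin 3) (Fin 3) ℝ →ₗ[ℝ] Fin 4 → ℝ where
  toFun M := ![M.1.trace, M.2 1 2 - M.2 2 1, M.2 2 0 - M.2 0 2, M.2 0 1 - M.2 1 0]
  map_add' M M' := by
    ext i
    fin_cases i <;> simp <;> ring
  map_smul' c M := by
    ext i
    fin_cases i <;> simp <;> ring

theorem traceAxial_surjective : Function.Surjective traceAxial := by
  intro y
  refine ⟨(!![y 0, 0, 0; 0, 0, 0; 0, 0, 0], !![0, y 3, 0; 0, 0, y 1; y 2, 0, 0]), ?_⟩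
  ext i
  fin_cases i <;> simp [traceAxial, Matrix.trace, Fin.sum_univ_three]

theorem mem_ker_traceAxial_iff {M : Matrix (Fin 3) (Fin 3) ℝ × Matrix (Fin 3) (Fin 3) ℝ} :
    M ∈ LinearMap.ker traceAxial ↔ M.1.trace = 0 ∧ M.2.IsSymm := by
  rw [LinearMap.mem_ker]
  constructor
  · intro h
    have h0 := congrFun h 0
    have h1 := congrFun h 1
    have h2 := congrFun h 2
    have h3 := congrFun h 3
    simp only [traceAxial, LinearMap.coe_mk, AddHom.coe_mk, Matrix.cons_val, Pi.zero_apply] at *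
    refine ⟨h0, Matrix.IsSymm.ext fun i j => ?_⟩
    fin_cases i <;> fin_cases j <;> simp <;> linarith
  · rintro ⟨h0, h1⟩
    ext i
    fin_cases i <;> simp [traceAxial, h0, h1.apply]

theorem mem_ker_traceAxial_iff_forall
    {M : Matrix (Fin 3) (Fin 3) ℝ × Matrix (Fin 3) (Fin 3) ℝ} :
    M ∈ LinearMap.ker traceAxial ↔ ∀ x, (M.1 + crossMatrix x M.2).trace = 0 := by
  simp only [Matrix.trace_add, trace_crossMatrix, LinearMap.mem_ker]
  constructor
  · intro h x
    have h0 := congrFun h 0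
    have h1 := congrFun h 1
    have h2 := congrFun h 2
    have h3 := congrFun h 3
    simp only [traceAxial, LinearMap.coe_mk, AddHom.coe_mk, Matrix.cons_val, Pi.zero_apply] at *
    rw [h0, h1, h2, h3]
    ring
  · intro h
    have h0 := h 0
    have h1 := h (EuclideanSpace.single 0 1)
    have h2 := h (EuclideanSpace.single 1 1)
    have h3 := h (EuclideanSpace.single 2 1)
    simp at h0 h1 h2 h3
    ext i
    fin_cases i <;> simp [traceAxial] <;> linarith

/-- The trace of A + x × S is affine in x, with constant term tr A and linear part given by the
axial vector of S; it vanishes identically exactly when A is traceless and S symmetric. -/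
theorem PW_one_two :
    PW (EuclideanSpace ℝ (Fin 3)) 1 2 = (LinearMap.ker traceAxial).map affineProxy := by
  ext ω
  rw [mem_PW_succ, mem_PAlt_one_two_iff, Submodule.mem_map]
  constructor
  · rintro ⟨⟨M, rfl⟩, h⟩
    refine ⟨M, mem_ker_traceAxial_iff_forall.2 fun x => ?_, rfl⟩
    rw [← sDagger_proxyForm_eq_zero_iff]
    exact h x
  · rintro ⟨M, hM, rfl⟩
    refine ⟨⟨M, rfl⟩, fun x => ?_⟩
    rw [affineProxy_apply, sDagger_proxyForm_eq_zero_iff]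
    exact mem_ker_traceAxial_iff_forall.1 hM x

theorem mem_PW_one_two_iff
    (ω : EuclideanSpace ℝ (Fin 3) → AltAlt (EuclideanSpace ℝ (Fin 3)) 1 2) :
    ω ∈ PW (EuclideanSpace ℝ (Fin 3)) 1 2 ↔ ∃ U, IsProxy ω U ∧ IsHLZShape U := by
  rw [PW_one_two, Submodule.mem_map]
  constructor
  · rintro ⟨M, hM, rfl⟩
    rw [mem_ker_traceAxial_iff] at hM
    exact ⟨fun x => M.1 + crossMatrix x M.2, isProxy_iff.2 fun x => affineProxy_apply M x,
      M.1, M.2, hM.1, hM.2, fun x => rfl⟩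
  · rintro ⟨U, hU, A, S, hA, hS, h⟩
    refine ⟨(A, S), mem_ker_traceAxial_iff.2 ⟨hA, hS⟩, funext fun x => ?_⟩
    rw [affineProxy_apply, isProxy_iff.1 hU, h]

/-- The 9 + 9 entries of A and S are subject to four independent conditions. -/
theorem finrank_PW_one_two : Module.finrank ℝ (PW (EuclideanSpace ℝ (Fin 3)) 1 2) = 14 := by
  rw [PW_one_two, ← (Submodule.equivMapOfInjective affineProxy affineProxy_injective
    (LinearMap.ker traceAxial)).finrank_eq]
  have h := traceAxial.finrank_range_add_finrank_ker
  rw [LinearMap.range_eq_top.2 traceAxial_surjective, finrank_top] at h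
  simp [Module.finrank_matrix] at h
  omega

end Shape


/-! ### The Hu-Lin-Zhang element -/

section Dimension

variable {V V' M : Type*} [AddCommGroup V] [Module ℝ V] [AddCommGroup V'] [Module ℝ V']
  [AddCommGroup M] [Module ℝ M]

/-- Alternating `1`-forms are linear maps. -/
def altOneEquiv : (V →ₗ[ℝ] M) ≃ₗ[ℝ] V [⋀^Fin 1]→ₗ[ℝ] M where
  __ := AlternatingMap.ofSubsingleton ℝ V M (0 : Fin 1)
  map_add' _ _ := rfl
  map_smul' _ _ := rfl

theorem finrank_mixedAlt_one [Module.Finite ℝ V] [Module.Finite ℝ V'] {p : ℕ} (hp : p = 1) :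
    Module.finrank ℝ (MixedAlt V V' 1 p) = Module.finrank ℝ V * Module.finrank ℝ V' := by
  subst hp
  rw [← (altOneEquiv (V := V) (M := Alt V' 1)).finrank_eq, Module.finrank_linearMap,
    ← (altOneEquiv (V := V') (M := ℝ)).finrank_eq, Module.finrank_linearMap, Module.finrank_self,
    mul_one]

variable {E : Type*} [NormedAddCommGroup E] [InnerProductSpace ℝ E] [FiniteDimensional ℝ E]
  {k ℓ : ℕ}

theorem finrank_skeletalTest_one_two (hE : Module.finrank ℝ E = 3) {σ : Finset E}
    (hσ : simplexDim σ = 1) : Module.finrank ℝ (SkeletalTest σ 1 2) = 2 := by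
  have h := (tangent σ).finrank_add_finrank_orthogonal
  have h1 : Module.finrank ℝ (tangent σ) = 1 := hσ
  refine (finrank_mixedAlt_one (by rw [hσ])).trans ?_
  rw [h1]
  omega

/-- If the only bubbles are those of the cell, the dimension of the space of shape functions is the
number of the degrees of freedom on the `k`-dimensional faces and in the cell. -/
theorem finrank_eq_sum_add_finrank {P : Submodule ℝ (E → AltAlt E k ℓ)} [Module.Finite ℝ P]
    {B : (σ : Finset E) → Submodule ℝ (SimplexField σ k ℓ)} (hPB : IsCompatible P B)
    {K : Finset E} (hK : AffineIndependent ℝ ((↑) : K → E))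
    (hKc : K.card = Module.finrank ℝ E + 1) (hE : Module.finrank ℝ E = ℓ + 1)
    (hext : HasExtensions (cellBasis hK hKc) P B) :
    Module.finrank ℝ P = (∑ σ ∈ K.powersetCard (k + 1), Module.finrank ℝ (SkeletalTest σ k ℓ)) +
      Module.finrank ℝ (B K) := by
  classical
  have hr := range_cellBasis hK hKc
  have hsub : ∀ {σ : Finset E}, σ ⊆ K → (σ : Set E) ⊆ Set.range (cellBasis hK hKc) := fun h => by
    rw [hr]; exact Finset.coe_subset.2 h
  have hdim : ∀ {σ : Finset E}, σ ⊆ K → σ.Nonempty → simplexDim σ + 1 = σ.card := fun h hne =>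
    simplexDim_add_one (cellBasis hK hKc) (hsub h) hne
  have hpt : ∀ σ : K.powersetCard (k + 1), Nonempty (simplexPts σ.1) := fun σ => by
    obtain ⟨p, hp⟩ := Finset.card_pos.1
      (by have := (Finset.mem_powersetCard.1 σ.2).2; omega : 0 < σ.1.card)
    exact ⟨⟨p, subset_convexHull ℝ _ hp⟩⟩
  let o : (σ : K.powersetCard (k + 1)) → simplexPts σ.1 := fun σ => (hpt σ).some
  -- On k-faces the generalized trace is constant, so its value at one point records all skeletal
  -- degrees of freedom. Since proper faces have dimension ≤ ℓ, the double trace on K identifies the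
  -- kernel of D with the bubbles of K.
  let D : P →ₗ[ℝ] (σ : K.powersetCard (k + 1)) → SkeletalTest σ.1 k ℓ :=
    LinearMap.pi fun σ => LinearMap.proj (o σ) ∘ₗ traceIJLin σ.1 k ℓ ∘ₗ P.subtype
  have hD : ∀ ω σ, D ω σ = traceIJ σ.1 ω (o σ) := fun _ _ => rfl
  have hsurj : Function.Surjective D := by
    intro c
    have hex : ∀ σ : K.powersetCard (k + 1), ∃ ω ∈ P, (∀ x, traceIJ σ.1 ω x = c σ) ∧
        ∀ F' ⊆ K, F'.card = k + 1 → F' ≠ σ.1 → traceIJ F' ω = 0 := by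
      intro σ
      obtain ⟨h1, h2⟩ := Finset.mem_powersetCard.1 σ.2
      obtain ⟨ω, hω, h3, h4⟩ := hext.skeletal σ.1 (hsub h1) h2 (c σ)
      exact ⟨ω, hω, h3, fun F' hF' => h4 F' (hsub hF')⟩
    choose ω hω h1 h2 using hex
    refine ⟨∑ σ, ⟨ω σ, hω σ⟩, funext fun σ => ?_⟩
    rw [map_sum, Finset.sum_apply, Finset.sum_eq_single σ, hD, h1]
    · intro ρ _ hρ
      obtain ⟨h3, h4⟩ := Finset.mem_powersetCard.1 σ.2
      rw [hD, h2 ρ σ.1 h3 h4 fun h => hρ (Subtype.ext h.symm)]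
      rfl
    · intro h
      exact absurd (Finset.mem_univ σ) h
  have hker : ∀ ω : P, D ω = 0 → ∀ F ⊆ K, F.card = k + 1 →
      traceIJ F (ω : E → AltAlt E k ℓ) = 0 := by
    intro ω h F hF hFc
    have hd : simplexDim F = k := by
      have := hdim hF (Finset.card_pos.1 (by omega))
      omega
    funext x
    rw [traceIJ_const hd (hPB.le ω.2) x (o ⟨F, Finset.mem_powersetCard.2 ⟨hF, hFc⟩⟩)]
    exact congrFun h ⟨F, Finset.mem_powersetCard.2 ⟨hF, hFc⟩⟩
  have hmem : ∀ ω : LinearMap.ker D, traceII K (ω.1 : E → AltAlt E k ℓ) ∈ B K := by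
    intro ω
    refine hPB.trace_mem _ ω.1.2 K fun τ hτ hne hτK => ?_
    have hc := Finset.card_lt_card (Finset.ssubset_iff_subset_ne.2 ⟨hτ, hτK⟩)
    have hd := hdim hτ hne
    rcases lt_or_eq_of_le (by omega : simplexDim τ ≤ ℓ) with h | h
    · exact traceII_eq_zero_of_dim_lt h _
    · exact traceII_eq_zero_of_traceIJ (cellBasis hK hKc) (hsub hτ) h (hPB.le ω.1.2)
        fun F hF => hker ω.1 ω.2 F (hF.trans hτ)
  let Φ : LinearMap.ker D →ₗ[ℝ] B K :=
    (traceIILin K k ℓ ∘ₗ P.subtype ∘ₗ (LinearMap.ker D).subtype).codRestrict (B K) hmem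
  have hΦ : Function.Bijective Φ := by
    constructor
    · intro ω ω' h
      have h' : traceII K (ω.1 : E → AltAlt E k ℓ) = traceII K (ω'.1 : E → AltAlt E k ℓ) :=
        congrArg Subtype.val h
      exact Subtype.ext (Subtype.ext (sub_eq_zero.1 (eq_zero_of_traceII_top (cellBasis hK hKc)
        (sub_mem (hPB.le ω.1.2) (hPB.le ω'.1.2)) hr.symm (by rw [traceII_sub, h', sub_self]))))
    · rintro ⟨w, hw⟩
      obtain ⟨ω, hω, h1, -, h3⟩ := hext.bubble K hr.symm.le (by omega) w hw
      refine ⟨⟨⟨ω, hω⟩, funext fun σ => ?_⟩, Subtype.ext h1⟩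
      obtain ⟨h4, h5⟩ := Finset.mem_powersetCard.1 σ.2
      rw [hD, h3 σ.1 (hsub h4) h5]
      rfl
  rw [← D.finrank_range_add_finrank_ker, LinearMap.range_eq_top.2 hsurj, finrank_top,
    (LinearEquiv.ofBijective Φ hΦ).finrank_eq, Module.finrank_pi_fintype,
    Finset.sum_coe_sort (K.powersetCard (k + 1)) fun σ => Module.finrank ℝ (SkeletalTest σ k ℓ)]

/-- A tetrahedron has six edges with two degrees of freedom each, which leaves 14 - 12 for the
interior. -/
theorem finrank_BW_one_two {K : Finset (EuclideanSpace ℝ (Fin 3))}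
    (hK : AffineIndependent ℝ ((↑) : K → EuclideanSpace ℝ (Fin 3))) (hKc : K.card = 4) :
    Module.finrank ℝ (BW 1 2 K) = 2 := by
  classical
  have hE : Module.finrank ℝ (EuclideanSpace ℝ (Fin 3)) = 3 := finrank_euclideanSpace_fin
  have hKc' : K.card = Module.finrank ℝ (EuclideanSpace ℝ (Fin 3)) + 1 := by rw [hKc, hE]
  have : Module.Finite ℝ (PW (EuclideanSpace ℝ (Fin 3)) 1 2) :=
    Module.finite_of_finrank_pos (by rw [finrank_PW_one_two]; norm_num)
  have h := finrank_eq_sum_add_finrank isCompatible_W hK hKc' hE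
    (hasExtensions_W (cellBasis hK hKc') (by norm_num : 1 ≤ 2))
  rw [finrank_PW_one_two, Finset.sum_congr rfl fun σ hσ => finrank_skeletalTest_one_two hE
    (σ := σ) ?_, Finset.sum_const, Finset.card_powersetCard, hKc] at h
  · simp [Nat.choose] at h
    omega
  · obtain ⟨h1, h2⟩ := Finset.mem_powersetCard.1 hσ
    have := simplexDim_add_one (cellBasis hK hKc')
      (by rw [range_cellBasis]; exact Finset.coe_subset.2 h1)
      (Finset.card_pos.1 (by omega : 0 < σ.card))
    omega

end Dimension

section EdgeTraces

variable {E : Type*} [NormedAddCommGroup E] [InnerProductSpace ℝ E] [FiniteDimensional ℝ E]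
  {k ℓ : ℕ}

/-- A description without the orthonormal frame: the generalized trace records the values on all
families whose span contains the tangent space. -/
theorem traceIJ_eq_iff {σ : Finset E} (hd : simplexDim σ ≤ ℓ) {ω ω' : E → AltAlt E k ℓ} :
    traceIJ σ ω = traceIJ σ ω' ↔ ∀ x ∈ convexHull ℝ (σ : Set E), ∀ v : Fin k → E,
      (∀ s, v s ∈ tangent σ) → ∀ u : Fin ℓ → E,
        tangent σ ≤ Submodule.span ℝ (Set.range u) → ω x v u = ω' x v u := by
  constructor
  · intro h x hx v hv u hu
    rw [← sub_eq_zero, ← traceIJ_sub] at h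
    have h1 : jStar (tangent σ) ℓ ((ω - ω') x v) = 0 :=
      congrArg (fun w => w ⟨x, hx⟩ fun s => ⟨v s, hv s⟩) h
    exact sub_eq_zero.1 (map_eq_zero_of_jStar hd h1 hu)
  · intro h
    funext x
    ext v ν
    rw [traceIJ_apply, traceIJ_apply, jStar_eq_frameVec hd, jStar_eq_frameVec hd]
    exact h x x.2 _ (fun s => (v s).2) _ (le_span_frameVec hd _)

end EdgeTraces

section HuLinZhang

open scoped Matrix

theorem tangent_pair {E : Type*} [NormedAddCommGroup E] [InnerProductSpace ℝ E] [DecidableEq E]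
    (p q : E) : tangent ({p, q} : Finset E) = Submodule.span ℝ {q - p} := by
  rw [tangent, Finset.coe_insert, Finset.coe_singleton, vectorSpan_pair_rev]
  rfl

/-- The generalized traces on an edge are the tangential-normal components. -/
theorem traceIJ_pair_eq_iff {p q : EuclideanSpace ℝ (Fin 3)}
    [DecidableEq (EuclideanSpace ℝ (Fin 3))]
    {ω ω' : EuclideanSpace ℝ (Fin 3) → AltAlt (EuclideanSpace ℝ (Fin 3)) 1 2}
    {U U' : EuclideanSpace ℝ (Fin 3) → Matrix (Fin 3) (Fin 3) ℝ}
    (hU : IsProxy ω U) (hU' : IsProxy ω' U') :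
    traceIJ {p, q} ω = traceIJ {p, q} ω' ↔
      ∀ x ∈ segment ℝ p q, ∀ ν : EuclideanSpace ℝ (Fin 3), inner ℝ (q - p) ν = 0 →
        (q - p).ofLp ⬝ᵥ ((U x).mulVec ν.ofLp) = (q - p).ofLp ⬝ᵥ ((U' x).mulVec ν.ofLp) := by
  have hd : simplexDim ({p, q} : Finset (EuclideanSpace ℝ (Fin 3))) ≤ 2 := by
    rw [simplexDim, tangent_pair]
    exact (finrank_span_le_card {q - p}).trans (by simp)
  rw [traceIJ_eq_iff hd, Finset.coe_insert, Finset.coe_singleton, convexHull_pair, tangent_pair]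
  refine forall₂_congr fun x _ => ?_
  generalize q - p = t
  have hin : ∀ ν : EuclideanSpace ℝ (Fin 3), inner ℝ t ν = t.ofLp ⬝ᵥ ν.ofLp := fun ν => by
    rw [PiLp.inner_apply, dotProduct]
    exact Finset.sum_congr rfl fun i _ => mul_comm _ _
  constructor
  · intro h ν hν
    rcases eq_or_ne t 0 with rfl | ht
    · simp
    rw [hin] at hν
    -- The pair (t, ν × t) spans t, and t × (ν × t) = |t|² ν for ν orthogonal to t, so it tests
    -- exactly the normal direction ν.
    have h1 := h ![t] (by simp [Submodule.mem_span_singleton_self])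
      ![t, WithLp.toLp 2 (crossProduct ν.ofLp t.ofLp)]
      (Submodule.span_mono (Set.singleton_subset_iff.2 ⟨0, rfl⟩))
    rw [hU, hU'] at h1
    have h2 : crossProduct t.ofLp (crossProduct ν.ofLp t.ofLp) = (t.ofLp ⬝ᵥ t.ofLp) • ν.ofLp := by
      rw [cross_cross_eq_smul_sub_smul', dotProduct_comm ν.ofLp, hν, zero_smul, sub_zero]
    simp only [Matrix.cons_val_zero, Matrix.cons_val_one, h2, Matrix.mulVec_smul,
      dotProduct_smul, smul_eq_mul] at h1
    refine mul_left_cancel₀ (fun h0 => ht ?_) h1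
    rw [dotProduct_self_eq_zero] at h0
    exact WithLp.ofLp_injective 2 h0
  · intro h v hv u hu
    obtain ⟨c, hc⟩ := Submodule.mem_span_singleton.1 (hv 0)
    -- Conversely, t lies in the span of u₀ and u₁, so u₀ × u₁ is normal to the edge.
    have hν := h (WithLp.toLp 2 (crossProduct (u 0).ofLp (u 1).ofLp)) (by
      rw [hin]
      obtain ⟨y, hy⟩ := (Submodule.mem_span_range_iff_exists_fun ℝ).1
        (hu (Submodule.mem_span_singleton_self t))
      rw [← hy, Fin.sum_univ_two]
      simp [dot_self_cross, dot_cross_self])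
    rw [hU, hU', ← hc]
    simp only [WithLp.ofLp_smul, smul_dotProduct]
    rw [hν]

theorem feSpace_PW_one_two (T : Geometry.SimplicialComplex ℝ (EuclideanSpace ℝ (Fin 3))) :
    feSpace T (PW (EuclideanSpace ℝ (Fin 3)) 1 2) (BW 1 2) =
      {ω | ∃ U : Cell T → EuclideanSpace ℝ (Fin 3) → Matrix (Fin 3) (Fin 3) ℝ,
        (∀ K, IsProxy (ω K) (U K) ∧ IsHLZShape (U K)) ∧
        ∀ (K K' : Cell T), ∀ p ∈ K.1, p ∈ K'.1 → ∀ q ∈ K.1, q ∈ K'.1 →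
          ∀ x ∈ segment ℝ p q, ∀ ν : EuclideanSpace ℝ (Fin 3), inner ℝ (q - p) ν = 0 →
            (q - p).ofLp ⬝ᵥ ((U K x).mulVec ν.ofLp) =
              (q - p).ofLp ⬝ᵥ ((U K' x).mulVec ν.ofLp)} := by
  classical
  have hE : Module.finrank ℝ (EuclideanSpace ℝ (Fin 3)) = 3 := finrank_euclideanSpace_fin
  have hdim : ∀ (K : Cell T) {σ : Finset (EuclideanSpace ℝ (Fin 3))}, σ ⊆ K.1 → σ.Nonempty →
      simplexDim σ + 1 = σ.card := fun K σ h hne =>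
    simplexDim_add_one (cellBasis (T.indep K.2.1) K.2.2)
      (by rw [range_cellBasis]; exact Finset.coe_subset.2 h) hne
  ext ω
  constructor
  · rintro ⟨hP, hdof⟩
    choose U hU using fun K => (mem_PW_one_two_iff (ω K)).1 (hP K)
    refine ⟨U, hU, fun K K' p hp hp' q hq hq' => ?_⟩
    rcases eq_or_ne p q with rfl | hpq
    · simp
    have hσ : {p, q} ⊆ K.1 := Finset.insert_subset hp (Finset.singleton_subset_iff.2 hq)
    have hσ' : {p, q} ⊆ K'.1 := Finset.insert_subset hp' (Finset.singleton_subset_iff.2 hq')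
    have hd : simplexDim ({p, q} : Finset (EuclideanSpace ℝ (Fin 3))) = 1 := by
      have := hdim K hσ (Finset.insert_nonempty _ _)
      rw [Finset.card_pair hpq] at this
      omega
    exact (traceIJ_pair_eq_iff (hU K).1 (hU K').1).1 (traceIJ_eq_of_skeletalMoment hd (hP K).1
      (hP K').1 ((hdof K K' _ hσ hσ' (Finset.insert_nonempty _ _)).1 hd))
  · rintro ⟨U, hU, h⟩
    refine ⟨fun K => (mem_PW_one_two_iff (ω K)).2 ⟨U K, hU K⟩, fun K K' σ hσ hσ' hne => ?_⟩
    have hdσ := hdim K hσ hne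
    constructor
    · intro hd c
      obtain ⟨p, q, -, rfl⟩ := Finset.card_eq_two.1 (by omega : σ.card = 2)
      rw [skeletalMoment, skeletalMoment, (traceIJ_pair_eq_iff (hU K).1 (hU K').1).2
        (h K K' p (hσ (by simp)) (hσ' (by simp)) q (hσ (by simp)) (hσ' (by simp)))]
    · intro hd c _
      -- A shared simplex of dimension > 2 is the whole of both cells, so the interior moments
      -- impose no condition.
      have h1 : σ = K.1 := Finset.eq_of_subset_of_card_le hσ (by rw [K.2.2, hE]; omega)
      have h2 : σ = K'.1 := Finset.eq_of_subset_of_card_le hσ' (by rw [K'.2.2, hE]; omega)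
      rw [Subtype.ext (h1.symm.trans h2)]

end HuLinZhang

end TensorialWhitney

end

theorem mainTheorem5 :
    -- unisolvence and conformity of both families
    (∀ n k ℓ : ℕ, k ≤ ℓ →
      (∀ K : Finset (EuclideanSpace ℝ (Fin n)),
        AffineIndependent ℝ ((↑) : K → EuclideanSpace ℝ (Fin n)) → K.card = n + 1 →
          IsUnisolvent K (PAlt (EuclideanSpace ℝ (Fin n)) k ℓ) (BAlt k ℓ) ∧
          IsUnisolvent K (PW (EuclideanSpace ℝ (Fin n)) k ℓ) (BW k ℓ)) ∧
      (∀ T : Geometry.SimplicialComplex ℝ (EuclideanSpace ℝ (Fin n)),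
        (∀ ω ∈ feSpace T (PAlt (EuclideanSpace ℝ (Fin n)) k ℓ) (BAlt k ℓ),
          IsIotaJConforming T ω) ∧
        (∀ ω ∈ feSpace T (PW (EuclideanSpace ℝ (Fin n)) k ℓ) (BW k ℓ),
          IsIotaJConforming T ω))) ∧
    -- `k = 0`: the `Alt^ℓ`-valued Lagrange space of continuous piecewise affine fields
    (∀ (n ℓ : ℕ) (T : Geometry.SimplicialComplex ℝ (EuclideanSpace ℝ (Fin n))),
      feSpace T (PAlt (EuclideanSpace ℝ (Fin n)) 0 ℓ) (BAlt 0 ℓ) =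
        {ω | (∀ K, ∃ A : EuclideanSpace ℝ (Fin n) →ᵃ[ℝ] AltAlt (EuclideanSpace ℝ (Fin n)) 0 ℓ,
            ∀ x, ω K x = A x) ∧
          ∀ (K K' : Cell T) (x : EuclideanSpace ℝ (Fin n)),
            x ∈ convexHull ℝ (K.1 : Set (EuclideanSpace ℝ (Fin n))) →
            x ∈ convexHull ℝ (K'.1 : Set (EuclideanSpace ℝ (Fin n))) → ω K x = ω K' x}) ∧
    -- `n = 3`, `(k, ℓ) = (1, 2)`: the Hu-Lin-Zhang element
    ((∀ ω : EuclideanSpace ℝ (Fin 3) → AltAlt (EuclideanSpace ℝ (Fin 3)) 1 2,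
        ω ∈ PW (EuclideanSpace ℝ (Fin 3)) 1 2 ↔ ∃ U, IsProxy ω U ∧ IsHLZShape U) ∧
      (∀ K : Finset (EuclideanSpace ℝ (Fin 3)),
        AffineIndependent ℝ ((↑) : K → EuclideanSpace ℝ (Fin 3)) → K.card = 4 →
          (∀ σ ⊆ K, σ.card = 2 → Module.finrank ℝ (SkeletalTest σ 1 2) = 2) ∧
          Module.finrank ℝ (BW 1 2 K) = 2) ∧
      (∀ T : Geometry.SimplicialComplex ℝ (EuclideanSpace ℝ (Fin 3)),
        feSpace T (PW (EuclideanSpace ℝ (Fin 3)) 1 2) (BW 1 2) =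
          {ω | ∃ U : Cell T → EuclideanSpace ℝ (Fin 3) → Matrix (Fin 3) (Fin 3) ℝ,
            (∀ K, IsProxy (ω K) (U K) ∧ IsHLZShape (U K)) ∧
            ∀ (K K' : Cell T), ∀ p ∈ K.1, p ∈ K'.1 → ∀ q ∈ K.1, q ∈ K'.1 →
              ∀ x ∈ segment ℝ p q, ∀ ν : EuclideanSpace ℝ (Fin 3), inner ℝ (q - p) ν = 0 →
                (q - p).ofLp ⬝ᵥ ((U K x).mulVec ν.ofLp) =
                  (q - p).ofLp ⬝ᵥ ((U K' x).mulVec ν.ofLp)})) := by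
  refine ⟨fun n k ℓ hk => ⟨fun K hK hKc => ?_, fun T => ⟨fun ω hω => ?_, fun ω hω => ?_⟩⟩,
    fun n ℓ T => feSpace_PAlt_zero T _, mem_PW_one_two_iff,
    fun K hK hKc => ⟨fun σ hσ hσc => ?_, finrank_BW_one_two hK hKc⟩, feSpace_PW_one_two⟩
  · classical
    have hKc' : K.card = Module.finrank ℝ (EuclideanSpace ℝ (Fin n)) + 1 := by
      rw [hKc, finrank_euclideanSpace_fin]
    exact ⟨isUnisolvent_of_hasExtensions hK hKc' isCompatible_Alt (hasExtensions_Alt _ hk),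
      isUnisolvent_of_hasExtensions hK hKc' isCompatible_W (hasExtensions_W _ hk)⟩
  · exact isIotaJConforming_of_mem_feSpace isCompatible_Alt hω
  · exact isIotaJConforming_of_mem_feSpace isCompatible_W hω
  · have hE : Module.finrank ℝ (EuclideanSpace ℝ (Fin 3)) = 3 := finrank_euclideanSpace_fin
    refine finrank_skeletalTest_one_two hE ?_
    have := simplexDim_add_one (cellBasis hK (by rw [hKc, hE]))
      (by rw [range_cellBasis]; exact Finset.coe_subset.2 hσ)
      (Finset.card_pos.1 (by omega : 0 < σ.card))
    omega
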